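/- **Setting.** A finite bipartite separated graph $(E,C)$ consists of finite sets $E^0$ (vertices) and $E^1$ (edges), maps $s,r\colon E^1\to E^0$ such that $E^0$ is the disjoint union of $E^{0,0}=r(E^1)$ and $E^{0,1}=s(E^1)$, and, for each $v\in E^{0}$, a partition $C_v$ of $r^{-1}(v)$ into nonempty, pairwise disjoint subsets. Let $K$ be a field with involution. The Leavitt path algebra $L_K(E,C)$ is the $*$-algebra over $K$ generated by $E^0\cup E^1$ with relations - $vw=\delta_{v,w}v$ and $v=v^*$ for $v,w\in E^0$; - $r(e)e=e=e\,s(e)$ for $e\in E^1$; - $e^*f=\delta_{e,f}s(e)$ for $e,f\in X$, $X\in C_v$, $v\in E^{0,0}$; - $v=\sum_{e\in X}ee^*$ for $X\in C_v$, $v\in E^{0,0}$. It is unital with unit $\sum_{v\in E^0} v$. The graph C\*-algebra $C^*(E,C)$ is the enveloping C\*-algebra of $L_{\mathbb C}(E,C)$, i.e. the completion of $L_{\mathbb C}(E,C)$ (modulo null vectors) in its largest C\*-seminorm. Let $U$ be the multiplicative semigroup generated by $E^1\cup (E^1)^*$ in either algebra and put $e(u)=uu^*$ for $u\in U$. Let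 $L^{\rm ab}_K(E,C)$ be the quotient of $L_K(E,C)$ by the two-sided ideal generated by all commutators $[e(u),e(w)]$, $u,w\in U$, and let $\mathcal O(E,C)$ be the quotient of $C^*(E,C)$ by the closed two-sided ideal generated by these commutators. **The partial action.** Let $B_\infty$ be the commutative $\mathbb C$-subalgebra of $L^{\rm ab}_{\mathbb C}(E,C)$ generated by $1$ and the projections $e(u)$, $u\in U$, and let $\Omega(E,C)$ be the space of unital algebra homomorphisms $\chi\colon B_\infty\to\mathbb C$ with the topology of pointwise convergence, a compact Hausdorff space. For $x\in E^1$ put $\Omega_{s(x)}=\{\chi:\chi(x^*x)=1\}$ and $H_x=\{\chi:\chi(xx^*)=1\}$. These are clopen, and $$\theta_x\colon \Omega_{s(x)}\to H_x,\qquad \theta_x(\chi)(b)=\chi(x^*bx),$$ is a homeomorphism. Let $\mathbb F$ be the free group on $E^1$. For $g\in\mathbb F$ with reduced word $x_1^{\epsilon_1}\cdots x_n^{\epsilon_n}$ let $\theta_g=\theta_{x_1}^{\epsilon_1}\circ\cdots\circ\theta_{x_n}^{\epsilon_n}$, composed on the largest possible domain (so $\theta_1=\mathrm{id}$), and let $\Omega_g$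 be the clopen range of $\theta_g$. This is a partial action of $\mathbb F$ on $\Omega(E,C)$. **Crossed products.** Let $R$ be either a field $K$ with involution, with the discrete topology, or $\mathbb C$ with complex conjugation and its usual topology, and let $C_R(\Omega(E,C))$ be the $*$-algebra of continuous functions $\Omega(E,C)\to R$. For $g\in\mathbb F$ let $D_g$ be the ideal of those $f\in C_R(\Omega(E,C))$ that vanish outside $\Omega_g$, and let $\alpha_g\colon D_{g^{-1}}\to D_g$, $\alpha_g(f)=f\circ\theta_{g^{-1}}$ on $\Omega_g$ and $0$ elsewhere. The algebraic crossed product $C_R(\Omega(E,C))\rtimes_\alpha\mathbb F$ is the $*$-algebra of finite formal sums $\sum_{g} a_g\delta_g$, $a_g\in D_g$, with $$(a\delta_g)(b\delta_h)=\alpha_g(\alpha_{g^{-1}}(a)b)\,\delta_{gh},\qquad (a\delta_g)^*=\alpha_{g^{-1}}(a^*)\,\delta_{g^{-1}} .$$ The full C\*-crossed product $C(\Omega(E,C))\rtimes_\alpha\mathbb F$ is the enveloping C\*-algebra of the algebraic crossed product for $R=\mathbb C$ with its usual topology. **Statement.** Let $(E,C)$ be a finite bipartite separated graph as above. 1. For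 every field with involution $K$, with the discrete topology on $K$, there is an isomorphism of $*$-algebras over $K$ $$L^{\rm ab}_K(E,C)\;\cong\; C_K(\Omega(E,C))\rtimes_\alpha\mathbb F$$ that sends the class of $x$ to $1_{H_x}\delta_x$ for every $x\in E^1$. 2. There is an isomorphism of C\*-algebras $$\mathcal O(E,C)\;\cong\; C(\Omega(E,C))\rtimes_\alpha\mathbb F$$ onto the full C\*-crossed product that sends the class of $x$ to (the image of) $1_{H_x}\delta_x$ for every $x\in E^1$. -/

import Mathlib

set_option linter.unusedSectionVars false
set_option linter.unusedVariables false
noncomputable section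

/-- A finitely separated graph `(E, C)` with vertex set `V` and edge set `E`: for every vertex `v`,
`blocks v` (that is, `C_v`) is a partition of `r⁻¹(v)` into nonempty, pairwise disjoint finite sets.
For a finite graph this is the general notion of a separated graph. -/
structure SeparatedGraph (V E : Type*) where
  source : E → V
  range : E → V
  blocks : V → Set (Finset E)
  nonempty_of_mem : ∀ v, ∀ X ∈ blocks v, X.Nonempty
  disjoint : ∀ v, ∀ X ∈ blocks v, ∀ Y ∈ blocks v, X ≠ Y → Disjoint X Y
  range_eq_iff : ∀ v e, range e = v ↔ ∃ X ∈ blocks v, e ∈ X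

/-- The graph is bipartite: `E⁰` is the disjoint union of `E^{0,0} = r(E¹)` and `E^{0,1} = s(E¹)`,
so all edges go from `E^{0,1}` to `E^{0,0}`, no vertex of `E^{0,0}` is a source and every vertex of
`E^{0,1}` emits an edge. -/
structure SeparatedGraph.IsBipartite {V E : Type*} (G : SeparatedGraph V E) : Prop where
  disjoint : Disjoint (Set.range G.range) (Set.range G.source)
  union : Set.range G.range ∪ Set.range G.source = Set.univ

/-- The generators `v`, `e`, `e*` of the Leavitt path algebra. -/
inductive LGen (V E : Type*) where
  | vertex (v : V) : LGen V E
  | edge (e : E) : LGen V E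
  | ghost (e : E) : LGen V E

/-- The involution on generators: `v* = v` and `e ↔ e*`. -/
def LGen.adj {V E : Type*} : LGen V E → LGen V E
  | .vertex v => .vertex v
  | .edge e => .ghost e
  | .ghost e => .edge e


/-- The opposite algebra of `A` with scalars acting through the involution of the field `K`.
Conjugate-linear anti-homomorphisms into `A` are `K`-algebra homomorphisms into it. -/
def ConjOp (_K A : Type*) : Type _ := Aᵐᵒᵖ

namespace ConjOp
variable (K : Type*) {A : Type*} [Field K] [StarRing K] [Ring A] [Algebra K A]
instance : Ring (ConjOp K A) := inferInstanceAs (Ring Aᵐᵒᵖ)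
instance : Algebra K (ConjOp K A) :=
  RingHom.toAlgebra' (((algebraMap K A).comp (starRingEnd K)).toOpposite
    fun _ _ => Algebra.commutes _ _)
    fun c _ => MulOpposite.unop_injective (Algebra.commutes (starRingEnd K c) _).symm
/-- The identity map `A → A` seen as a map into the twisted opposite algebra. -/
def mk : A →+ ConjOp K A := (MulOpposite.opAddEquiv : A ≃+ Aᵐᵒᵖ).toAddMonoidHom
theorem mk_mul (a b : A) : mk K a * mk K b = mk K (b * a) := rfl
theorem mk_one : mk K (1 : A) = 1 := rfl
end ConjOp

section Leavitt

variable (K : Type*) [Field K] {V E : Type*} [Fintype V]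

open FreeAlgebra LGen in
/-- The relations (V), (E), (SCK1), (SCK2) of the Leavitt path algebra of a separated graph, together
with the adjoints of (E). The vertex set is finite, so `∑ v` is a unit element of the algebra with
these generators and relations; `sum_vertex` records this inside the unital free algebra. -/
inductive SeparatedGraph.LRel (G : SeparatedGraph V E) :
    FreeAlgebra K (LGen V E) → FreeAlgebra K (LGen V E) → Prop
  | vertex_mul_self (v : V) : G.LRel (ι K (vertex v) * ι K (vertex v)) (ι K (vertex v))
  | vertex_mul_of_ne (v w : V) (h : v ≠ w) : G.LRel (ι K (vertex v) * ι K (vertex w)) 0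
  | sum_vertex : G.LRel (∑ v, ι K (vertex v)) 1
  | range_mul_edge (e : E) : G.LRel (ι K (vertex (G.range e)) * ι K (edge e)) (ι K (edge e))
  | edge_mul_source (e : E) : G.LRel (ι K (edge e) * ι K (vertex (G.source e))) (ι K (edge e))
  | ghost_mul_range (e : E) : G.LRel (ι K (ghost e) * ι K (vertex (G.range e))) (ι K (ghost e))
  | source_mul_ghost (e : E) : G.LRel (ι K (vertex (G.source e)) * ι K (ghost e)) (ι K (ghost e))
  | sck1_self (e : E) : G.LRel (ι K (ghost e) * ι K (edge e)) (ι K (vertex (G.source e)))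
  | sck1_of_ne (v : V) (X : Finset E) (hX : X ∈ G.blocks v) (e f : E) (he : e ∈ X) (hf : f ∈ X)
      (hne : e ≠ f) : G.LRel (ι K (ghost e) * ι K (edge f)) 0
  | sck2 (v : V) (X : Finset E) (hX : X ∈ G.blocks v) :
      G.LRel (ι K (vertex v)) (∑ e ∈ X, ι K (edge e) * ι K (ghost e))

/-- The Leavitt path algebra `L_K(E, C)`, by generators and relations. -/
def LeavittPathAlgebra (G : SeparatedGraph V E) : Type _ := RingQuot (G.LRel K)

namespace LeavittPathAlgebra
variable (G : SeparatedGraph V E)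

instance : Ring (LeavittPathAlgebra K G) := inferInstanceAs (Ring (RingQuot (G.LRel K)))
instance : Algebra K (LeavittPathAlgebra K G) :=
  inferInstanceAs (Algebra K (RingQuot (G.LRel K)))

/-- The image of a generator. -/
def gen (x : LGen V E) : LeavittPathAlgebra K G :=
  RingQuot.mkAlgHom K (G.LRel K) (FreeAlgebra.ι K x)

/-- The element `v` of `L_K(E, C)`. -/
def vertex (v : V) : LeavittPathAlgebra K G := gen K G (.vertex v)
/-- The element `e` of `L_K(E, C)`. -/
def edge (e : E) : LeavittPathAlgebra K G := gen K G (.edge e)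
/-- The element `e*` of `L_K(E, C)`. -/
def ghost (e : E) : LeavittPathAlgebra K G := gen K G (.ghost e)

variable {G K}

theorem mk_rel {a b : FreeAlgebra K (LGen V E)} (h : G.LRel K a b) :
    RingQuot.mkAlgHom K (G.LRel K) a = RingQuot.mkAlgHom K (G.LRel K) b :=
  RingQuot.mkAlgHom_rel K h


open FreeAlgebra SeparatedGraph.LRel in
theorem star_compat {a b : FreeAlgebra K (LGen V E)} (h : G.LRel K a b) [StarRing K] :
    FreeAlgebra.lift K (fun x => (ConjOp.mk K (gen K G x.adj))) a =
      FreeAlgebra.lift K (fun x => (ConjOp.mk K (gen K G x.adj))) b := by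
  cases h with
  | vertex_mul_self v => simpa [gen, LGen.adj, ConjOp.mk_mul] using! congrArg (ConjOp.mk K) (mk_rel (vertex_mul_self (K := K) (G := G) v))
  | vertex_mul_of_ne v w h =>
    simpa [gen, LGen.adj, ConjOp.mk_mul] using! congrArg (ConjOp.mk K) (mk_rel (vertex_mul_of_ne (K := K) (G := G) w v h.symm))
  | sum_vertex =>
    have h := congrArg (ConjOp.mk K) (mk_rel (sum_vertex (K := K) (G := G)))
    rw [map_sum, map_sum, map_one] at h
    simpa [gen, LGen.adj, ConjOp.mk_one] using! h
  | range_mul_edge e =>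
    simpa [gen, LGen.adj, ConjOp.mk_mul] using! congrArg (ConjOp.mk K) (mk_rel (ghost_mul_range (K := K) (G := G) e))
  | edge_mul_source e =>
    simpa [gen, LGen.adj, ConjOp.mk_mul] using! congrArg (ConjOp.mk K) (mk_rel (source_mul_ghost (K := K) (G := G) e))
  | ghost_mul_range e =>
    simpa [gen, LGen.adj, ConjOp.mk_mul] using! congrArg (ConjOp.mk K) (mk_rel (range_mul_edge (K := K) (G := G) e))
  | source_mul_ghost e =>
    simpa [gen, LGen.adj, ConjOp.mk_mul] using! congrArg (ConjOp.mk K) (mk_rel (edge_mul_source (K := K) (G := G) e))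
  | sck1_self e =>
    simpa [gen, LGen.adj, ConjOp.mk_mul] using! congrArg (ConjOp.mk K) (mk_rel (sck1_self (K := K) (G := G) e))
  | sck1_of_ne v X hX e f he hf hne =>
    simpa [gen, LGen.adj, ConjOp.mk_mul] using! congrArg (ConjOp.mk K) (mk_rel (sck1_of_ne (K := K) (G := G) v X hX f e hf he hne.symm))
  | sck2 v X hX =>
    have h := congrArg (ConjOp.mk K) (mk_rel (sck2 (K := K) (G := G) v X hX))
    rw [map_sum, map_sum] at h
    simpa [gen, LGen.adj, ConjOp.mk_mul] using! h

variable [StarRing K]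

variable (K G) in
/-- The conjugate-linear anti-endomorphism of `L_K(E, C)` fixing `v` and exchanging `e` and `e*`. -/
def starHom : LeavittPathAlgebra K G →ₐ[K] ConjOp K (LeavittPathAlgebra K G) :=
  RingQuot.liftAlgHom K ⟨FreeAlgebra.lift K (fun x => (ConjOp.mk K (gen K G x.adj))),
    fun _ _ h => star_compat h⟩

/-- The involution of `L_K(E, C)`. -/
instance : Star (LeavittPathAlgebra K G) := ⟨fun a => (starHom K G a).unop⟩

theorem star_def (a : LeavittPathAlgebra K G) : star a = (starHom K G a).unop := rfl

theorem star_gen (x : LGen V E) : star (gen K G x) = gen K G x.adj := by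
  have h : starHom K G (gen K G x) = ConjOp.mk K (gen K G x.adj) := by
    unfold starHom gen
    erw [RingQuot.liftAlgHom_mkAlgHom_apply]
    simp
  rw [star_def, h]; rfl

theorem star_algebraMap' (c : K) : star (algebraMap K (LeavittPathAlgebra K G) c) =
    algebraMap K (LeavittPathAlgebra K G) (star c) := by
  rw [star_def, AlgHom.commutes]; rfl

theorem induction {p : LeavittPathAlgebra K G → Prop}
    (halg : ∀ c : K, p (algebraMap K _ c)) (hgen : ∀ x, p (gen K G x))
    (hadd : ∀ a b, p a → p b → p (a + b)) (hmul : ∀ a b, p a → p b → p (a * b)) (a) : p a := by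
  obtain ⟨a, rfl⟩ := RingQuot.mkAlgHom_surjective K (G.LRel K) a
  induction a using FreeAlgebra.induction with
  | grade0 r => simpa using! halg r
  | grade1 x => exact hgen x
  | mul a b ha hb => rw [map_mul]; exact hmul _ _ ha hb
  | add a b ha hb => rw [map_add]; exact hadd _ _ ha hb

theorem star_add' (a b : LeavittPathAlgebra K G) : star (a + b) = star a + star b := by
  simp only [star_def, map_add]; rfl

theorem star_mul' (a b : LeavittPathAlgebra K G) : star (a * b) = star b * star a := by
  simp only [star_def, map_mul]; rfl

instance : StarRing (LeavittPathAlgebra K G) where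
  star_involutive a := by
    induction a using induction with
    | halg c => rw [star_algebraMap', star_algebraMap', star_star]
    | hgen x => rw [star_gen, star_gen]; cases x <;> rfl
    | hadd a b ha hb => rw [star_add', star_add', ha, hb]
    | hmul a b ha hb => rw [star_mul', star_mul', ha, hb]
  star_mul := star_mul'
  star_add := star_add'

instance : StarModule K (LeavittPathAlgebra K G) where
  star_smul c a := by
    rw [Algebra.smul_def, star_mul', star_algebraMap', ← Algebra.commutes, ← Algebra.smul_def]

theorem star_vertex (v : V) : star (vertex K G v) = vertex K G v := star_gen _

theorem vertex_mul_self (v : V) : vertex K G v * vertex K G v = vertex K G v := by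
  simpa [vertex, gen] using! mk_rel (SeparatedGraph.LRel.vertex_mul_self (K := K) (G := G) v)

theorem star_edge_mul_edge (e : E) :
    star (edge K G e) * edge K G e = vertex K G (G.source e) := by
  rw [edge, star_gen]
  simpa [vertex, edge, gen] using! mk_rel (SeparatedGraph.LRel.sck1_self (K := K) (G := G) e)

theorem edge_mul_source (e : E) : edge K G e * vertex K G (G.source e) = edge K G e := by
  simpa [vertex, edge, gen] using! mk_rel (SeparatedGraph.LRel.edge_mul_source (K := K) (G := G) e)

end LeavittPathAlgebra
end Leavitt

/-- Every map out of a discrete space is continuous; in particular so is the involution. -/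
instance (priority := 50) {R : Type*} [Star R] [TopologicalSpace R] [DiscreteTopology R] :
    ContinuousStar R := ⟨continuous_of_discreteTopology⟩

/-- A partial action of a group `G` on a space `X` by homeomorphisms `θ_g : X_{g⁻¹} → X_g` between
clopen subsets: `X_1 = X`, `θ_1 = id`, and `θ_{gh}` extends `θ_g ∘ θ_h`. Only the values of `homeo g`
on its source `X_{g⁻¹}` are meaningful. -/
structure PartialAction (G X : Type*) [Group G] [TopologicalSpace X] where
  homeo : G → OpenPartialHomeomorph X X
  source_inv : ∀ g, (homeo g⁻¹).source = (homeo g).target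
  isClosed_source : ∀ g, IsClosed (homeo g).source
  one_source : (homeo 1).source = Set.univ
  one_apply : ∀ x, homeo 1 x = x
  mul_apply : ∀ g h x, x ∈ (homeo h).source → homeo h x ∈ (homeo g).source →
    x ∈ (homeo (g * h)).source ∧ homeo g (homeo h x) = homeo (g * h) x

namespace PartialAction

section Basic
variable {G X : Type*} [Group G] [TopologicalSpace X] (θ : PartialAction G X)

/-- The clopen set `X_g`, the range of `θ_g`. -/
def dom (g : G) : Set X := (θ.homeo g).target

theorem source_eq (g : G) : (θ.homeo g).source = θ.dom g⁻¹ := by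
  rw [dom, ← source_inv, inv_inv]

theorem isClopen_dom (g : G) : IsClopen (θ.dom g) := by
  refine ⟨?_, (θ.homeo g).open_target⟩
  have := θ.isClosed_source g⁻¹
  rwa [source_eq, inv_inv] at this

theorem dom_one : θ.dom 1 = Set.univ := by
  rw [← θ.one_source, source_eq, inv_one]

theorem map_mem {g : G} {x : X} (hx : x ∈ θ.dom g⁻¹) : θ.homeo g x ∈ θ.dom g :=
  (θ.homeo g).map_source (by rwa [source_eq])

theorem map_inv_mem {g : G} {x : X} (hx : x ∈ θ.dom g) : θ.homeo g⁻¹ x ∈ θ.dom g⁻¹ :=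
  θ.map_mem (by rwa [inv_inv])

theorem mul_mem {g h : G} {x : X} (hx : x ∈ θ.dom h⁻¹) (hy : θ.homeo h x ∈ θ.dom g⁻¹) :
    x ∈ θ.dom (g * h)⁻¹ := by
  rw [← source_eq] at *
  exact (θ.mul_apply g h x hx hy).1

theorem act_act {g h : G} {x : X} (hx : x ∈ θ.dom h⁻¹) (hy : θ.homeo h x ∈ θ.dom g⁻¹) :
    θ.homeo g (θ.homeo h x) = θ.homeo (g * h) x := by
  rw [← source_eq] at *
  exact (θ.mul_apply g h x hx hy).2

theorem act_inv_act {g : G} {x : X} (hx : x ∈ θ.dom g) : θ.homeo g (θ.homeo g⁻¹ x) = x := by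
  rw [θ.act_act (by rwa [inv_inv]) (θ.map_inv_mem hx), mul_inv_cancel, one_apply]

/-- `x ∈ X_g` and `g⁻¹ x ∈ X_h` give `x ∈ X_{gh}`. -/
theorem mem_dom_mul {g h : G} {x : X} (hx : x ∈ θ.dom g) (hy : θ.homeo g⁻¹ x ∈ θ.dom h) :
    x ∈ θ.dom (g * h) := by
  have := θ.mul_mem (g := h⁻¹) (h := g⁻¹) (x := x) (by rwa [inv_inv]) (by rwa [inv_inv])
  rwa [← mul_inv_rev, inv_inv] at this

theorem act_inv_mul {g h : G} {x : X} (hx : x ∈ θ.dom g) (hy : θ.homeo g⁻¹ x ∈ θ.dom h) :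
    θ.homeo h⁻¹ (θ.homeo g⁻¹ x) = θ.homeo (g * h)⁻¹ x := by
  rw [mul_inv_rev]
  exact θ.act_act (by rwa [inv_inv]) (by rwa [inv_inv])

/-- `x ∈ X_g ∩ X_{gh}` gives `g⁻¹ x ∈ X_h`. -/
theorem mem_dom_of_mul {g h : G} {x : X} (hx : x ∈ θ.dom g) (hy : x ∈ θ.dom (g * h)) :
    θ.homeo g⁻¹ x ∈ θ.dom h := by
  have h1 := θ.map_inv_mem hx
  have := θ.mem_dom_mul (g := g⁻¹) (h := g * h) (x := θ.homeo g⁻¹ x) h1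
    (by rw [inv_inv, θ.act_inv_act hx]; exact hy)
  simpa using this

end Basic

section Crossed
variable {G X : Type*} [Group G] [TopologicalSpace X] (θ : PartialAction G X)
variable (R : Type*) [CommRing R] [TopologicalSpace R] [IsTopologicalRing R]

/-- The ideal `D_g` of `C(X, R)`: the continuous functions `X → R` vanishing outside `X_g`. -/
def ideal (g : Additive G) : Submodule R C(X, R) where
  carrier := {f | ∀ x ∉ θ.dom g.toMul, f x = 0}
  add_mem' ha hb x hx := by simp [ha x hx, hb x hx]
  zero_mem' _ _ := rfl
  smul_mem' c f hf x hx := by simp [hf x hx]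

variable {R}

open Classical in
/-- The function equal to `f ∘ θ_{g⁻¹}` on `X_g` and to `0` elsewhere. On `D_{g⁻¹}` this is the
isomorphism `α_g : D_{g⁻¹} → D_g` of the partial action induced on `C(X, R)`. -/
def pull (g : G) (f : C(X, R)) : C(X, R) where
  toFun x := if x ∈ θ.dom g then f (θ.homeo g⁻¹ x) else 0
  continuous_toFun := by
    have hc : IsClopen {x | x ∈ θ.dom g} := θ.isClopen_dom g
    refine continuous_if ?_ ?_ continuousOn_const
    · rw [hc.frontier_eq]; simp
    · rw [hc.isClosed.closure_eq]
      refine f.continuous.comp_continuousOn ((θ.homeo g⁻¹).continuousOn.mono fun x hx => ?_)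
      rw [source_eq, inv_inv]; exact hx

theorem pull_of_mem {g : G} (f : C(X, R)) {x : X} (hx : x ∈ θ.dom g) :
    θ.pull g f x = f (θ.homeo g⁻¹ x) := if_pos hx

theorem pull_of_notMem {g : G} (f : C(X, R)) {x : X} (hx : x ∉ θ.dom g) :
    θ.pull g f x = 0 := if_neg hx

theorem pull_mem (g : G) (f : C(X, R)) : θ.pull g f ∈ θ.ideal R (Additive.ofMul g) :=
  fun _ hx => θ.pull_of_notMem f hx


theorem pull_add (g : G) (a b : C(X, R)) : θ.pull g (a + b) = θ.pull g a + θ.pull g b := by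
  ext x
  by_cases hx : x ∈ θ.dom g <;> simp [pull_of_mem, pull_of_notMem, hx]

theorem mul_apply_of_mem {g : G} (a b : C(X, R)) {x : X} (hx : x ∈ θ.dom g) :
    θ.pull g (θ.pull g⁻¹ a * b) x = a x * b (θ.homeo g⁻¹ x) := by
  rw [θ.pull_of_mem _ hx, ContinuousMap.mul_apply, θ.pull_of_mem _ (θ.map_inv_mem hx), inv_inv,
    θ.act_inv_act hx]

/-- The product `(a δ_g)(b δ_h) = α_g(α_{g⁻¹}(a) b) δ_{gh}` of homogeneous elements. -/
def homMul {g h : Additive G} (a : θ.ideal R g) (b : θ.ideal R h) :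
    θ.ideal R (g + h) :=
  ⟨θ.pull g.toMul (θ.pull g.toMul⁻¹ (a : C(X, R)) * (b : C(X, R))), fun x hx => by
    by_cases hg : x ∈ θ.dom g.toMul
    · rw [θ.mul_apply_of_mem _ _ hg, b.2 _ fun hy => hx (θ.mem_dom_mul hg hy), mul_zero]
    · exact θ.pull_of_notMem _ hg⟩

theorem homMul_of_mem {g h : Additive G} (a : θ.ideal R g) (b : θ.ideal R h) {x : X}
    (hx : x ∈ θ.dom g.toMul) :
    (θ.homMul a b : C(X, R)) x = (a : C(X, R)) x * (b : C(X, R)) (θ.homeo g.toMul⁻¹ x) :=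
  θ.mul_apply_of_mem _ _ hx

theorem homMul_of_notMem {g h : Additive G} (a : θ.ideal R g) (b : θ.ideal R h) {x : X}
    (hx : x ∉ θ.dom g.toMul) : (θ.homMul a b : C(X, R)) x = 0 :=
  θ.pull_of_notMem _ hx

theorem mem_ideal_zero (f : C(X, R)) : f ∈ θ.ideal R 0 := fun x hx =>
  absurd (by rw [toMul_zero, θ.dom_one]; trivial) hx

theorem sigma_eq {a b : GradedMonoid fun g : Additive G => θ.ideal R g}
    (h1 : a.1 = b.1) (h2 : (a.2 : C(X, R)) = b.2) : a = b := by
  obtain ⟨i, a⟩ := a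
  obtain ⟨j, b⟩ := b
  obtain rfl : i = j := h1
  obtain rfl : a = b := Subtype.ext h2
  rfl

instance gOne : GradedMonoid.GOne fun g : Additive G => θ.ideal R g where
  one := ⟨1, θ.mem_ideal_zero _⟩

instance gMul : GradedMonoid.GMul fun g : Additive G => θ.ideal R g where
  mul := θ.homMul

theorem gMul_eq {g h : Additive G} (a : θ.ideal R g) (b : θ.ideal R h) :
    GradedMonoid.GMul.mul (A := fun g : Additive G => θ.ideal R g) a b = θ.homMul a b := rfl

instance gRing : DirectSum.GRing fun g : Additive G => θ.ideal R g where
  mul_zero {i j} a := by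
    ext x
    by_cases hx : x ∈ θ.dom i.toMul <;> simp [gMul_eq, homMul_of_mem, homMul_of_notMem, hx]
  zero_mul {i j} b := by
    ext x
    by_cases hx : x ∈ θ.dom i.toMul <;> simp [gMul_eq, homMul_of_mem, homMul_of_notMem, hx]
  mul_add {i j} a b c := by
    ext x
    by_cases hx : x ∈ θ.dom i.toMul <;>
      simp [gMul_eq, homMul_of_mem, homMul_of_notMem, hx, mul_add]
  add_mul {i j} a b c := by
    ext x
    by_cases hx : x ∈ θ.dom i.toMul <;>
      simp [gMul_eq, homMul_of_mem, homMul_of_notMem, hx, add_mul]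
  one := (gOne θ).one
  one_mul a := by
    refine θ.sigma_eq (zero_add _) ?_
    ext x
    have hx : x ∈ θ.dom (Additive.toMul 0) := by simp [θ.dom_one]
    refine (θ.homMul_of_mem _ _ hx).trans ?_
    change (1 : C(X, R)) x * (a.2 : C(X, R)) (θ.homeo 1⁻¹ x) = _
    simp [θ.one_apply]
  mul_one a := by
    refine θ.sigma_eq (add_zero _) ?_
    ext x
    by_cases hx : x ∈ θ.dom a.1.toMul
    · refine (θ.homMul_of_mem _ _ hx).trans ?_
      change (a.2 : C(X, R)) x * (1 : C(X, R)) _ = _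
      simp
    · exact (θ.homMul_of_notMem _ _ hx).trans (a.2.2 x hx).symm
  mul_assoc a b c := by
    refine θ.sigma_eq (add_assoc _ _ _) ?_
    ext x
    by_cases hx : x ∈ θ.dom a.1.toMul
    · refine Eq.trans ?_ (θ.homMul_of_mem _ _ hx).symm
      by_cases hy : x ∈ θ.dom (a.1 + b.1).toMul
      · have hz := θ.mem_dom_of_mul hx hy
        refine (θ.homMul_of_mem _ _ hy).trans ?_
        refine (congrArg (· * _) (θ.homMul_of_mem _ _ hx)).trans ?_
        refine Eq.trans ?_ (congrArg (_ * ·) (θ.homMul_of_mem _ _ hz).symm)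
        rw [mul_assoc, θ.act_inv_mul hx hz]
        rfl
      · refine (θ.homMul_of_notMem _ _ hy).trans ?_
        have hz : θ.homeo a.1.toMul⁻¹ x ∉ θ.dom b.1.toMul := fun hz => hy (θ.mem_dom_mul hx hz)
        refine Eq.trans ?_ (congrArg (_ * ·) (θ.homMul_of_notMem _ _ hz).symm)
        simp
    · refine Eq.trans ?_ (θ.homMul_of_notMem _ _ hx).symm
      by_cases hy : x ∈ θ.dom (a.1 + b.1).toMul
      · refine (θ.homMul_of_mem _ _ hy).trans ?_
        refine (congrArg (· * _) (θ.homMul_of_notMem _ _ hx)).trans ?_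
        simp
      · exact θ.homMul_of_notMem _ _ hy
  natCast n := ⟨n, θ.mem_ideal_zero _⟩
  natCast_zero := by ext; simp
  natCast_succ n := by
    apply Subtype.ext
    exact Nat.cast_succ n
  intCast n := ⟨n, θ.mem_ideal_zero _⟩
  intCast_ofNat n := by apply Subtype.ext; exact Int.cast_natCast n
  intCast_negSucc_ofNat n := by apply Subtype.ext; exact Int.cast_negSucc n

instance gAlgebra : DirectSum.GAlgebra R fun g : Additive G => θ.ideal R g where
  toFun :=
    { toFun := fun c => ⟨algebraMap R C(X, R) c, θ.mem_ideal_zero _⟩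
      map_zero' := by ext; simp
      map_add' := fun a b => by ext; simp }
  map_one := by apply Subtype.ext; exact map_one (algebraMap R C(X, R))
  map_mul c d := by
    refine θ.sigma_eq (zero_add _).symm ?_
    ext x
    have hx : x ∈ θ.dom (Additive.toMul 0) := by simp [θ.dom_one]
    refine Eq.trans ?_ (θ.homMul_of_mem _ _ hx).symm
    change algebraMap R C(X, R) (c * d) x = algebraMap R C(X, R) c x * algebraMap R C(X, R) d _
    simp
  commutes c a := by
    refine θ.sigma_eq ((zero_add _).trans (add_zero _).symm) ?_
    ext x
    have h0 : x ∈ θ.dom (Additive.toMul 0) := by simp [θ.dom_one]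
    refine (θ.homMul_of_mem _ _ h0).trans ?_
    change algebraMap R C(X, R) c x * (a.2 : C(X, R)) (θ.homeo 1⁻¹ x) = _
    by_cases hx : x ∈ θ.dom a.1.toMul
    · refine Eq.trans ?_ (θ.homMul_of_mem _ _ hx).symm
      change _ = (a.2 : C(X, R)) x * algebraMap R C(X, R) c _
      simp [θ.one_apply, mul_comm]
    · refine Eq.trans ?_ (θ.homMul_of_notMem _ _ hx).symm
      simp [θ.one_apply, a.2.2 x hx]
  smul_def c a := by
    refine θ.sigma_eq (zero_add _).symm ?_
    ext x
    have h0 : x ∈ θ.dom (Additive.toMul 0) := by simp [θ.dom_one]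
    refine Eq.trans ?_ (θ.homMul_of_mem _ _ h0).symm
    change c * (a.2 : C(X, R)) x = algebraMap R C(X, R) c x * (a.2 : C(X, R)) (θ.homeo 1⁻¹ x)
    simp [θ.one_apply]

variable (R) in
/-- The algebraic crossed product `C(X, R) ⋊_α G`: finite formal sums `∑ a_g δ_g` with `a_g ∈ D_g`,
multiplication `(a δ_g)(b δ_h) = α_g(α_{g⁻¹}(a) b) δ_{gh}` and involution
`(a δ_g)* = α_{g⁻¹}(a*) δ_{g⁻¹}`. The index set is `G`, written additively. -/
def CrossedProduct : Type _ := DirectSum (Additive G) fun g => θ.ideal R g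

namespace CrossedProduct
variable [DecidableEq G]

instance : Ring (θ.CrossedProduct R) :=
  inferInstanceAs (Ring (DirectSum (Additive G) fun g => θ.ideal R g))
instance : Algebra R (θ.CrossedProduct R) :=
  inferInstanceAs (Algebra R (DirectSum (Additive G) fun g => θ.ideal R g))

variable {θ}

/-- `a δ_g`. -/
def single (g : G) (a : θ.ideal R (Additive.ofMul g)) : θ.CrossedProduct R :=
  DirectSum.of (fun g : Additive G => θ.ideal R g) (Additive.ofMul g) a

theorem single_add (g : G) (a b : θ.ideal R (Additive.ofMul g)) :
    (single g (a + b) : θ.CrossedProduct R) = single g a + single g b :=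
  map_add (DirectSum.of (fun g : Additive G => θ.ideal R g) (Additive.ofMul g)) a b

theorem single_mul (g h : G) (a : θ.ideal R (Additive.ofMul g))
    (b : θ.ideal R (Additive.ofMul h)) :
    (single g a * single h b : θ.CrossedProduct R) = single (g * h) (θ.homMul a b) :=
  DirectSum.of_mul_of _ _

theorem single_congr {g h : G} {a : θ.ideal R (Additive.ofMul g)}
    {b : θ.ideal R (Additive.ofMul h)} (hgh : g = h) (hab : (a : C(X, R)) = b) :
    (single g a : θ.CrossedProduct R) = single h b := by
  subst hgh
  obtain rfl : a = b := Subtype.ext hab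
  rfl

theorem induction {p : θ.CrossedProduct R → Prop} (h0 : p 0)
    (hs : ∀ g a, p (single g a)) (hadd : ∀ a b, p a → p b → p (a + b)) (a) : p a :=
  DirectSum.induction_on a h0 (fun g a => hs g.toMul a) hadd

section Star
variable [StarRing R] [ContinuousStar R]

variable (θ) in
/-- The function `α_{g⁻¹}(a*)`. -/
def starFn (g : G) (a : C(X, R)) : C(X, R) := θ.pull g⁻¹ (star a)

theorem starFn_of_mem {g : G} (a : C(X, R)) {x : X} (hx : x ∈ θ.dom g⁻¹) :
    starFn θ g a x = star (a (θ.homeo g x)) := by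
  rw [starFn, θ.pull_of_mem _ hx, inv_inv]; rfl

theorem starFn_of_notMem {g : G} (a : C(X, R)) {x : X} (hx : x ∉ θ.dom g⁻¹) :
    starFn θ g a x = 0 := θ.pull_of_notMem _ hx

/-- The map `a δ_g ↦ (a δ_g)* = α_{g⁻¹}(a*) δ_{g⁻¹}`. -/
def homStar (g : Additive G) : θ.ideal R g →+ θ.ideal R (-g) where
  toFun a := ⟨starFn θ g.toMul a, θ.pull_mem g.toMul⁻¹ _⟩
  map_zero' := by
    ext x
    by_cases hx : x ∈ θ.dom g.toMul⁻¹ <;> simp [starFn_of_mem, starFn_of_notMem, hx]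
  map_add' a b := by
    ext x
    by_cases hx : x ∈ θ.dom g.toMul⁻¹ <;> simp [starFn_of_mem, starFn_of_notMem, hx]

variable (θ R) in
/-- The involution of the crossed product as an additive map. -/
def starHom : θ.CrossedProduct R →+ θ.CrossedProduct R :=
  DirectSum.toAddMonoid fun g =>
    (DirectSum.of (fun g : Additive G => θ.ideal R g) (-g)).comp (homStar g)

instance : Star (θ.CrossedProduct R) := ⟨starHom θ R⟩

theorem star_single (g : G) (a : θ.ideal R (Additive.ofMul g)) :
    star (single g a : θ.CrossedProduct R) = single g⁻¹ (homStar _ a) :=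
  DirectSum.toAddMonoid_of _ _ _

theorem star_add' (a b : θ.CrossedProduct R) : star (a + b) = star a + star b :=
  map_add (starHom θ R) a b

theorem star_zero' : star (0 : θ.CrossedProduct R) = 0 := map_zero (starHom θ R)

theorem starFn_starFn (g : G) (a : C(X, R)) (ha : ∀ x ∉ θ.dom g, a x = 0) :
    starFn θ g⁻¹ (starFn θ g a) = a := by
  ext x
  by_cases hx : x ∈ θ.dom g
  · rw [starFn_of_mem _ (by rwa [inv_inv]), starFn_of_mem _ (θ.map_inv_mem hx),
      θ.act_inv_act hx, star_star]
  · rw [starFn_of_notMem _ (by rwa [inv_inv]), ha x hx]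

theorem starFn_mul (g h : G) (a b : C(X, R)) :
    starFn θ (g * h) (θ.pull g (θ.pull g⁻¹ a * b)) =
      θ.pull h⁻¹ (θ.pull h⁻¹⁻¹ (starFn θ h b) * starFn θ g a) := by
  ext x
  by_cases hy : x ∈ θ.dom h⁻¹
  · rw [θ.mul_apply_of_mem _ _ hy, starFn_of_mem b hy, inv_inv]
    by_cases hg : θ.homeo h x ∈ θ.dom g⁻¹
    · have hgh := θ.act_act hy hg
      have hm := θ.map_mem hg
      rw [starFn_of_mem a hg, starFn_of_mem _ (θ.mul_mem hy hg), ← hgh,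
        θ.mul_apply_of_mem _ _ hm, star_mul, θ.act_act hg (by rwa [inv_inv]), inv_mul_cancel,
        θ.one_apply]
    · rw [starFn_of_notMem a hg, mul_zero, starFn_of_notMem]
      intro hgh
      refine hg ?_
      have := θ.mem_dom_of_mul (g := h⁻¹) (h := g⁻¹) hy (by rwa [← mul_inv_rev])
      rwa [inv_inv] at this
  · rw [θ.pull_of_notMem _ hy]
    by_cases hgh : x ∈ θ.dom (g * h)⁻¹
    · rw [starFn_of_mem _ hgh, θ.pull_of_notMem, star_zero]
      intro hg
      refine hy ?_
      have := θ.mul_mem (g := g⁻¹) hgh (by rwa [inv_inv])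
      rwa [inv_mul_cancel_left] at this
    · exact starFn_of_notMem _ hgh

instance : StarRing (θ.CrossedProduct R) where
  star_involutive a := by
    induction a using induction with
    | h0 => rw [star_zero', star_zero']
    | hs g a =>
      rw [star_single, star_single]
      exact single_congr (inv_inv g) (starFn_starFn g _ a.2)
    | hadd a b ha hb => rw [star_add', star_add', ha, hb]
  star_mul a b := by
    induction a using induction with
    | h0 => simp only [star_zero', zero_mul, mul_zero]
    | hadd a a' h h' => simp only [star_add', add_mul, mul_add, h, h']
    | hs g a =>
      induction b using induction with
      | h0 => simp only [star_zero', zero_mul, mul_zero]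
      | hadd a a' h h' => simp only [star_add', add_mul, mul_add, h, h']
      | hs h b =>
        rw [star_single, star_single, single_mul, single_mul, star_single]
        exact single_congr (mul_inv_rev g h) (starFn_mul g h _ _)
  star_add := star_add'

theorem smul_single (c : R) (g : G) (a : θ.ideal R (Additive.ofMul g)) :
    c • (single g a : θ.CrossedProduct R) = single g (c • a) :=
  ((DirectSum.lof R (Additive G) (fun g => θ.ideal R g) (Additive.ofMul g)).map_smul c a).symm

instance : StarModule R (θ.CrossedProduct R) where
  star_smul c a := by
    induction a using induction with
    | h0 => simp only [smul_zero, star_zero']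
    | hadd a b ha hb => simp only [smul_add, star_add', ha, hb]
    | hs g a =>
      rw [smul_single, star_single, star_single, smul_single]
      refine single_congr rfl ?_
      change starFn θ g (c • (a : C(X, R))) = star c • starFn θ g (a : C(X, R))
      ext x
      by_cases hx : x ∈ θ.dom g⁻¹
      · simp [starFn_of_mem _ hx]
      · simp [starFn_of_notMem _ hx]
end Star

end CrossedProduct
end Crossed
end PartialAction

section FreeAction
variable {X E : Type*} [TopologicalSpace X] (f : E → OpenPartialHomeomorph X X)

/-- The partial homeomorphism of a letter: `e ↦ f e` and `e⁻¹ ↦ (f e)⁻¹`. -/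
def letterHomeo : E × Bool → OpenPartialHomeomorph X X
  | (e, true) => f e
  | (e, false) => (f e).symm

/-- The composition of the partial homeomorphisms of the letters of a word, on its largest domain;
the last letter acts first. -/
def wordHomeo : List (E × Bool) → OpenPartialHomeomorph X X
  | [] => OpenPartialHomeomorph.refl X
  | a :: w => (wordHomeo w).trans (letterHomeo f a)

variable {f}

theorem letterHomeo_not (e : E) (b : Bool) : letterHomeo f (e, !b) = (letterHomeo f (e, b)).symm := by
  cases b <;> simp [letterHomeo]

theorem mem_source_cons (a : E × Bool) (w : List (E × Bool)) (x : X) :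
    x ∈ (wordHomeo f (a :: w)).source ↔
      x ∈ (wordHomeo f w).source ∧ wordHomeo f w x ∈ (letterHomeo f a).source := by
  simp [wordHomeo]

theorem wordHomeo_cons_apply (a : E × Bool) (w : List (E × Bool)) (x : X) :
    wordHomeo f (a :: w) x = letterHomeo f a (wordHomeo f w x) := rfl

theorem wordHomeo_append_apply (v w : List (E × Bool)) (x : X) :
    wordHomeo f (v ++ w) x = wordHomeo f v (wordHomeo f w x) := by
  induction v with
  | nil => rfl
  | cons a v ih => rw [List.cons_append, wordHomeo_cons_apply, ih, wordHomeo_cons_apply]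

theorem mem_source_append (v w : List (E × Bool)) (x : X) :
    x ∈ (wordHomeo f (v ++ w)).source ↔
      x ∈ (wordHomeo f w).source ∧ wordHomeo f w x ∈ (wordHomeo f v).source := by
  induction v with
  | nil => simp [wordHomeo]
  | cons a v ih =>
    rw [List.cons_append, mem_source_cons, ih, mem_source_cons, wordHomeo_append_apply, and_assoc]

theorem wordHomeo_step {v w : List (E × Bool)} (h : FreeGroup.Red.Step v w) {x : X}
    (hx : x ∈ (wordHomeo f v).source) :
    x ∈ (wordHomeo f w).source ∧ wordHomeo f v x = wordHomeo f w x := by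
  cases h with
  | @not L₁ L₂ e b =>
    rw [mem_source_append, mem_source_cons, mem_source_cons] at hx
    have key : wordHomeo f ((e, b) :: (e, !b) :: L₂) x = wordHomeo f L₂ x := by
      rw [wordHomeo_cons_apply, wordHomeo_cons_apply, letterHomeo_not]
      have := hx.1.1.2
      rw [letterHomeo_not] at this
      exact (letterHomeo f (e, b)).right_inv this
    rw [key] at hx
    exact ⟨(mem_source_append _ _ _).2 ⟨hx.1.1.1, hx.2⟩, by
      rw [wordHomeo_append_apply, key, wordHomeo_append_apply]⟩

theorem wordHomeo_red {v w : List (E × Bool)} (h : FreeGroup.Red v w) {x : X}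
    (hx : x ∈ (wordHomeo f v).source) :
    x ∈ (wordHomeo f w).source ∧ wordHomeo f v x = wordHomeo f w x := by
  induction h with
  | refl => exact ⟨hx, rfl⟩
  | tail _ h ih =>
    obtain ⟨h1, h2⟩ := ih
    obtain ⟨h3, h4⟩ := wordHomeo_step h h1
    exact ⟨h3, h2.trans h4⟩

theorem wordHomeo_invRev_source (w : List (E × Bool)) :
    (wordHomeo f (FreeGroup.invRev w)).source = (wordHomeo f w).target := by
  induction w with
  | nil => simp [wordHomeo, FreeGroup.invRev]
  | cons a w ih =>
    obtain ⟨e, b⟩ := a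
    have : FreeGroup.invRev ((e, b) :: w) = FreeGroup.invRev w ++ [(e, !b)] := by
      simp [FreeGroup.invRev]
    ext x
    rw [this, mem_source_append, ih, mem_source_cons, wordHomeo_cons_apply, letterHomeo_not]
    simp [wordHomeo]

theorem wordHomeo_isClosed_source (hs : ∀ e, IsClosed (f e).source)
    (ht : ∀ e, IsClosed (f e).target) (w : List (E × Bool)) :
    IsClosed (wordHomeo f w).source := by
  induction w with
  | nil => simp [wordHomeo]
  | cons a w ih =>
    have ha : IsClosed (letterHomeo f a).source := by
      obtain ⟨e, _ | _⟩ := a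
      · simpa [letterHomeo] using ht e
      · simpa [letterHomeo] using hs e
    rw [wordHomeo, OpenPartialHomeomorph.trans_source]
    exact (wordHomeo f w).continuousOn.preimage_isClosed_of_isClosed ih ha

end FreeAction

/-- The partial action of the free group on `E` generated by partial homeomorphisms `f e` between
clopen sets: the reduced word `g₁ ⋯ g_k` acts as the composition `f_{g₁} ∘ ⋯ ∘ f_{g_k}`. -/
def PartialAction.ofFree {X E : Type*} [TopologicalSpace X] [DecidableEq E]
    (f : E → OpenPartialHomeomorph X X)
    (hs : ∀ e, IsClosed (f e).source) (ht : ∀ e, IsClosed (f e).target) :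
    PartialAction (FreeGroup E) X where
  homeo g := wordHomeo f g.toWord
  source_inv g := by rw [FreeGroup.toWord_inv, wordHomeo_invRev_source]
  isClosed_source g := wordHomeo_isClosed_source hs ht _
  one_source := by simp [wordHomeo]
  one_apply x := by simp [wordHomeo]
  mul_apply g h x hx hy := by
    have hx' := (mem_source_append g.toWord h.toWord x).2 ⟨hx, hy⟩
    have := wordHomeo_red (f := f) (FreeGroup.reduce.red (L := g.toWord ++ h.toWord)) hx'
    rw [← FreeGroup.toWord_mul, wordHomeo_append_apply] at this
    exact this


/-- A C*-seminorm on a `*`-algebra: a submultiplicative seminorm with `p(a* a) = p(a)²`. These are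
the seminorms `a ↦ ‖π(a)‖` for `*`-homomorphisms `π` into C*-algebras. -/
structure CStarSeminorm (A : Type*) [Ring A] [StarRing A] [Algebra ℂ A] extends
    Seminorm ℂ A where
  mul_le' : ∀ a b, toFun (a * b) ≤ toFun a * toFun b
  star_mul_self' : ∀ a, toFun (star a * a) = toFun a ^ 2

namespace CStarSeminorm
variable {A : Type*} [Ring A] [StarRing A] [Algebra ℂ A]

instance : CoeFun (CStarSeminorm A) fun _ => A → ℝ := ⟨fun p => p.toSeminorm⟩

variable (p : CStarSeminorm A)
theorem mul_le (a b : A) : p (a * b) ≤ p a * p b := p.mul_le' a b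
theorem star_mul_self (a : A) : p (star a * a) = p a ^ 2 := p.star_mul_self' a
theorem nonneg (a : A) : 0 ≤ p a := apply_nonneg p.toSeminorm a
theorem add_le (a b : A) : p (a + b) ≤ p a + p b := map_add_le_add p.toSeminorm a b
theorem map_zero : p 0 = 0 := _root_.map_zero p.toSeminorm
theorem map_smul (c : ℂ) (a : A) : p (c • a) = ‖c‖ * p a := map_smul_eq_mul p.toSeminorm c a

theorem le_star (a : A) : p a ≤ p (star a) := by
  rcases (p.nonneg a).eq_or_lt with h | h
  · rw [← h]; exact p.nonneg _
  · have := p.star_mul_self a ▸ p.mul_le (star a) a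
    rw [sq] at this
    exact le_of_mul_le_mul_right this h

theorem map_star (a : A) : p (star a) = p a :=
  le_antisymm (by simpa using p.le_star (star a)) (p.le_star a)

/-- Projections have seminorm at most one -/
theorem le_one_of_proj {e : A} (he : star e * e = e) : p e ≤ 1 := by
  have h := p.star_mul_self e
  rw [he] at h
  nlinarith [p.nonneg e]

theorem le_one_of_star_mul_self {a e : A} (ha : star a * a = e) (he : star e * e = e) :
    p a ≤ 1 := by
  have h := p.star_mul_self a
  rw [ha] at h
  have := p.le_one_of_proj he
  nlinarith [p.nonneg a]

theorem one_le_one : p 1 ≤ 1 := p.le_one_of_proj (by simp)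

instance : Nonempty (CStarSeminorm A) :=
  ⟨{ (0 : Seminorm ℂ A) with
      mul_le' := fun a b => (zero_mul (0 : ℝ)).symm.le
      star_mul_self' := fun a => (zero_pow two_ne_zero).symm }⟩
end CStarSeminorm

/-- For every element, the values of all C*-seminorms are bounded; this is what is needed for the
enveloping C*-algebra to exist. -/
class CStarBounded (A : Type*) [Ring A] [StarRing A] [Algebra ℂ A] : Prop where
  bddAbove : ∀ a : A, BddAbove (Set.range fun p : CStarSeminorm A => p a)

section Envelope
variable (A : Type*) [Ring A] [StarRing A] [Algebra ℂ A]

variable [CStarBounded A]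

variable {A} in
/-- The supremum of all C*-seminorms. -/
def cstarSup (a : A) : ℝ := ⨆ p : CStarSeminorm A, p a

variable {A}

theorem le_cstarSup (p : CStarSeminorm A) (a : A) : p a ≤ cstarSup a :=
  le_ciSup (CStarBounded.bddAbove a) p

theorem cstarSup_le {a : A} {r : ℝ} (h : ∀ p : CStarSeminorm A, p a ≤ r) : cstarSup a ≤ r :=
  ciSup_le h

theorem cstarSup_nonneg (a : A) : 0 ≤ cstarSup a :=
  (Classical.arbitrary (CStarSeminorm A)).nonneg a |>.trans (le_cstarSup _ a)

variable (A) in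
/-- The largest C*-seminorm of `A`. -/
def maxCStarSeminorm : CStarSeminorm A where
  toFun := cstarSup
  map_zero' := le_antisymm (cstarSup_le fun p => p.map_zero.le) (cstarSup_nonneg 0)
  add_le' a b := cstarSup_le fun p =>
    (p.add_le a b).trans (add_le_add (le_cstarSup p a) (le_cstarSup p b))
  neg' a := by
    have h (a : A) : cstarSup (-a) ≤ cstarSup a := cstarSup_le fun p => by
      rw [show p (-a) = p a from map_neg_eq_map p.toSeminorm a]; exact le_cstarSup p a
    exact le_antisymm (h a) (by simpa using h (-a))
  smul' c a := by
    rcases eq_or_ne c 0 with rfl | hc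
    · simp only [zero_smul, norm_zero, zero_mul]
      exact le_antisymm (cstarSup_le fun p => p.map_zero.le) (cstarSup_nonneg 0)
    have h (c : ℂ) (a : A) : cstarSup (c • a) ≤ ‖c‖ * cstarSup a := cstarSup_le fun p => by
      rw [p.map_smul]; exact mul_le_mul_of_nonneg_left (le_cstarSup p a) (norm_nonneg c)
    refine le_antisymm (h c a) ?_
    have := h c⁻¹ (c • a)
    rw [inv_smul_smul₀ hc, norm_inv] at this
    rwa [← le_inv_mul_iff₀ (norm_pos_iff.2 hc)]
  mul_le' a b := cstarSup_le fun p => (p.mul_le a b).trans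
    (mul_le_mul (le_cstarSup p a) (le_cstarSup p b) (p.nonneg b) (cstarSup_nonneg a))
  star_mul_self' a := by
    refine le_antisymm (cstarSup_le fun p => ?_) ?_
    · rw [p.star_mul_self]
      exact pow_le_pow_left₀ (p.nonneg a) (le_cstarSup p a) 2
    · have h0 : 0 ≤ cstarSup (star a * a) := cstarSup_nonneg _
      have : cstarSup a ≤ Real.sqrt (cstarSup (star a * a)) := cstarSup_le fun p => by
        refine Real.le_sqrt_of_sq_le ?_
        rw [← p.star_mul_self]; exact le_cstarSup p _
      calc cstarSup a ^ 2 ≤ Real.sqrt (cstarSup (star a * a)) ^ 2 :=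
            pow_le_pow_left₀ (cstarSup_nonneg a) this 2
        _ = _ := Real.sq_sqrt h0

variable (A) in
/-- The `*`-algebra `A` equipped with its largest C*-seminorm. -/
def PreEnvelope : Type _ := A

namespace PreEnvelope

instance : SeminormedRing (PreEnvelope A) :=
  { (maxCStarSeminorm A).toSeminorm.toAddGroupSeminorm.toSeminormedAddCommGroup,
    (inferInstanceAs (Ring A) : Ring (PreEnvelope A)) with
    norm_mul_le := (maxCStarSeminorm A).mul_le }

instance : StarRing (PreEnvelope A) := inferInstanceAs (StarRing A)
instance : Algebra ℂ (PreEnvelope A) := inferInstanceAs (Algebra ℂ A)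
instance [StarModule ℂ A] : StarModule ℂ (PreEnvelope A) := inferInstanceAs (StarModule ℂ A)

theorem norm_def (a : PreEnvelope A) : ‖a‖ = maxCStarSeminorm A a := rfl

instance : NormedSpace ℂ (PreEnvelope A) where
  norm_smul_le c a := ((maxCStarSeminorm A).map_smul c a).le

instance : NormedStarGroup (PreEnvelope A) where
  norm_star_le a := ((maxCStarSeminorm A).map_star a).le

theorem uniformContinuous_star : UniformContinuous (star : PreEnvelope A → PreEnvelope A) :=
  (AddMonoidHomClass.isometry_of_norm (starAddEquiv : PreEnvelope A ≃+ PreEnvelope A)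
    fun a => norm_star a).uniformContinuous

end PreEnvelope

variable (A) in
/-- The enveloping C*-algebra of `A`: the Hausdorff completion of `A` in its largest C*-seminorm. -/
def CStarEnvelope : Type _ := UniformSpace.Completion (PreEnvelope A)

namespace CStarEnvelope
open UniformSpace

instance : NormedRing (CStarEnvelope A) :=
  inferInstanceAs (NormedRing (Completion (PreEnvelope A)))
instance : Algebra ℂ (CStarEnvelope A) :=
  inferInstanceAs (Algebra ℂ (Completion (PreEnvelope A)))
instance : NormedAlgebra ℂ (CStarEnvelope A) where
  norm_smul_le c a := norm_smul_le (α := ℂ) (β := Completion (PreEnvelope A)) c a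
instance : CompleteSpace (CStarEnvelope A) :=
  inferInstanceAs (CompleteSpace (Completion (PreEnvelope A)))

variable (A) in
/-- The canonical homomorphism of `A` into its enveloping C*-algebra. -/
def toEnvelope : A →ₐ[ℂ] CStarEnvelope A where
  toFun a := Completion.coe' (α := PreEnvelope A) a
  map_one' := Completion.coe_one _
  map_mul' a b := Completion.coe_mul (α := PreEnvelope A) a b
  map_zero' := Completion.coe_zero
  map_add' a b := Completion.coe_add (α := PreEnvelope A) a b
  commutes' c := rfl

theorem denseRange : DenseRange (toEnvelope A) :=
  Completion.denseRange_coe (α := PreEnvelope A)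

theorem norm_toEnvelope (a : A) : ‖toEnvelope A a‖ = cstarSup a :=
  Completion.norm_coe (E := PreEnvelope A) a

instance : Star (CStarEnvelope A) :=
  ⟨Completion.map (star : PreEnvelope A → PreEnvelope A)⟩

theorem star_toEnvelope (a : A) : star (toEnvelope A a) = toEnvelope A (star a) :=
  Completion.map_coe PreEnvelope.uniformContinuous_star (show PreEnvelope A from a)

theorem continuous_star' : Continuous (star : CStarEnvelope A → CStarEnvelope A) :=
  Completion.continuous_map

instance : StarRing (CStarEnvelope A) where
  star_involutive a := by
    refine denseRange.induction_on a
      (isClosed_eq (continuous_star'.comp continuous_star') continuous_id) fun a => ?_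
    rw [star_toEnvelope, star_toEnvelope, star_star]
  star_mul a b := by
    refine denseRange.induction_on₂ (isClosed_eq (continuous_star'.comp continuous_mul)
      ((continuous_star'.comp continuous_snd).mul (continuous_star'.comp continuous_fst)))
      (fun a b => ?_) a b
    simp only [star_toEnvelope, ← map_mul, star_mul]
  star_add a b := by
    refine denseRange.induction_on₂ (isClosed_eq (continuous_star'.comp continuous_add)
      ((continuous_star'.comp continuous_fst).add (continuous_star'.comp continuous_snd)))
      (fun a b => ?_) a b
    simp only [star_toEnvelope, ← map_add, star_add]

variable (A) in
/-- The canonical `*`-homomorphism of `A` into its enveloping C*-algebra. -/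
def of : A →⋆ₐ[ℂ] CStarEnvelope A :=
  { toEnvelope A with map_star' := fun a => (star_toEnvelope a).symm }

instance : CStarRing (CStarEnvelope A) where
  norm_mul_self_le a := by
    refine denseRange.induction_on a (isClosed_le (continuous_norm.mul continuous_norm)
      (continuous_norm.comp (continuous_star'.mul continuous_id))) fun a => ?_
    rw [star_toEnvelope, ← map_mul, norm_toEnvelope, norm_toEnvelope, ← sq]
    exact ((maxCStarSeminorm A).star_mul_self a).ge

instance [StarModule ℂ A] : StarModule ℂ (CStarEnvelope A) where
  star_smul c a := by
    refine denseRange.induction_on a (isClosed_eq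
      (continuous_star'.comp (continuous_const_smul c))
      ((continuous_const_smul (star c)).comp continuous_star')) fun a => ?_
    rw [← map_smul, star_toEnvelope, star_smul, map_smul, star_toEnvelope]

instance [StarModule ℂ A] : CStarAlgebra (CStarEnvelope A) where

end CStarEnvelope

end Envelope

section Tame
variable {A E : Type*} [Ring A] [StarRing A]

/-- The multiplicative semigroup `U` generated by the elements `x e` and `(x e)*`. -/
def wordSemigroup (x : E → A) : Subsemigroup A :=
  Subsemigroup.closure (Set.range x ∪ Set.range fun e => star (x e))

/-- The commutators `[u u*, w w*]` of the final projections `e(u) = u u*` and `e(w) = w w*`,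
for `u, w` in the semigroup generated by the `x e` and `(x e)*`. -/
def finalCommutators (x : E → A) : Set A :=
  {c | ∃ u ∈ wordSemigroup x, ∃ w ∈ wordSemigroup x,
    c = (u * star u) * (w * star w) - (w * star w) * (u * star u)}

/-- A family of partial isometries such that the final projections of all words in them and their
adjoints commute. (All words are then partial isometries, see `word_partialIsometry`.) -/
class TameFamily (x : E → A) : Prop where
  partialIsometry : ∀ e, x e * star (x e) * x e = x e
  commute : ∀ u ∈ wordSemigroup x, ∀ w ∈ wordSemigroup x, Commute (u * star u) (w * star w)

variable {x : E → A}

theorem mem_wordSemigroup (e : E) : x e ∈ wordSemigroup x :=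
  Subsemigroup.subset_closure (Or.inl ⟨e, rfl⟩)

theorem star_mem_wordSemigroup (e : E) : star (x e) ∈ wordSemigroup x :=
  Subsemigroup.subset_closure (Or.inr ⟨e, rfl⟩)

theorem star_mem_of_mem {u : A} (hu : u ∈ wordSemigroup x) : star u ∈ wordSemigroup x := by
  induction hu using Subsemigroup.closure_induction with
  | mem u hu =>
    rcases hu with ⟨e, rfl⟩ | ⟨e, rfl⟩
    · exact star_mem_wordSemigroup e
    · simpa using mem_wordSemigroup e
  | mul u w _ _ hu hw => rw [star_mul]; exact mul_mem hw hu

theorem TameFamily.word_partialIsometry [TameFamily x] {u : A} (hu : u ∈ wordSemigroup x) :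
    u * star u * u = u := by
  induction hu using Subsemigroup.closure_induction with
  | mem u hu =>
    rcases hu with ⟨e, rfl⟩ | ⟨e, rfl⟩
    · exact partialIsometry e
    · have := congrArg star (partialIsometry (x := x) e)
      simpa [mul_assoc] using this
  | mul u w hu' hw' hu hw =>
    have hc := (commute (star u) (star_mem_of_mem hu') w hw').eq
    rw [star_star] at hc
    calc u * w * star (u * w) * (u * w) = u * ((w * star w) * (star u * u)) * w := by
          simp only [star_mul, mul_assoc]
      _ = (u * star u * u) * (w * star w * w) := by rw [← hc]; simp only [mul_assoc]
      _ = u * w := by rw [hu, hw]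

theorem star_mem_finalCommutators {c : A} (hc : c ∈ finalCommutators x) :
    star c ∈ finalCommutators x := by
  obtain ⟨u, hu, w, hw, rfl⟩ := hc
  exact ⟨w, hw, u, hu, by simp⟩

theorem exists_of_mem_wordSemigroup_map {K B : Type*} [CommSemiring K] [Algebra K A] [Ring B]
    [StarRing B] [Algebra K B] (f : A →⋆ₐ[K] B) {u : B}
    (hu : u ∈ wordSemigroup fun e => f (x e)) : ∃ v ∈ wordSemigroup x, f v = u := by
  induction hu using Subsemigroup.closure_induction with
  | mem u hu =>
    rcases hu with ⟨e, rfl⟩ | ⟨e, rfl⟩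
    · exact ⟨_, mem_wordSemigroup e, rfl⟩
    · exact ⟨_, star_mem_wordSemigroup e, map_star f _⟩
  | mul u w _ _ hu hw =>
    obtain ⟨v, hv, rfl⟩ := hu
    obtain ⟨v', hv', rfl⟩ := hw
    exact ⟨v * v', mul_mem hv hv', map_mul f v v'⟩

end Tame

section Spectrum
variable {A E : Type*} [Ring A] [StarRing A] [Algebra ℂ A]

/-- The commutative subalgebra generated by the final projections `u u*` of all words `u`. -/
def finalAlgebra (x : E → A) : Subalgebra ℂ A :=
  Algebra.adjoin ℂ {p | ∃ u ∈ wordSemigroup x, p = u * star u}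

/-- The space of characters of `finalAlgebra x`, with the topology of pointwise convergence. The
algebra is spanned by commuting projections, so this is the Stone space of its Boolean algebra of
projections, and the Gelfand spectrum of its C*-completion. -/
def FinalSpectrum (x : E → A) : Type _ := finalAlgebra x →ₐ[ℂ] ℂ

namespace FinalSpectrum
variable {x : E → A}

/-- A point of the space, as a character. -/
def eval (χ : FinalSpectrum x) : finalAlgebra x →ₐ[ℂ] ℂ := χ

instance : TopologicalSpace (FinalSpectrum x) :=
  TopologicalSpace.induced (fun χ (b : finalAlgebra x) => χ.eval b) inferInstance

theorem continuous_eval (b : finalAlgebra x) : Continuous fun χ : FinalSpectrum x => χ.eval b :=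
  (continuous_apply b).comp continuous_induced_dom

theorem continuousOn_iff {Y : Type*} [TopologicalSpace Y] {f : Y → FinalSpectrum x} {s : Set Y} :
    ContinuousOn f s ↔ ∀ b, ContinuousOn (fun y => (f y).eval b) s := by
  rw [continuousOn_iff_continuous_domRestrict, continuous_induced_rng, continuous_pi_iff]
  simp only [continuousOn_iff_continuous_domRestrict]
  rfl

theorem ext {χ ψ : FinalSpectrum x} (h : ∀ b, χ.eval b = ψ.eval b) : χ = ψ := AlgHom.ext h

theorem final_mem {u : A} (hu : u ∈ wordSemigroup x) : u * star u ∈ finalAlgebra x :=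
  Algebra.subset_adjoin ⟨u, hu, rfl⟩

theorem initial_mem {u : A} (hu : u ∈ wordSemigroup x) : star u * u ∈ finalAlgebra x := by
  simpa using final_mem (star_mem_of_mem hu)

variable [TameFamily x]

theorem commute_final {u b : A} (hu : u ∈ wordSemigroup x) (hb : b ∈ finalAlgebra x) :
    Commute (u * star u) b := by
  induction hb using Algebra.adjoin_induction with
  | mem b hb =>
    obtain ⟨w, hw, rfl⟩ := hb
    exact TameFamily.commute u hu w hw
  | algebraMap c => exact (Algebra.commutes c _).symm
  | add a b _ _ ha hb => exact ha.add_right hb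
  | mul a b _ _ ha hb => exact ha.mul_right hb

theorem conj_mul {u : A} (hu : u ∈ wordSemigroup x) (a : A) {b : A} (hb : b ∈ finalAlgebra x) :
    star u * (a * b) * u = (star u * a * u) * (star u * b * u) := by
  calc star u * (a * b) * u = star u * (a * b) * (u * star u * u) := by
        rw [TameFamily.word_partialIsometry hu]
    _ = star u * a * (b * (u * star u)) * u := by simp only [mul_assoc]
    _ = _ := by rw [← (commute_final hu hb).eq]; simp only [mul_assoc]

theorem conj_mem {u b : A} (hu : u ∈ wordSemigroup x) (hb : b ∈ finalAlgebra x) :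
    star u * b * u ∈ finalAlgebra x := by
  induction hb using Algebra.adjoin_induction with
  | mem b hb =>
    obtain ⟨w, hw, rfl⟩ := hb
    have := final_mem (mul_mem (star_mem_of_mem hu) hw)
    simpa [mul_assoc] using this
  | algebraMap c =>
    rw [← Algebra.commutes, mul_assoc]
    exact mul_mem (Subalgebra.algebraMap_mem _ c) (initial_mem hu)
  | add a b _ _ ha hb => rw [mul_add, add_mul]; exact add_mem ha hb
  | mul a b _ hb' ha hb => rw [conj_mul hu a hb']; exact mul_mem ha hb

/-- `b ↦ u* b u` on the algebra of final projections. -/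
def conj {u : A} (hu : u ∈ wordSemigroup x) : finalAlgebra x →ₗ[ℂ] finalAlgebra x where
  toFun b := ⟨star u * b * u, conj_mem hu b.2⟩
  map_add' a b := Subtype.ext (by simp [mul_add, add_mul])
  map_smul' c b := Subtype.ext (by simp)

/-- The initial projection `u* u`. -/
def initial {u : A} (hu : u ∈ wordSemigroup x) : finalAlgebra x := ⟨star u * u, initial_mem hu⟩

/-- The final projection `u u*`. -/
def final {u : A} (hu : u ∈ wordSemigroup x) : finalAlgebra x := ⟨u * star u, final_mem hu⟩

/-- The character `b ↦ χ(u* b u)`, for a character `χ` with `χ(u* u) = 1`. -/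
def move {u : A} (hu : u ∈ wordSemigroup x) (χ : FinalSpectrum x)
    (h : χ.eval (initial hu) = 1) : FinalSpectrum x :=
  AlgHom.ofLinearMap (χ.eval.toLinearMap.comp (conj hu))
    (by
      have : conj hu 1 = initial hu := Subtype.ext (by simp [conj, initial])
      simpa [this] using h)
    fun a b => by
      have : conj hu (a * b) = conj hu a * conj hu b := Subtype.ext (conj_mul hu _ b.2)
      simp [this]

theorem move_eval {u : A} (hu : u ∈ wordSemigroup x) (χ : FinalSpectrum x)
    (h : χ.eval (initial hu) = 1) (b : finalAlgebra x) :
    (move hu χ h).eval b = χ.eval (conj hu b) := rfl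

theorem conj_final {u : A} (hu : u ∈ wordSemigroup x) : conj hu (final hu) = initial hu :=
  Subtype.ext (by
    change star u * (u * star u) * u = star u * u
    rw [mul_assoc, TameFamily.word_partialIsometry hu])

theorem move_final {u : A} (hu : u ∈ wordSemigroup x) (χ : FinalSpectrum x)
    (h : χ.eval (initial hu) = 1) : (move hu χ h).eval (final hu) = 1 := by
  rw [move_eval, conj_final, h]

theorem eval_conj_conj {u w : A} (hu : u ∈ wordSemigroup x) (hw : w ∈ wordSemigroup x)
    (h' : star w = u) (χ : FinalSpectrum x) (h : χ.eval (initial hu) = 1) (b : finalAlgebra x) :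
    χ.eval (conj hu (conj hw b)) = χ.eval b := by
  have : conj hu (conj hw b) = initial hu * b * initial hu := Subtype.ext (by
    subst h'
    simp [conj, initial, mul_assoc])
  rw [this, map_mul, map_mul, h, one_mul, mul_one]

theorem final_eq_initial {u w : A} (hu : u ∈ wordSemigroup x) (hw : w ∈ wordSemigroup x)
    (h : star w = u) : (final hu : finalAlgebra x) = initial hw := by
  subst h; exact Subtype.ext (by simp [final, initial])

theorem final_isIdempotent {u : A} (hu : u ∈ wordSemigroup x) : final hu * final hu = final hu :=
  Subtype.ext (by
    change u * star u * (u * star u) = u * star u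
    rw [← mul_assoc, TameFamily.word_partialIsometry hu])

theorem eval_final {u : A} (hu : u ∈ wordSemigroup x) (χ : FinalSpectrum x) :
    χ.eval (final hu) = 0 ∨ χ.eval (final hu) = 1 := by
  have := congrArg χ.eval (final_isIdempotent hu)
  rw [map_mul] at this
  rcases eq_or_ne (χ.eval (final hu)) 0 with h | h
  · exact Or.inl h
  · exact Or.inr (mul_right_cancel₀ h (this.trans (one_mul _).symm))

theorem isClopen_final {u : A} (hu : u ∈ wordSemigroup x) :
    IsClopen {χ : FinalSpectrum x | χ.eval (final hu) = 1} := by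
  refine ⟨isClosed_singleton.preimage (continuous_eval (final hu)), ?_⟩
  have : {χ : FinalSpectrum x | χ.eval (final hu) = 1} = {χ | χ.eval (final hu) ≠ 0} := by
    ext χ
    rcases eval_final hu χ with h | h <;> simp [h]
  rw [this]
  exact isOpen_ne.preimage (continuous_eval (final hu))

theorem isClopen_initial {u : A} (hu : u ∈ wordSemigroup x) :
    IsClopen {χ : FinalSpectrum x | χ.eval (initial hu) = 1} := by
  have h := isClopen_final (star_mem_of_mem hu)
  have e : final (star_mem_of_mem hu) = initial hu := Subtype.ext (by simp [final, initial])
  rwa [e] at h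

open Classical in
/-- The map `χ ↦ χ(u* · u)` on `{χ | χ(u* u) = 1}`, extended by the identity. -/
def moveFun {u : A} (hu : u ∈ wordSemigroup x) (χ : FinalSpectrum x) : FinalSpectrum x :=
  if h : χ.eval (initial hu) = 1 then move hu χ h else χ

theorem moveFun_eval {u : A} (hu : u ∈ wordSemigroup x) {χ : FinalSpectrum x}
    (h : χ.eval (initial hu) = 1) (b : finalAlgebra x) :
    (moveFun hu χ).eval b = χ.eval (conj hu b) := by
  rw [moveFun, dif_pos h, move_eval]

theorem moveFun_final {u : A} (hu : u ∈ wordSemigroup x) {χ : FinalSpectrum x}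
    (h : χ.eval (initial hu) = 1) : (moveFun hu χ).eval (final hu) = 1 := by
  rw [moveFun, dif_pos h, move_final]

theorem moveFun_moveFun {u w : A} (hu : u ∈ wordSemigroup x) (hw : w ∈ wordSemigroup x)
    (h' : star w = u) {χ : FinalSpectrum x} (h : χ.eval (initial hu) = 1) :
    moveFun hw (moveFun hu χ) = χ := by
  refine ext fun b => ?_
  rw [moveFun_eval hw (by rw [← final_eq_initial hu hw h']; exact moveFun_final hu h),
    moveFun_eval hu h, eval_conj_conj hu hw h' χ h]

theorem continuousOn_moveFun {u : A} (hu : u ∈ wordSemigroup x) :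
    ContinuousOn (moveFun hu) {χ : FinalSpectrum x | χ.eval (initial hu) = 1} :=
  continuousOn_iff.2 fun b =>
    (continuous_eval (conj hu b)).continuousOn.congr fun _ h => moveFun_eval hu h b

variable (x) in
/-- The homeomorphism `θ_e : χ ↦ χ(x_e* · x_e)` of `{χ | χ(x_e* x_e) = 1}` onto
`{χ | χ(x_e x_e*) = 1}`, dual to the isomorphism `b ↦ x_e b x_e*` of algebras. -/
def edgeHomeo (e : E) : OpenPartialHomeomorph (FinalSpectrum x) (FinalSpectrum x) where
  toFun := moveFun (mem_wordSemigroup e)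
  invFun := moveFun (star_mem_wordSemigroup e)
  source := {χ | χ.eval (initial (mem_wordSemigroup e)) = 1}
  target := {χ | χ.eval (final (mem_wordSemigroup e)) = 1}
  map_source' _ h := moveFun_final _ h
  map_target' χ h := by
    change χ.eval _ = 1 at h
    rw [final_eq_initial _ (star_mem_wordSemigroup e) (star_star _)] at h
    change (moveFun _ χ).eval _ = 1
    rw [← final_eq_initial (star_mem_wordSemigroup e) _ rfl]
    exact moveFun_final _ h
  left_inv' _ h := moveFun_moveFun _ _ (star_star _) h
  right_inv' χ h := by
    change χ.eval _ = 1 at h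
    rw [final_eq_initial _ (star_mem_wordSemigroup e) (star_star _)] at h
    exact moveFun_moveFun _ _ rfl h
  open_source := (isClopen_initial _).isOpen
  open_target := (isClopen_final _).isOpen
  continuousOn_toFun := continuousOn_moveFun _
  continuousOn_invFun := by
    rw [final_eq_initial _ (star_mem_wordSemigroup e) (star_star _)]
    exact continuousOn_moveFun _

theorem bounded (b : finalAlgebra x) : ∃ r : ℝ, ∀ χ : FinalSpectrum x, ‖χ.eval b‖ ≤ r := by
  obtain ⟨b, hb⟩ := b
  induction hb using Algebra.adjoin_induction with
  | mem b hb =>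
    obtain ⟨u, hu, rfl⟩ := hb
    refine ⟨1, fun χ => ?_⟩
    rcases eval_final hu χ with h | h <;> rw [final] at h <;> simp [h]
  | algebraMap c =>
    refine ⟨‖c‖, fun χ => ?_⟩
    have : χ.eval ⟨algebraMap ℂ A c, Subalgebra.algebraMap_mem _ c⟩ = c := χ.eval.commutes c
    rw [this]
  | add a b ha hb ha' hb' =>
    obtain ⟨r, hr⟩ := ha'
    obtain ⟨s, hs⟩ := hb'
    refine ⟨r + s, fun χ => ?_⟩
    have : χ.eval ⟨a + b, add_mem ha hb⟩ = χ.eval ⟨a, ha⟩ + χ.eval ⟨b, hb⟩ :=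
      map_add χ.eval ⟨a, ha⟩ ⟨b, hb⟩
    rw [this]
    exact (norm_add_le _ _).trans (add_le_add (hr χ) (hs χ))
  | mul a b ha hb ha' hb' =>
    obtain ⟨r, hr⟩ := ha'
    obtain ⟨s, hs⟩ := hb'
    refine ⟨r * s, fun χ => ?_⟩
    have : χ.eval ⟨a * b, mul_mem ha hb⟩ = χ.eval ⟨a, ha⟩ * χ.eval ⟨b, hb⟩ :=
      map_mul χ.eval ⟨a, ha⟩ ⟨b, hb⟩
    rw [this, norm_mul]
    exact mul_le_mul (hr χ) (hs χ) (norm_nonneg _) ((norm_nonneg _).trans (hr χ))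

instance : CompactSpace (FinalSpectrum x) := by
  choose r hr using bounded (x := x)
  have hind : Topology.IsInducing fun (χ : FinalSpectrum x) (b : finalAlgebra x) => χ.eval b := ⟨rfl⟩
  rw [← isCompact_univ_iff, hind.isCompact_iff, Set.image_univ]
  refine IsCompact.of_isClosed_subset
    (isCompact_univ_pi fun b => isCompact_closedBall (0 : ℂ) (r b)) ?_ ?_
  · have : (Set.range fun (χ : FinalSpectrum x) (b : finalAlgebra x) => χ.eval b) =
        {φ | (∀ c, φ (algebraMap ℂ _ c) = c) ∧ (∀ a b, φ (a + b) = φ a + φ b) ∧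
          ∀ a b, φ (a * b) = φ a * φ b} := by
      ext φ
      constructor
      · rintro ⟨χ, rfl⟩
        exact ⟨χ.eval.commutes, map_add _, map_mul _⟩
      · rintro ⟨h1, h2, h3⟩
        have h0 : φ 0 = 0 := by simpa using h1 0
        have h1' : φ 1 = 1 := by simpa using h1 1
        exact ⟨({ toFun := φ, map_one' := h1', map_mul' := h3, map_zero' := h0, map_add' := h2,
                  commutes' := h1 } : finalAlgebra x →ₐ[ℂ] ℂ), rfl⟩
    rw [this]
    simp only [Set.ofPred_and, Set.ofPred_forall]
    refine IsClosed.inter ?_ (IsClosed.inter ?_ ?_)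
    · exact isClosed_iInter fun c => isClosed_eq (continuous_apply _) continuous_const
    · exact isClosed_iInter fun a => isClosed_iInter fun b =>
        isClosed_eq (by fun_prop) (by fun_prop)
    · exact isClosed_iInter fun a => isClosed_iInter fun b =>
        isClosed_eq (by fun_prop) (by fun_prop)
  · rintro _ ⟨χ, rfl⟩ b -
    simpa using hr b χ

end FinalSpectrum
end Spectrum

section Quot
variable {A : Type*} [Ring A] [StarRing A]

/-- The ideal is closed under the involution. -/
class TwoSidedIdeal.IsStarClosed (I : TwoSidedIdeal A) : Prop where
  star_mem : ∀ a ∈ I, star a ∈ I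

/-- The quotient `*`-algebra `A / I`, for a two-sided ideal `I` closed under the involution. -/
def StarQuotient (I : TwoSidedIdeal A) : Type _ := I.ringCon.Quotient

namespace StarQuotient
variable (I : TwoSidedIdeal A)

instance : Ring (StarQuotient I) := inferInstanceAs (Ring I.ringCon.Quotient)

instance {K : Type*} [CommSemiring K] [Algebra K A] : Algebra K (StarQuotient I) :=
  inferInstanceAs (Algebra K I.ringCon.Quotient)

variable {I} in
theorem ind {p : StarQuotient I → Prop} (h : ∀ a : A, p (I.ringCon.mk' a)) (a : StarQuotient I) : p a :=
  Quotient.ind h a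

variable [I.IsStarClosed]

theorem rel_star {a b : A} (h : I.ringCon a b) : I.ringCon (star a) (star b) := by
  rw [TwoSidedIdeal.rel_iff] at *
  rw [← star_sub]
  exact TwoSidedIdeal.IsStarClosed.star_mem _ h

instance : Star (StarQuotient I) := ⟨Quotient.map star fun _ _ => rel_star I⟩

instance : StarRing (StarQuotient I) where
  star_involutive := by
    refine ind fun a => ?_
    exact congrArg I.ringCon.mk' (star_star a)
  star_mul := by
    refine ind fun a => ind fun b => ?_
    exact congrArg I.ringCon.mk' (star_mul a b)
  star_add := by
    refine ind fun a => ind fun b => ?_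
    exact congrArg I.ringCon.mk' (star_add a b)

variable (K : Type*) [CommSemiring K] [StarRing K] [Algebra K A] [StarModule K A]

instance : StarModule K (StarQuotient I) where
  star_smul c := by
    refine ind fun a => ?_
    exact congrArg I.ringCon.mk' (star_smul c a)

/-- The quotient map. -/
def mk : A →⋆ₐ[K] StarQuotient I :=
  { (I.ringCon.mk' : A →+* I.ringCon.Quotient) with
    toFun := I.ringCon.mk'
    commutes' := fun _ => rfl
    map_star' := fun _ => rfl }

theorem mk_surjective : Function.Surjective (mk I K) := ind fun a => ⟨a, rfl⟩

theorem mk_eq_iff {a b : A} : mk I K a = mk I K b ↔ a - b ∈ I :=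
  (RingCon.eq I.ringCon).trans (TwoSidedIdeal.rel_iff I a b)

end StarQuotient

theorem TwoSidedIdeal.isStarClosed_span {S : Set A} (hS : ∀ a ∈ S, star a ∈ S) :
    (TwoSidedIdeal.span S).IsStarClosed where
  star_mem a ha := by
    let I := TwoSidedIdeal.span S
    let J : TwoSidedIdeal A := .mk' {a | star a ∈ I}
      (by simp [I.zero_mem])
      (fun {a b} ha hb => by simpa using I.add_mem (x := star a) (y := star b) ha hb)
      (fun {a} ha => by simpa using I.neg_mem (x := star a) ha)
      (fun {a b} hb => by simpa using I.mul_mem_right (star b) (star a) hb)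
      (fun {a b} hb => by simpa using I.mul_mem_left (star b) (star a) hb)
    have : a ∈ J := TwoSidedIdeal.mem_span_iff.1 ha J fun b hb => by
      simpa [J, I, TwoSidedIdeal.mem_mk'] using TwoSidedIdeal.subset_span (hS b hb)
    simpa [J, I, TwoSidedIdeal.mem_mk'] using this

/-- The closure of a two-sided ideal of a topological ring. -/
def TwoSidedIdeal.topClosure [TopologicalSpace A] [IsTopologicalRing A] (I : TwoSidedIdeal A) :
    TwoSidedIdeal A :=
  .mk' (closure (I : Set A)) (subset_closure I.zero_mem)
    (fun {_ _} ha hb => map_mem_closure₂ continuous_add ha hb fun _ ha _ hb => I.add_mem ha hb)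
    (fun {_} ha => map_mem_closure continuous_neg ha fun _ ha => I.neg_mem ha)
    (fun {a b} hb => map_mem_closure (continuous_const_mul a) hb fun _ => I.mul_mem_left _ _)
    (fun {a b} hb => map_mem_closure (f := fun t => t * b) (continuous_mul_const b) hb fun _ => I.mul_mem_right _ _)

instance [TopologicalSpace A] [IsTopologicalRing A] [ContinuousStar A] (I : TwoSidedIdeal A)
    [I.IsStarClosed] : I.topClosure.IsStarClosed where
  star_mem a ha := by
    rw [TwoSidedIdeal.topClosure, TwoSidedIdeal.mem_mk'] at *
    exact map_mem_closure continuous_star ha fun _ => TwoSidedIdeal.IsStarClosed.star_mem _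

end Quot
section Bounded
variable {A : Type*} [Ring A] [StarRing A] [Algebra ℂ A]

namespace CStarSeminorm

/-- The values of all C*-seminorms at `a` are bounded. -/
def IsBddAt (a : A) : Prop := BddAbove (Set.range fun p : CStarSeminorm A => p a)

theorem IsBddAt.of_le {a : A} {r : ℝ} (h : ∀ p : CStarSeminorm A, p a ≤ r) : IsBddAt a :=
  ⟨r, by rintro _ ⟨p, rfl⟩; exact h p⟩

theorem IsBddAt.exists_le {a : A} (h : IsBddAt a) : ∃ r, ∀ p : CStarSeminorm A, p a ≤ r := by
  obtain ⟨r, hr⟩ := h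
  exact ⟨r, fun p => hr ⟨p, rfl⟩⟩

theorem IsBddAt.add {a b : A} (ha : IsBddAt a) (hb : IsBddAt b) : IsBddAt (a + b) := by
  obtain ⟨r, hr⟩ := ha.exists_le
  obtain ⟨s, hs⟩ := hb.exists_le
  exact .of_le fun p => (p.add_le a b).trans (add_le_add (hr p) (hs p))

theorem IsBddAt.mul {a b : A} (ha : IsBddAt a) (hb : IsBddAt b) : IsBddAt (a * b) := by
  obtain ⟨r, hr⟩ := ha.exists_le
  obtain ⟨s, hs⟩ := hb.exists_le
  exact .of_le fun p => (p.mul_le a b).trans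
    (mul_le_mul (hr p) (hs p) (p.nonneg b) ((p.nonneg a).trans (hr p)))

theorem IsBddAt.smul (c : ℂ) {a : A} (ha : IsBddAt a) : IsBddAt (c • a) := by
  obtain ⟨r, hr⟩ := ha.exists_le
  exact .of_le fun p => (p.map_smul c a).le.trans
    (mul_le_mul_of_nonneg_left (hr p) (norm_nonneg c))

theorem isBddAt_zero : IsBddAt (0 : A) := .of_le fun p => p.map_zero.le

theorem isBddAt_one : IsBddAt (1 : A) := .of_le fun p => p.one_le_one

theorem IsBddAt.of_star_mul_self {a : A} (ha : IsBddAt (star a * a)) : IsBddAt a := by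
  obtain ⟨r, hr⟩ := ha.exists_le
  refine .of_le (r := Real.sqrt r) fun p => Real.le_sqrt_of_sq_le ?_
  rw [← p.star_mul_self]; exact hr p

/-- The pull-back of a C*-seminorm along a `*`-homomorphism. -/
def comap {B : Type*} [Ring B] [StarRing B] [Algebra ℂ B] (p : CStarSeminorm A)
    (f : B →⋆ₐ[ℂ] A) : CStarSeminorm B where
  toSeminorm := p.toSeminorm.comp f.toAlgHom.toLinearMap
  mul_le' a b := by
    change p (f (a * b)) ≤ p (f a) * p (f b)
    rw [map_mul]; exact p.mul_le _ _
  star_mul_self' a := by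
    change p (f (star a * a)) = p (f a) ^ 2
    rw [map_mul, StarHomClass.map_star]; exact p.star_mul_self _

theorem IsBddAt.map {B : Type*} [Ring B] [StarRing B] [Algebra ℂ B] (f : B →⋆ₐ[ℂ] A) {b : B}
    (hb : IsBddAt b) : IsBddAt (f b) := by
  obtain ⟨r, hr⟩ := hb.exists_le
  exact .of_le fun p => hr (p.comap f)

theorem isBddAt_of_cstarAlgebra {B : Type*} [CStarAlgebra B] (b : B) : IsBddAt b := by
  have hb : b ∈ Submodule.span ℂ (unitary B : Set B) := by
    rw [CStarAlgebra.span_unitary]; trivial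
  induction hb using Submodule.span_induction with
  | mem u hu => exact .of_star_mul_self (by rw [Unitary.star_mul_self_of_mem hu]; exact isBddAt_one)
  | zero => exact isBddAt_zero
  | add a b _ _ ha hb => exact ha.add hb
  | smul c a _ ha => exact ha.smul c

end CStarSeminorm

open CStarSeminorm

instance {V E : Type*} [Fintype V] (G : SeparatedGraph V E) :
    CStarBounded (LeavittPathAlgebra ℂ G) where
  bddAbove a := by
    change IsBddAt a
    have hv (v : V) : star (LeavittPathAlgebra.vertex ℂ G v) * LeavittPathAlgebra.vertex ℂ G v =
        LeavittPathAlgebra.vertex ℂ G v := by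
      rw [LeavittPathAlgebra.star_vertex, LeavittPathAlgebra.vertex_mul_self]
    have he (e : E) : IsBddAt (LeavittPathAlgebra.edge ℂ G e) := .of_le fun p =>
      p.le_one_of_star_mul_self (LeavittPathAlgebra.star_edge_mul_edge e) (hv _)
    induction a using LeavittPathAlgebra.induction with
    | halg c => rw [Algebra.algebraMap_eq_smul_one]; exact isBddAt_one.smul c
    | hgen x =>
      cases x with
      | vertex v => exact .of_le fun p => p.le_one_of_proj (hv v)
      | edge e => exact he e
      | ghost e =>
        obtain ⟨r, hr⟩ := (he e).exists_le
        have : LeavittPathAlgebra.gen ℂ G (.ghost e) = star (LeavittPathAlgebra.edge ℂ G e) :=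
          (LeavittPathAlgebra.star_gen (LGen.edge e)).symm
        rw [this]
        exact .of_le fun p => (p.map_star _).le.trans (hr p)
    | hadd a b ha hb => exact ha.add hb
    | hmul a b ha hb => exact ha.mul hb

namespace PartialAction
variable {G X : Type*} [Group G] [DecidableEq G] [TopologicalSpace X] (θ : PartialAction G X)

/-- The embedding `f ↦ f δ_1`. -/
def CrossedProduct.ofFun : C(X, ℂ) →⋆ₐ[ℂ] θ.CrossedProduct ℂ where
  toFun f := CrossedProduct.single 1 ⟨f, θ.mem_ideal_zero f⟩
  map_one' := rfl
  map_mul' f g := by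
    rw [CrossedProduct.single_mul]
    refine CrossedProduct.single_congr (mul_one 1).symm ?_
    change f * g = θ.pull 1 (θ.pull 1⁻¹ f * g)
    ext x
    rw [θ.mul_apply_of_mem _ _ (by simp [θ.dom_one]), inv_one, θ.one_apply]; rfl
  map_zero' := (map_zero (DirectSum.of (fun g : Additive G => θ.ideal ℂ g) 0))
  map_add' f g := CrossedProduct.single_add (θ := θ) 1 ⟨f, θ.mem_ideal_zero f⟩ ⟨g, θ.mem_ideal_zero g⟩
  commutes' c := rfl
  map_star' f := by
    rw [CrossedProduct.star_single]
    refine CrossedProduct.single_congr inv_one.symm ?_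
    change star f = CrossedProduct.starFn θ 1 f
    ext x
    rw [CrossedProduct.starFn_of_mem _ (by simp [θ.dom_one]), θ.one_apply]; rfl

instance [CompactSpace X] : CStarBounded (θ.CrossedProduct ℂ) where
  bddAbove a := by
    change IsBddAt a
    induction a using CrossedProduct.induction with
    | h0 => exact isBddAt_zero
    | hadd a b ha hb => exact ha.add hb
    | hs g a =>
      refine .of_star_mul_self ?_
      have : ∃ f, star (CrossedProduct.single g a : θ.CrossedProduct ℂ) *
          CrossedProduct.single g a = CrossedProduct.ofFun θ f := by
        rw [CrossedProduct.star_single, CrossedProduct.single_mul]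
        exact ⟨_, CrossedProduct.single_congr (inv_mul_cancel g) rfl⟩
      obtain ⟨f, hf⟩ := this
      rw [hf]
      exact (isBddAt_of_cstarAlgebra (B := C(X, ℂ)) f).map _

variable {θ} in
/-- The element `1_{X_g} δ_g` of the crossed product. -/
def CrossedProduct.delta {R : Type*} [CommRing R] [TopologicalSpace R] [IsTopologicalRing R]
    (g : G) : θ.CrossedProduct R :=
  CrossedProduct.single g ⟨θ.pull g 1, θ.pull_mem g 1⟩

/-- The full C*-algebra crossed product `C(X) ⋊_α G`, for `X` compact: the enveloping C*-algebra of
the algebraic crossed product of the algebra of continuous functions `X → ℂ`. -/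
abbrev FullCrossedProduct [CompactSpace X] : Type _ := CStarEnvelope (θ.CrossedProduct ℂ)

end PartialAction
end Bounded

namespace SeparatedGraph
section
variable (K : Type*) [Field K] [StarRing K] {V E : Type*} [Fintype V] (G : SeparatedGraph V E)

/-- The ideal of `L_K(E, C)` generated by the commutators `[e(u), e(w)]` of final projections of
elements of the semigroup generated by the edges and their adjoints. -/
def abIdeal : TwoSidedIdeal (LeavittPathAlgebra K G) :=
  TwoSidedIdeal.span (finalCommutators (LeavittPathAlgebra.edge K G))

instance : (G.abIdeal K).IsStarClosed :=
  TwoSidedIdeal.isStarClosed_span fun _ => star_mem_finalCommutators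

/-- The algebra `L^{ab}_K(E, C)`. -/
abbrev Lab : Type _ := StarQuotient (G.abIdeal K)

/-- The image of the edge `e` in `L^{ab}_K(E, C)`. -/
def labEdge (e : E) : G.Lab K := StarQuotient.mk (G.abIdeal K) K (LeavittPathAlgebra.edge K G e)

instance : TameFamily (G.labEdge K) where
  partialIsometry e := by
    simp only [labEdge, ← map_star, ← map_mul]
    rw [mul_assoc, LeavittPathAlgebra.star_edge_mul_edge, LeavittPathAlgebra.edge_mul_source]
  commute u hu w hw := by
    obtain ⟨u, hu', rfl⟩ := exists_of_mem_wordSemigroup_map (StarQuotient.mk (G.abIdeal K) K) hu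
    obtain ⟨w, hw', rfl⟩ := exists_of_mem_wordSemigroup_map (StarQuotient.mk (G.abIdeal K) K) hw
    simp only [← map_star, ← map_mul, Commute, SemiconjBy]
    rw [StarQuotient.mk_eq_iff]
    exact TwoSidedIdeal.subset_span ⟨u, hu', w, hw', rfl⟩
end

section
variable {V E : Type*} [Fintype V] (G : SeparatedGraph V E)

/-- The space `Ω(E, C)`: the spectrum of the commutative subalgebra of `L^{ab}_ℂ(E, C)` generated by
the final projections of the elements of the semigroup generated by the edges and their adjoints. -/
abbrev Omega : Type _ := FinalSpectrum (G.labEdge ℂ)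

/-- The partial action of the free group on `E¹` on `Ω(E, C)`: the edge `e` acts as the
homeomorphism `Ω_{s(e)} → H_e` dual to conjugation by `e`. -/
def freeAction [DecidableEq E] : PartialAction (FreeGroup E) G.Omega :=
  .ofFree (FinalSpectrum.edgeHomeo (G.labEdge ℂ))
    (fun _ => (FinalSpectrum.isClopen_initial _).isClosed)
    (fun _ => (FinalSpectrum.isClopen_final _).isClosed)

/-- The graph C*-algebra `C*(E, C)`, the enveloping C*-algebra of `L_ℂ(E, C)`. -/
abbrev GraphCStar : Type _ := CStarEnvelope (LeavittPathAlgebra ℂ G)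

/-- The image of the edge `e` in `C*(E, C)`. -/
def cstarEdge (e : E) : G.GraphCStar :=
  CStarEnvelope.of (LeavittPathAlgebra ℂ G) (LeavittPathAlgebra.edge ℂ G e)

/-- The ideal of `C*(E, C)` generated by the commutators of final projections. -/
def commIdeal : TwoSidedIdeal G.GraphCStar :=
  TwoSidedIdeal.span (finalCommutators G.cstarEdge)

instance : G.commIdeal.IsStarClosed :=
  TwoSidedIdeal.isStarClosed_span fun _ => star_mem_finalCommutators

/-- The C*-algebra `𝒪(E, C)`: the quotient of `C*(E, C)` by the closed ideal generated by the
commutators of final projections. -/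
abbrev TameCStar : Type _ := StarQuotient G.commIdeal.topClosure

/-- The image of the edge `e` in `𝒪(E, C)`. -/
def tameEdge (e : E) : G.TameCStar := StarQuotient.mk G.commIdeal.topClosure ℂ (G.cstarEdge e)
end
end SeparatedGraph

end

/-! Both algebras are governed by words in the edges and their adjoints. A word `L` has a value
`x_L` and a final projection `p_L = x_L x_L*` in any tame family. On Ω it is a composition of
partial homeomorphisms with clopen range `X_L`, and in the crossed product it is `1_{X_L} δ_[L]`.
Words are not assumed reduced: cancelling inside a word keeps its class in the free group but may
enlarge its range. Three facts match the two pictures. A character χ lies in `X_L` exactly when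
`χ(p_L) = 1` (`mem_wordRange`). The identity `x_L p_M = p_{LM} x_L` corresponds to `α_g(1_{X_M}) =
1_{X_{gM}}`. If `L` reduces to `M`, then `x_L = p_L x_M` (`wordVal_red`).

To the crossed product: send `e` to `1_{H_e} δ_e` and a vertex `v` to the indicator function of the
characters equal to 1 at `v`. The Leavitt relations can be read off at each character. Final
projections go to functions on Ω, which commute, so the map factors through `L^ab`, and in the
C*-case through `𝒪` after extension to the enveloping algebra.

Back from the crossed product: a representation π of the functions on Ω with `π(1_{X_L}) = p_L`,
covariant for the words, gives a `*`-homomorphism `f δ_g ↦ π(f) x_g` (`covariantHom`). Everything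
rests on the existence of π.

For a discrete field `K` the functions `1_{X_L}` span all continuous functions, so it must be shown
that a `K`-linear relation among them also holds among the `p_L` in `L^ab_K`. The difficulty is that
Ω is built from the complex algebra. A commutative `K`-algebra generated by idempotents has enough
`K`-valued characters (`exists_algHom_ne_zero`), and each character ψ of the algebra generated by
the `p_L` in `L^ab_K` yields a point of Ω with the same values 0 and 1 (`exists_omega`). To see
this, let words act by partial bijections on the set of such ψ. This makes the complex-valued
functions on that set a module over `L^ab_ℂ` in which final projections act as multiplication
operators, and evaluation at ψ is then a complex character. So a relation valid on Ω is annihilated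
by every ψ, and it holds in `L^ab_K`.

In the C*-case the images of the `p_L` in `𝒪` generate a commutative C*-algebra, whose characters
restrict to points of Ω. Pulling functions back along this map and inverting the Gelfand transform
gives π. This needs `𝒪`, a quotient by a closed ideal, to be a C*-algebra, and Stone–Weierstrass to
pass from the `1_{X_L}` to all functions.

The two homomorphisms are mutually inverse because they are so on generators. On the graph side the
edges suffice: in a bipartite graph every vertex is some `e*e` or a sum of `ee*`. On the crossed
product side every `f δ_g` is a function times a word. -/

noncomputable section

/-! ### Words in a tame family -/

section Words
variable {A E : Type*} [Ring A] [StarRing A]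

/-- The element of the algebra given by a letter of the free group. -/
def letterVal (x : E → A) : E × Bool → A
  | (e, true) => x e
  | (e, false) => star (x e)

/-- The product in the algebra of the letters of a word. -/
def wordVal (x : E → A) (L : List (E × Bool)) : A := (L.map (letterVal x)).prod

/-- The final projection of a word. -/
def wordProj (x : E → A) (L : List (E × Bool)) : A := wordVal x L * star (wordVal x L)

variable (x : E → A)

@[simp] theorem wordVal_nil : wordVal x [] = 1 := rfl

@[simp] theorem wordProj_nil : wordProj x [] = 1 := by simp [wordProj]

theorem wordVal_cons (a : E × Bool) (L : List (E × Bool)) :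
    wordVal x (a :: L) = letterVal x a * wordVal x L := by
  simp [wordVal]

theorem wordVal_append (L M : List (E × Bool)) :
    wordVal x (L ++ M) = wordVal x L * wordVal x M := by
  simp [wordVal]

theorem wordVal_singleton (a : E × Bool) : wordVal x [a] = letterVal x a := by
  simp [wordVal]

theorem letterVal_not (e : E) (b : Bool) : letterVal x (e, !b) = star (letterVal x (e, b)) := by
  cases b <;> simp [letterVal]

theorem wordVal_invRev (L : List (E × Bool)) :
    wordVal x (FreeGroup.invRev L) = star (wordVal x L) := by
  induction L with
  | nil => simp
  | cons a L ih =>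
    obtain ⟨e, b⟩ := a
    rw [FreeGroup.invRev_cons, wordVal_append, ih, wordVal_cons, star_mul, ← letterVal_not]
    simp [FreeGroup.invRev, wordVal_singleton]

/-- The empty word is excluded because its value 1 need not lie in the semigroup. -/
theorem wordVal_mem {L : List (E × Bool)} (hL : L ≠ []) : wordVal x L ∈ wordSemigroup x := by
  induction L with
  | nil => exact absurd rfl hL
  | cons a L ih =>
    have ha : letterVal x a ∈ wordSemigroup x := by
      obtain ⟨e, _ | _⟩ := a
      · exact star_mem_wordSemigroup e
      · exact mem_wordSemigroup e
    rcases eq_or_ne L [] with rfl | h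
    · rwa [wordVal_singleton]
    · rw [wordVal_cons]; exact mul_mem ha (ih h)

variable {x} in
theorem exists_wordVal_of_mem {u : A} (hu : u ∈ wordSemigroup x) :
    ∃ L, L ≠ [] ∧ wordVal x L = u := by
  induction hu using Subsemigroup.closure_induction with
  | mem u hu =>
    rcases hu with ⟨e, rfl⟩ | ⟨e, rfl⟩
    · exact ⟨[(e, true)], by simp, by simp [wordVal_singleton, letterVal]⟩
    · exact ⟨[(e, false)], by simp, by simp [wordVal_singleton, letterVal]⟩
  | mul u w _ _ hu hw =>
    obtain ⟨L, hL, rfl⟩ := hu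
    obtain ⟨M, hM, rfl⟩ := hw
    exact ⟨L ++ M, by simp [hL], wordVal_append x L M⟩

theorem map_letterVal {F B : Type*} [Ring B] [StarRing B] [FunLike F A B] [StarHomClass F A B]
    (f : F) (a : E × Bool) :
    f (letterVal x a) = letterVal (fun e => f (x e)) a := by
  obtain ⟨e, _ | _⟩ := a <;> simp [letterVal, map_star]

theorem map_wordVal {F B : Type*} [Ring B] [StarRing B] [FunLike F A B] [RingHomClass F A B]
    [StarHomClass F A B] (f : F) (L : List (E × Bool)) :
    f (wordVal x L) = wordVal (fun e => f (x e)) L := by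
  induction L with
  | nil => simp
  | cons a L ih => rw [wordVal_cons, map_mul, ih, map_letterVal, wordVal_cons]

theorem map_wordProj {F B : Type*} [Ring B] [StarRing B] [FunLike F A B] [RingHomClass F A B]
    [StarHomClass F A B] (f : F) (L : List (E × Bool)) :
    f (wordProj x L) = wordProj (fun e => f (x e)) L := by
  rw [wordProj, map_mul, map_star, map_wordVal, wordProj]

theorem star_wordProj (L : List (E × Bool)) : star (wordProj x L) = wordProj x L := by
  simp [wordProj]

theorem TameFamily.map {F B : Type*} [Ring B] [StarRing B] [FunLike F A B] [RingHomClass F A B]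
    [StarHomClass F A B] (f : F) [TameFamily x] : TameFamily fun e => f (x e) where
  partialIsometry e := by
    rw [← map_star, ← map_mul, ← map_mul, TameFamily.partialIsometry]
  commute u hu w hw := by
    obtain ⟨L, hL, rfl⟩ := exists_wordVal_of_mem hu
    obtain ⟨M, hM, rfl⟩ := exists_wordVal_of_mem hw
    simp only [← map_wordVal, ← map_star, ← map_mul]
    exact (TameFamily.commute _ (wordVal_mem x hL) _ (wordVal_mem x hM)).map f

variable [TameFamily x]

theorem wordVal_partialIsometry (L : List (E × Bool)) :
    wordProj x L * wordVal x L = wordVal x L := by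
  rcases eq_or_ne L [] with rfl | h
  · simp
  · exact TameFamily.word_partialIsometry (wordVal_mem x h)

theorem wordProj_commute (L M : List (E × Bool)) : Commute (wordProj x L) (wordProj x M) := by
  rcases eq_or_ne L [] with rfl | hL
  · simp
  rcases eq_or_ne M [] with rfl | hM
  · simp
  exact TameFamily.commute _ (wordVal_mem x hL) _ (wordVal_mem x hM)

theorem wordProj_mul_self (L : List (E × Bool)) : wordProj x L * wordProj x L = wordProj x L := by
  conv_lhs => rw [wordProj.eq_def x L]
  rw [← mul_assoc, ← wordProj, wordVal_partialIsometry]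
  rfl

/-- The word `L L⁻¹ M` has value `p_L x_M`, whose final projection is `p_L p_M p_L = p_L p_M`. So
final projections are closed under products and their linear span is an algebra. -/
theorem wordProj_mul (L M : List (E × Bool)) :
    wordProj x L * wordProj x M = wordProj x (L ++ FreeGroup.invRev L ++ M) := by
  have h : wordVal x (L ++ FreeGroup.invRev L ++ M) = wordProj x L * wordVal x M := by
    rw [wordVal_append, wordVal_append, wordVal_invRev, wordProj]
  have h2 : wordProj x (L ++ FreeGroup.invRev L ++ M) =
      wordProj x L * (wordProj x M * wordProj x L) := by
    rw [wordProj.eq_def x (_ ++ _), h, star_mul, star_wordProj, wordProj.eq_def x M]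
    simp only [mul_assoc]
  rw [h2, ← (wordProj_commute x L M).eq, ← mul_assoc, wordProj_mul_self]

/-- The initial projection `x_L* x_L` is itself the final projection of `L⁻¹`, so it commutes with
`p_M` and can be moved across it. This is the algebraic form of covariance. -/
theorem wordVal_mul_wordProj (L M : List (E × Bool)) :
    wordVal x L * wordProj x M = wordProj x (L ++ M) * wordVal x L := by
  have h := (wordProj_commute x M (FreeGroup.invRev L)).eq
  rw [wordProj.eq_def x (FreeGroup.invRev L), wordVal_invRev, star_star] at h
  calc wordVal x L * wordProj x M = wordProj x L * wordVal x L * wordProj x M := by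
        rw [wordVal_partialIsometry]
    _ = wordVal x L * (star (wordVal x L) * wordVal x L * wordProj x M) := by
        simp only [wordProj, mul_assoc]
    _ = _ := by
        rw [← h, wordProj.eq_def x (L ++ M), wordVal_append, star_mul, wordProj]
        simp only [mul_assoc]

theorem wordProj_mul_append (L M : List (E × Bool)) :
    wordProj x L * wordProj x (L ++ M) = wordProj x (L ++ M) := by
  conv_lhs => rw [wordProj.eq_def x (L ++ M)]
  rw [wordVal_append, ← mul_assoc, ← mul_assoc, wordVal_partialIsometry, ← wordVal_append,
    wordProj]

/-- A cancelling pair contributes the final projection of its first letter; moved to the left end,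
it only cuts down the value of the shorter word. -/
theorem wordVal_step {L M : List (E × Bool)} (h : FreeGroup.Red.Step L M) :
    wordVal x L = wordProj x L * wordVal x M := by
  cases h with
  | @not L₁ L₂ e b =>
    -- With `a` the first letter of the pair, `x_{L₁} p_a x_{L₂} = p_{L₁a} x_{L₁} x_{L₂}`.
    have key : wordVal x (L₁ ++ (e, b) :: (e, !b) :: L₂) =
        wordProj x (L₁ ++ [(e, b)]) * wordVal x (L₁ ++ L₂) := by
      have h := wordVal_mul_wordProj x L₁ [(e, b)]
      rw [wordVal_append x L₁ L₂, ← mul_assoc, ← h, wordVal_append, wordVal_cons, wordVal_cons,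
        letterVal_not, wordProj, wordVal_singleton]
      simp only [mul_assoc]
    set u := wordVal x (L₁ ++ (e, b) :: (e, !b) :: L₂) with hu
    set p := wordProj x (L₁ ++ [(e, b)])
    set w := wordVal x (L₁ ++ L₂) with hw
    have hpw : Commute p (w * star w) := wordProj_commute x _ _
    have hp : star p = p := star_wordProj x _
    have hpp : p * p = p := wordProj_mul_self x _
    have hww : w * star w * w = w := wordVal_partialIsometry x _
    -- The projection of the long word is the product of `p` and that of the short word, so
    -- multiplying the short word by it has the same effect as multiplying by `p`.
    have : wordProj x (L₁ ++ (e, b) :: (e, !b) :: L₂) = p * (w * star w) := by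
      rw [wordProj, ← hu, key, star_mul, hp]
      calc p * w * (star w * p) = p * (w * star w * p) := by simp only [mul_assoc]
        _ = p * (w * star w) := by rw [← hpw.eq, ← mul_assoc, hpp]
    rw [this, mul_assoc, hww, key]

/-- A word is at most its reductions in the natural order of partial isometries. -/
theorem wordVal_red {L M : List (E × Bool)} (h : FreeGroup.Red L M) :
    wordVal x L = wordProj x L * wordVal x M := by
  induction h with
  | refl => rw [wordVal_partialIsometry]
  | @tail M N _ h ih =>
    have h1 := wordVal_step x h
    -- Since `x_L = p_L x_M`, the projection `p_L` lies below `p_M`, and the factor `p_M` produced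
    -- by the last reduction step is absorbed.
    have h2 : wordProj x M * wordProj x L = wordProj x L := by
      conv_lhs => rw [wordProj.eq_def x L, ih]
      rw [← mul_assoc, ← mul_assoc, (wordProj_commute x M L).eq, mul_assoc (wordProj x L),
        wordVal_partialIsometry, ← ih, wordProj]
    conv_lhs => rw [ih, h1, ← mul_assoc, ← (wordProj_commute x M L).eq, h2]

end Words

end

noncomputable section

/-! ### Indicator functions of clopen sets -/

section Indicator
open TopologicalSpace
variable {X : Type*} [TopologicalSpace X] (R : Type*) [CommRing R] [TopologicalSpace R]
  [IsTopologicalRing R]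

open Classical in
/-- The indicator function of a clopen set, as a continuous function. -/
def clopenInd (Z : Clopens X) : C(X, R) where
  toFun x := if x ∈ Z then 1 else 0
  continuous_toFun := by
    refine continuous_if ?_ continuousOn_const continuousOn_const
    intro a ha
    have : frontier {x | x ∈ Z} = ∅ := Z.isClopen.frontier_eq
    rw [this] at ha
    exact absurd ha (Set.notMem_empty _)

variable {R} {Z W : Clopens X}

theorem clopenInd_of_mem {x : X} (h : x ∈ Z) : clopenInd R Z x = 1 := if_pos h

theorem clopenInd_of_notMem {x : X} (h : x ∉ Z) : clopenInd R Z x = 0 := if_neg h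

theorem clopenInd_mul : clopenInd R Z * clopenInd R W = clopenInd R (Z ⊓ W) := by
  ext x
  have h : x ∈ Z ⊓ W ↔ x ∈ Z ∧ x ∈ W := Iff.rfl
  by_cases hx : x ∈ Z <;> by_cases hw : x ∈ W <;>
    simp [clopenInd, h, hx, hw]

theorem clopenInd_top : clopenInd R (⊤ : Clopens X) = 1 := by
  ext x; exact clopenInd_of_mem trivial

theorem clopenInd_bot : clopenInd R (⊥ : Clopens X) = 0 := by
  ext x; exact clopenInd_of_notMem (fun h => h)

theorem clopenInd_compl : clopenInd R Zᶜ = 1 - clopenInd R Z := by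
  ext x
  by_cases hx : x ∈ Z
  · have : x ∉ Zᶜ := fun h => h hx
    simp [clopenInd_of_mem hx, clopenInd_of_notMem this]
  · have : x ∈ Zᶜ := hx
    simp [clopenInd_of_notMem hx, clopenInd_of_mem this]

theorem star_clopenInd [StarRing R] [ContinuousStar R] :
    star (clopenInd R Z) = clopenInd R Z := by
  ext x
  by_cases hx : x ∈ Z <;> simp [clopenInd, hx]

end Indicator

/-! ### The crossed product by a partial action of a free group -/

namespace PartialAction

namespace CrossedProduct
variable {G X : Type*} [Group G] [DecidableEq G] [TopologicalSpace X] (θ : PartialAction G X)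
  (R : Type*) [CommRing R] [TopologicalSpace R] [IsTopologicalRing R] [StarRing R]
  [ContinuousStar R]

/-- The embedding `f ↦ f δ_1` of the algebra of continuous functions. -/
def incl : C(X, R) →⋆ₐ[R] θ.CrossedProduct R where
  toFun f := CrossedProduct.single 1 ⟨f, θ.mem_ideal_zero f⟩
  map_one' := rfl
  map_mul' f g := by
    rw [CrossedProduct.single_mul]
    refine CrossedProduct.single_congr (mul_one 1).symm ?_
    change f * g = θ.pull 1 (θ.pull 1⁻¹ f * g)
    ext x
    rw [θ.mul_apply_of_mem _ _ (by simp [θ.dom_one]), inv_one, θ.one_apply]; rfl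
  map_zero' := (map_zero (DirectSum.of (fun g : Additive G => θ.ideal R g) 0))
  map_add' f g :=
    CrossedProduct.single_add (θ := θ) 1 ⟨f, θ.mem_ideal_zero f⟩ ⟨g, θ.mem_ideal_zero g⟩
  commutes' c := rfl
  map_star' f := by
    rw [CrossedProduct.star_single]
    refine CrossedProduct.single_congr inv_one.symm ?_
    change star f = CrossedProduct.starFn θ 1 f
    ext x
    rw [CrossedProduct.starFn_of_mem _ (by simp [θ.dom_one]), θ.one_apply]; rfl

variable {θ R}

theorem incl_eq (f : C(X, R)) : incl θ R f = single 1 ⟨f, θ.mem_ideal_zero f⟩ := rfl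

theorem incl_mul_single (f : C(X, R)) (g : G) (a : θ.ideal R (Additive.ofMul g)) :
    incl θ R f * single g a =
      single g ⟨f * (a : C(X, R)), fun x hx => by rw [ContinuousMap.mul_apply, a.2 x hx, mul_zero]⟩ := by
  rw [incl_eq, single_mul]
  refine single_congr (one_mul g) ?_
  ext x
  refine (θ.homMul_of_mem (g := 0) (h := Additive.ofMul g) _ _ (by simp [θ.dom_one])).trans ?_
  simp [θ.one_apply]

/-- Both sides vanish off `X_g`, and on `X_g` the two translations of `a` cancel. In this form the
coefficient is a product of continuous functions on the whole space, to which a `*`-homomorphism can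
be applied. -/
theorem homMul_eq {g h : G} (a : θ.ideal R (Additive.ofMul g)) (b : θ.ideal R (Additive.ofMul h)) :
    (θ.homMul a b : C(X, R)) = (a : C(X, R)) * θ.pull g (b : C(X, R)) := by
  ext x
  by_cases hx : x ∈ θ.dom g
  · rw [θ.homMul_of_mem a b hx, ContinuousMap.mul_apply, θ.pull_of_mem _ hx]; rfl
  · rw [θ.homMul_of_notMem a b hx, ContinuousMap.mul_apply, θ.pull_of_notMem _ hx, mul_zero]

end CrossedProduct
end PartialAction

/-! ### Ranges of words, and words as elements of the crossed product -/

section FreeWords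
open TopologicalSpace FreeGroup
variable {X E : Type*} [TopologicalSpace X] {f : E → OpenPartialHomeomorph X X}
  (hs : ∀ e, IsClosed (f e).source) (ht : ∀ e, IsClosed (f e).target)

/-- The range of the partial homeomorphism of a word. -/
def wordClopen (L : List (E × Bool)) : Clopens X where
  carrier := (wordHomeo f (invRev L)).source
  isClopen' := ⟨wordHomeo_isClosed_source hs ht _, (wordHomeo f (invRev L)).open_source⟩

theorem mem_wordClopen {L : List (E × Bool)} {x : X} :
    x ∈ wordClopen hs ht L ↔ x ∈ (wordHomeo f (invRev L)).source := Iff.rfl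

@[simp] theorem wordClopen_nil : wordClopen hs ht [] = ⊤ := by
  ext x; simp [wordClopen, wordHomeo]

theorem mem_wordClopen_append {L M : List (E × Bool)} {x : X} :
    x ∈ wordClopen hs ht (L ++ M) ↔
      x ∈ wordClopen hs ht L ∧ wordHomeo f (invRev L) x ∈ wordClopen hs ht M := by
  rw [mem_wordClopen, invRev_append, mem_source_append]; rfl

variable [DecidableEq E]

theorem dom_ofFree (g : FreeGroup E) :
    (PartialAction.ofFree f hs ht).dom g = wordClopen hs ht g.toWord :=
  (wordHomeo_invRev_source _).symm

theorem homeo_ofFree (g : FreeGroup E) :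
    (PartialAction.ofFree f hs ht).homeo g = wordHomeo f g.toWord := rfl

theorem mem_dom_ofFree (g : FreeGroup E) (x : X) :
    x ∈ (PartialAction.ofFree f hs ht).dom g ↔ x ∈ wordClopen hs ht g.toWord := by
  rw [dom_ofFree]; rfl

theorem homeo_ofFree_inv (g : FreeGroup E) :
    (PartialAction.ofFree f hs ht).homeo g⁻¹ = wordHomeo f (invRev g.toWord) := by
  rw [homeo_ofFree, toWord_inv]

/-- Each cancellation extends the composed partial homeomorphism, so an unreduced word acts as a
restriction of the action of its class. -/
theorem mem_dom_mk {L : List (E × Bool)} {x : X} (hx : x ∈ wordClopen hs ht L) :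
    x ∈ (PartialAction.ofFree f hs ht).dom (mk L) ∧
      (PartialAction.ofFree f hs ht).homeo (mk L)⁻¹ x = wordHomeo f (invRev L) x := by
  have h := wordHomeo_red (f := f) (reduce.red (L := invRev L)) hx
  rw [← toWord_mk, ← inv_mk] at h
  refine ⟨?_, h.2.symm⟩
  have h1 : x ∈ ((PartialAction.ofFree f hs ht).homeo (mk L)⁻¹).source := h.1
  rwa [PartialAction.source_eq, inv_inv] at h1

/-- The action of the class of `L` may be defined on more than the domain of the word `L`; this
domain consists of the points that are sent into the range of `L`. The adjoint of a word in the
crossed product is computed from this. -/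
theorem mem_wordClopen_invRev {L : List (E × Bool)} {x : X} :
    x ∈ wordClopen hs ht (invRev L) ↔
      x ∈ (PartialAction.ofFree f hs ht).dom (mk L)⁻¹ ∧
        (PartialAction.ofFree f hs ht).homeo (mk L) x ∈ wordClopen hs ht L := by
  constructor
  · intro hx
    have h := mem_dom_mk hs ht hx
    rw [← inv_mk, inv_inv] at h
    refine ⟨h.1, ?_⟩
    rw [h.2, invRev_invRev, mem_wordClopen, wordHomeo_invRev_source]
    refine (wordHomeo f L).map_source ?_
    rwa [mem_wordClopen, invRev_invRev] at hx
  · rintro ⟨h1, h2⟩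
    have h := (mem_dom_mk hs ht h2).2
    rw [PartialAction.act_act _ h1 (by rw [inv_inv]; exact PartialAction.map_mem _ h1),
      inv_mul_cancel, PartialAction.one_apply] at h
    rw [h, mem_wordClopen, wordHomeo_invRev_source]
    exact (wordHomeo f (invRev L)).map_source h2

section Coeff
variable (R : Type*) [CommRing R] [TopologicalSpace R] [IsTopologicalRing R]

theorem pull_one_ofFree (g : FreeGroup E) :
    (PartialAction.ofFree f hs ht).pull g (1 : C(X, R)) =
      clopenInd R (wordClopen hs ht g.toWord) := by
  ext x
  by_cases hx : x ∈ wordClopen hs ht g.toWord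
  · rw [clopenInd_of_mem hx, PartialAction.pull_of_mem _ _ ((mem_dom_ofFree hs ht g x).2 hx)]; rfl
  · rw [clopenInd_of_notMem hx,
      PartialAction.pull_of_notMem _ _ fun h => hx ((mem_dom_ofFree hs ht g x).1 h)]

/-- The range of the concatenated word is the translate by `g` of the part of `X_L` on which `g` is
defined. Compare `wordVal_mul_wordProj`. -/
theorem pull_clopenInd (g : FreeGroup E) (L : List (E × Bool)) :
    (PartialAction.ofFree f hs ht).pull g (clopenInd R (wordClopen hs ht L)) =
      clopenInd R (wordClopen hs ht (g.toWord ++ L)) := by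
  ext x
  by_cases hx : x ∈ wordClopen hs ht g.toWord
  · rw [PartialAction.pull_of_mem _ _ ((mem_dom_ofFree hs ht g x).2 hx), homeo_ofFree_inv]
    have := mem_wordClopen_append hs ht (L := g.toWord) (M := L) (x := x)
    by_cases hy : wordHomeo f (invRev g.toWord) x ∈ wordClopen hs ht L
    · rw [clopenInd_of_mem hy, clopenInd_of_mem (this.2 ⟨hx, hy⟩)]
    · rw [clopenInd_of_notMem hy, clopenInd_of_notMem fun h => hy (this.1 h).2]
  · rw [PartialAction.pull_of_notMem _ _ fun h => hx ((mem_dom_ofFree hs ht g x).1 h),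
      clopenInd_of_notMem fun h => hx ((mem_wordClopen_append hs ht).1 h).1]

theorem clopenInd_mem_ideal (L : List (E × Bool)) :
    clopenInd R (wordClopen hs ht L) ∈
      (PartialAction.ofFree f hs ht).ideal R (Additive.ofMul (mk L)) :=
  fun _ hx => clopenInd_of_notMem fun h => hx (mem_dom_mk hs ht h).1

/-- The element `1_{X_L} δ_{[L]}` of the crossed product, for a word `L`. -/
def wordDelta (L : List (E × Bool)) : (PartialAction.ofFree f hs ht).CrossedProduct R :=
  .single (mk L) ⟨clopenInd R (wordClopen hs ht L), clopenInd_mem_ideal hs ht R L⟩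

variable {R}

/-- No reduction takes place: the group element forgets the cancelled letters, but the support of
the coefficient remembers them. -/
theorem wordDelta_mul (L M : List (E × Bool)) :
    wordDelta hs ht R L * wordDelta hs ht R M = wordDelta hs ht R (L ++ M) := by
  rw [wordDelta, wordDelta, PartialAction.CrossedProduct.single_mul]
  refine PartialAction.CrossedProduct.single_congr mul_mk ?_
  ext x
  have h := mem_wordClopen_append hs ht (L := L) (M := M) (x := x)
  by_cases hx : x ∈ wordClopen hs ht L
  · obtain ⟨h1, h2⟩ := mem_dom_mk hs ht hx
    refine (PartialAction.homMul_of_mem _ _ _ h1).trans ?_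
    refine (congrArg (_ * clopenInd R (wordClopen hs ht M) ·) h2).trans ?_
    by_cases hy : wordHomeo f (invRev L) x ∈ wordClopen hs ht M
    · simp only [clopenInd_of_mem hx, clopenInd_of_mem hy, clopenInd_of_mem (h.2 ⟨hx, hy⟩), one_mul]
    · simp only [clopenInd_of_notMem hy, clopenInd_of_notMem fun h' => hy (h.1 h').2, mul_zero]
  · rw [clopenInd_of_notMem fun h' => hx (h.1 h').1]
    by_cases h1 : x ∈ (PartialAction.ofFree f hs ht).dom (mk L)
    · refine (PartialAction.homMul_of_mem _ _ _ h1).trans ?_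
      simp only [clopenInd_of_notMem hx, zero_mul]
    · exact PartialAction.homMul_of_notMem _ _ _ h1

/-- Applied to words such as `L L⁻¹`, this turns final projections into functions. -/
theorem wordDelta_eq_incl [StarRing R] [ContinuousStar R] {L : List (E × Bool)} (h : mk L = 1) :
    wordDelta hs ht R L =
      PartialAction.CrossedProduct.incl _ R (clopenInd R (wordClopen hs ht L)) :=
  PartialAction.CrossedProduct.single_congr h rfl

theorem star_wordDelta [StarRing R] [ContinuousStar R] (L : List (E × Bool)) :
    star (wordDelta hs ht R L) = wordDelta hs ht R (invRev L) := by
  rw [wordDelta, wordDelta, PartialAction.CrossedProduct.star_single]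
  refine PartialAction.CrossedProduct.single_congr inv_mk ?_
  change PartialAction.CrossedProduct.starFn _ (mk L) _ = _
  ext x
  have h := mem_wordClopen_invRev hs ht (L := L) (x := x)
  by_cases hx : x ∈ (PartialAction.ofFree f hs ht).dom (mk L)⁻¹
  · rw [PartialAction.CrossedProduct.starFn_of_mem _ hx]
    by_cases hy : (PartialAction.ofFree f hs ht).homeo (mk L) x ∈ wordClopen hs ht L
    · simp only [clopenInd_of_mem hy, clopenInd_of_mem (h.2 ⟨hx, hy⟩), star_one]
    · simp only [clopenInd_of_notMem hy, clopenInd_of_notMem fun h' => hy (h.1 h').2, star_zero]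
  · rw [PartialAction.CrossedProduct.starFn_of_notMem _ hx,
      clopenInd_of_notMem fun h' => hx (h.1 h').1]

theorem delta_of_eq (e : E) :
    PartialAction.CrossedProduct.delta (θ := PartialAction.ofFree f hs ht) (R := R)
      (FreeGroup.of e) = wordDelta hs ht R [(e, true)] :=
  PartialAction.CrossedProduct.single_congr rfl (by
    refine (pull_one_ofFree hs ht R (FreeGroup.of e)).trans ?_
    rw [toWord_of])

/-- The coefficient already vanishes off `X_g`, so multiplying it by the indicator function changes
nothing. Thus the crossed product is spanned by products of functions and words. -/
theorem single_eq_incl_mul [StarRing R] [ContinuousStar R] (g : FreeGroup E)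
    (a : (PartialAction.ofFree f hs ht).ideal R (Additive.ofMul g)) :
    PartialAction.CrossedProduct.single g a =
      PartialAction.CrossedProduct.incl _ R (a : C(X, R)) * wordDelta hs ht R g.toWord := by
  rw [wordDelta, PartialAction.CrossedProduct.incl_mul_single]
  refine PartialAction.CrossedProduct.single_congr mk_toWord.symm ?_
  ext x
  by_cases hx : x ∈ (PartialAction.ofFree f hs ht).dom g
  · simp only [ContinuousMap.mul_apply, clopenInd_of_mem ((mem_dom_ofFree hs ht g x).1 hx), mul_one]
  · simp only [ContinuousMap.mul_apply, a.2 x hx, zero_mul]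

theorem wordDelta_eq_wordVal [StarRing R] [ContinuousStar R] (L : List (E × Bool)) :
    wordVal (fun e => wordDelta hs ht R [(e, true)]) L = wordDelta hs ht R L := by
  induction L with
  | nil =>
    rw [wordDelta_eq_incl hs ht rfl, wordClopen_nil, clopenInd_top, _root_.map_one, wordVal_nil]
  | cons a L ih =>
    have : letterVal (fun e => wordDelta hs ht R [(e, true)]) a = wordDelta hs ht R [a] := by
      obtain ⟨e, _ | _⟩ := a
      · exact star_wordDelta hs ht [(e, true)]
      · rfl
    rw [wordVal_cons, ih, this, wordDelta_mul]; rfl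

end Coeff
end FreeWords

end

noncomputable section

/-! ### Covariant representations -/

section Covariant
open TopologicalSpace
variable {X E : Type*} [TopologicalSpace X] {f : E → OpenPartialHomeomorph X X}
  (hs : ∀ e, IsClosed (f e).source) (ht : ∀ e, IsClosed (f e).target) [DecidableEq E]
  {R : Type*} [CommRing R] [TopologicalSpace R] [IsTopologicalRing R] [StarRing R]
  [ContinuousStar R]
  {A : Type*} [Ring A] [StarRing A] [Algebra R A] (y : E → A) (π : C(X, R) →⋆ₐ[R] A)

/-- The additive map `f δ_g ↦ π(f) u_g` on the crossed product. -/
def covariantAddHom : (PartialAction.ofFree f hs ht).CrossedProduct R →+ A :=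
  DirectSum.toAddMonoid fun g =>
    ((AddMonoidHom.mulRight (wordVal y g.toMul.toWord)).comp π.toRingHom.toAddMonoidHom).comp
      ((PartialAction.ofFree f hs ht).ideal R g).subtype.toAddMonoidHom

theorem covariantAddHom_single (g : FreeGroup E)
    (a : (PartialAction.ofFree f hs ht).ideal R (Additive.ofMul g)) :
    covariantAddHom hs ht y π (.single g a) = π (a : C(X, R)) * wordVal y g.toWord :=
  DirectSum.toAddMonoid_of _ _ _

-- A covariant pair: `hπ` ties the functions to the final projections of the family, and `hcov` lets
-- the words implement the partial action.
variable [TameFamily y]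
  (hπ : ∀ L, π (clopenInd R (wordClopen hs ht L)) = wordProj y L)
  (hcov : ∀ (g : FreeGroup E) (h : C(X, R)), wordVal y g.toWord * π h =
    π ((PartialAction.ofFree f hs ht).pull g h) * wordVal y g.toWord)

-- The reduced word of `gk` and the concatenation of the words of `g` and `k` have values that
-- differ by the projection of the concatenation. The coefficient of the product is supported on the
-- corresponding range, so π of it does not see the difference; the rest is covariance.
include hπ hcov in
theorem covariantAddHom_mul (a b : (PartialAction.ofFree f hs ht).CrossedProduct R) :
    covariantAddHom hs ht y π (a * b) =
      covariantAddHom hs ht y π a * covariantAddHom hs ht y π b := by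
  induction a using PartialAction.CrossedProduct.induction with
  | h0 => simp only [zero_mul, map_zero]
  | hadd a a' h h' => simp only [add_mul, map_add, h, h']
  | hs g a =>
    induction b using PartialAction.CrossedProduct.induction with
    | h0 => simp only [mul_zero, map_zero]
    | hadd a a' h h' => simp only [mul_add, map_add, h, h']
    | hs k b =>
      rw [PartialAction.CrossedProduct.single_mul, covariantAddHom_single,
        covariantAddHom_single, covariantAddHom_single]
      -- The product coefficient is nonzero only at points of `X_g` that `g⁻¹` moves into `X_k`,
      -- which is the range of the concatenated word.
      have h1 : ((PartialAction.ofFree f hs ht).homMul a b : C(X, R)) *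
          clopenInd R (wordClopen hs ht (g.toWord ++ k.toWord)) =
            (PartialAction.ofFree f hs ht).homMul a b := by
        ext x
        by_cases hx : x ∈ wordClopen hs ht (g.toWord ++ k.toWord)
        · simp only [ContinuousMap.mul_apply, clopenInd_of_mem hx, mul_one]
        · rw [ContinuousMap.mul_apply, clopenInd_of_notMem hx, mul_zero]
          by_cases hg : x ∈ (PartialAction.ofFree f hs ht).dom g
          · refine ((PartialAction.homMul_of_mem _ a b hg).trans ?_).symm
            rw [b.2, mul_zero]
            intro hk
            refine hx ((mem_wordClopen_append hs ht).2 ⟨(mem_dom_ofFree hs ht g x).1 hg, ?_⟩)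
            have := (mem_dom_ofFree hs ht k _).1 hk
            rwa [toMul_ofMul, homeo_ofFree_inv] at this
          · exact (PartialAction.homMul_of_notMem _ a b hg).symm
      have h2 := wordVal_red y (FreeGroup.reduce.red (L := g.toWord ++ k.toWord))
      rw [← FreeGroup.toWord_mul, wordVal_append] at h2
      calc π ((PartialAction.ofFree f hs ht).homMul a b : C(X, R)) * wordVal y (g * k).toWord
          = π ((PartialAction.ofFree f hs ht).homMul a b : C(X, R)) *
            (wordVal y g.toWord * wordVal y k.toWord) := by
              rw [h2, ← hπ, ← mul_assoc, ← map_mul, h1]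
        _ = π (a : C(X, R)) * wordVal y g.toWord * (π (b : C(X, R)) * wordVal y k.toWord) := by
              rw [PartialAction.CrossedProduct.homMul_eq, map_mul, mul_assoc (π _), mul_assoc (π _),
                ← mul_assoc (wordVal y _), hcov]
              simp only [mul_assoc]

/-- The `*`-homomorphism of the crossed product given by a covariant representation. -/
def covariantHom : (PartialAction.ofFree f hs ht).CrossedProduct R →⋆ₐ[R] A where
  toFun := covariantAddHom hs ht y π
  map_zero' := map_zero _
  map_add' := map_add _
  map_mul' := covariantAddHom_mul hs ht y π hπ hcov
  map_one' := by
    refine (covariantAddHom_single hs ht y π 1 ⟨1, PartialAction.mem_ideal_zero _ _⟩).trans ?_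
    simp
  commutes' c := by
    refine (covariantAddHom_single hs ht y π 1
      ⟨algebraMap R C(X, R) c, PartialAction.mem_ideal_zero _ _⟩).trans ?_
    simp [AlgHomClass.commutes]
  map_star' a := by
    induction a using PartialAction.CrossedProduct.induction with
    | h0 => simp only [star_zero, map_zero]
    | hadd a a' h h' => simp only [star_add, map_add, h, h']
    | hs g a =>
      -- Covariance for `g⁻¹`: the adjoint of `π(a) y_g` is `y_{g⁻¹} π(a*) = π(α_{g⁻¹}(a*))
      -- y_{g⁻¹}`.
      rw [PartialAction.CrossedProduct.star_single, covariantAddHom_single,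
        covariantAddHom_single, star_mul, ← wordVal_invRev, ← FreeGroup.toWord_inv, ← map_star,
        hcov]
      rfl

theorem covariantHom_single (g : FreeGroup E)
    (a : (PartialAction.ofFree f hs ht).ideal R (Additive.ofMul g)) :
    covariantHom hs ht y π hπ hcov (.single g a) = π (a : C(X, R)) * wordVal y g.toWord :=
  covariantAddHom_single hs ht y π g a

theorem covariantHom_wordDelta (e : E) :
    covariantHom hs ht y π hπ hcov (wordDelta hs ht R [(e, true)]) = y e := by
  refine (covariantHom_single hs ht y π hπ hcov (FreeGroup.of e) _).trans ?_
  rw [FreeGroup.toWord_of, hπ, wordVal_partialIsometry, wordVal_singleton]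
  rfl

end Covariant

/-! ### Density of the indicator functions of the ranges of words -/

section Span
open TopologicalSpace
variable {X : Type*} [TopologicalSpace X]

/-- A Boolean algebra of clopen sets that separates the points of a compact space contains every
clopen set, by two successive compactness arguments. -/
theorem clopens_induction [CompactSpace X] {P : Clopens X → Prop} (hbot : P ⊥)
    (hcompl : ∀ Z, P Z → P Zᶜ) (hinf : ∀ Z W, P Z → P W → P (Z ⊓ W))
    (hsep : ∀ a b : X, a ≠ b → ∃ Z, P Z ∧ a ∈ Z ∧ b ∉ Z) (Z : Clopens X) : P Z := by
  have hsup (Z W) (hZ : P Z) (hW : P W) : P (Z ⊔ W) := by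
    simpa using hcompl _ (hinf _ _ (hcompl _ hZ) (hcompl _ hW))
  -- Finitely many members of the algebra that avoid `a` cover the compact complement of `Z`; the
  -- complement of their union is a neighbourhood of `a` inside `Z`.
  have h1 (a : X) (ha : a ∈ Z) : ∃ W, P W ∧ a ∈ W ∧ W ≤ Z := by
    have : ∃ W, P W ∧ a ∉ W ∧ (((Zᶜ : Clopens X) : Set X)) ⊆ W := by
      refine IsCompact.induction_on (p := fun s => ∃ W : Clopens X, P W ∧ a ∉ W ∧ s ⊆ W)
        (Zᶜ).isClopen.isClosed.isCompact ?_ ?_ ?_ ?_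
      · exact ⟨⊥, hbot, fun h => h, Set.empty_subset _⟩
      · rintro s t hst ⟨W, h1, h2, h3⟩
        exact ⟨W, h1, h2, hst.trans h3⟩
      · rintro s t ⟨W, h1, h2, h3⟩ ⟨W', h1', h2', h3'⟩
        refine ⟨W ⊔ W', hsup _ _ h1 h1', ?_, ?_⟩
        · rintro (h | h)
          · exact h2 h
          · exact h2' h
        · exact Set.union_subset_union h3 h3'
      · intro b hb
        obtain ⟨W, h1, h2, h3⟩ := hsep b a (by rintro rfl; exact hb ha)
        exact ⟨W, mem_nhdsWithin_of_mem_nhds (W.isClopen.isOpen.mem_nhds h2), W, h1, h3, subset_rfl⟩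
    obtain ⟨W, h1, h2, h3⟩ := this
    refine ⟨Wᶜ, hcompl _ h1, h2, fun b hb => ?_⟩
    by_contra hbZ
    exact hb (h3 hbZ)
  -- Finitely many of these neighbourhoods cover `Z`, and their union is `Z`.
  have : ∃ W, P W ∧ ((Z : Clopens X) : Set X) ⊆ W ∧ W ≤ Z := by
    refine IsCompact.induction_on (p := fun s => ∃ W : Clopens X, P W ∧ s ⊆ W ∧ W ≤ Z)
      Z.isClopen.isClosed.isCompact ?_ ?_ ?_ ?_
    · exact ⟨⊥, hbot, Set.empty_subset _, bot_le⟩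
    · rintro s t hst ⟨W, h1, h2, h3⟩
      exact ⟨W, h1, hst.trans h2, h3⟩
    · rintro s t ⟨W, h1, h2, h3⟩ ⟨W', h1', h2', h3'⟩
      exact ⟨W ⊔ W', hsup _ _ h1 h1', Set.union_subset_union h2 h2', sup_le h3 h3'⟩
    · intro a ha
      obtain ⟨W, h1, h2, h3⟩ := h1 a ha
      exact ⟨W, mem_nhdsWithin_of_mem_nhds (W.isClopen.isOpen.mem_nhds h2), W, h1, subset_rfl, h3⟩
  obtain ⟨W, h1, h2, h3⟩ := this
  exact le_antisymm h3 h2 ▸ h1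

/-- On a compact space the indicator functions of clopen sets span the continuous functions to a
discrete ring. -/
theorem mem_span_of_discrete [CompactSpace X] {R : Type*} [CommRing R] [TopologicalSpace R]
    [IsTopologicalRing R] [DiscreteTopology R] (M : Submodule R C(X, R))
    (hM : ∀ Z : Clopens X, clopenInd R Z ∈ M) (f : C(X, R)) : f ∈ M := by
  -- A compact subset of a discrete space is finite, so `f` is the finite sum of its values times
  -- the indicator functions of its level sets.
  have hfin : (Set.range f).Finite := (isCompact_range f.continuous).finite_of_discrete
  let Z (c : R) : Clopens X := ⟨f ⁻¹' {c}, (isClopen_discrete {c}).preimage f.continuous⟩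
  have hf : f = ∑ c ∈ hfin.toFinset, c • clopenInd R (Z c) := by
    ext x
    rw [ContinuousMap.sum_apply, Finset.sum_eq_single (f x)]
    · rw [ContinuousMap.smul_apply, clopenInd_of_mem (show x ∈ Z (f x) from rfl)]
      simp
    · intro c _ hc
      rw [ContinuousMap.smul_apply, clopenInd_of_notMem (fun h : x ∈ Z c => hc (Eq.symm h)),
        smul_zero]
    · intro h
      simp at h
  rw [hf]
  exact Submodule.sum_mem _ fun c _ => Submodule.smul_mem _ _ (hM _)

end Span

/-! ### The spectrum of a tame family -/

namespace FinalSpectrum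
open TopologicalSpace
variable {A E : Type*} [Ring A] [StarRing A] [Algebra ℂ A] (x : E → A)

theorem wordProj_mem (L : List (E × Bool)) : wordProj x L ∈ finalAlgebra x := by
  rcases eq_or_ne L [] with rfl | h
  · rw [wordProj_nil]; exact one_mem _
  · exact final_mem (wordVal_mem x h)

/-- The final projection of a word. -/
def finalWord (L : List (E × Bool)) : finalAlgebra x := ⟨wordProj x L, wordProj_mem x L⟩

variable [TameFamily x]

theorem isClosed_edgeHomeo_source (e : E) : IsClosed (edgeHomeo x e).source :=
  (isClopen_initial _).isClosed

theorem isClosed_edgeHomeo_target (e : E) : IsClosed (edgeHomeo x e).target :=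
  (isClopen_final _).isClosed

/-- The range of a word in the spectrum of a tame family. -/
abbrev wordRange (L : List (E × Bool)) : Clopens (FinalSpectrum x) :=
  wordClopen (isClosed_edgeHomeo_source x) (isClosed_edgeHomeo_target x) L

theorem finalWord_mul_append (L M : List (E × Bool)) :
    finalWord x L * finalWord x (L ++ M) = finalWord x (L ++ M) :=
  Subtype.ext (wordProj_mul_append x L M)

theorem mem_source_letter (a : E × Bool) (χ : FinalSpectrum x) :
    χ ∈ (wordHomeo (edgeHomeo x) (FreeGroup.invRev [a])).source ↔
      χ.eval (finalWord x [a]) = 1 := by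
  obtain ⟨e, _ | _⟩ := a
  · have : finalWord x [(e, false)] = initial (mem_wordSemigroup e) :=
      Subtype.ext (by simp [finalWord, wordProj, wordVal_singleton, letterVal, initial])
    rw [this]
    simp [FreeGroup.invRev, wordHomeo, letterHomeo, edgeHomeo]
  · have : finalWord x [(e, true)] = final (mem_wordSemigroup e) :=
      Subtype.ext (by simp [finalWord, wordProj, wordVal_singleton, letterVal, final])
    rw [this]
    simp [FreeGroup.invRev, wordHomeo, letterHomeo, edgeHomeo]

/-- Moving a character back by a letter composes it with `b ↦ x_a b x_a*`, which carries `p_L` to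
`p_{aL}`. -/
theorem eval_letter (a : E × Bool) (L : List (E × Bool)) {χ : FinalSpectrum x}
    (h : χ.eval (finalWord x [a]) = 1) :
    (wordHomeo (edgeHomeo x) (FreeGroup.invRev [a]) χ).eval (finalWord x L) =
      χ.eval (finalWord x (a :: L)) := by
  obtain ⟨e, _ | _⟩ := a
  · have h1 : finalWord x [(e, false)] = initial (mem_wordSemigroup e) :=
      Subtype.ext (by simp [finalWord, wordProj, wordVal_singleton, letterVal, initial])
    rw [h1] at h
    change (moveFun _ χ).eval _ = _
    rw [moveFun_eval _ h]
    congr 1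
    exact Subtype.ext (by simp [conj, finalWord, wordProj, wordVal_cons, letterVal, mul_assoc])
  · have h1 : finalWord x [(e, true)] = initial (star_mem_wordSemigroup e) :=
      Subtype.ext (by simp [finalWord, wordProj, wordVal_singleton, letterVal, initial])
    rw [h1] at h
    change (moveFun _ χ).eval _ = _
    rw [moveFun_eval _ h]
    congr 1
    exact Subtype.ext (by simp [conj, finalWord, wordProj, wordVal_cons, letterVal, mul_assoc])

/-- The dictionary between dynamics and algebra: peeling the first letter off a word translates the
character on one side and, by `eval_letter`, shortens the projection on the other. -/
theorem mem_wordRange {L : List (E × Bool)} {χ : FinalSpectrum x} :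
    χ ∈ wordRange x L ↔ χ.eval (finalWord x L) = 1 := by
  induction L generalizing χ with
  | nil =>
    have : finalWord x [] = 1 := Subtype.ext (wordProj_nil x)
    rw [wordRange, wordClopen_nil, this, map_one]
    exact ⟨fun _ => rfl, fun _ => trivial⟩
  | cons a L ih =>
    rw [wordRange, ← List.singleton_append, mem_wordClopen_append, ih, mem_wordClopen,
      mem_source_letter]
    constructor
    · rintro ⟨h1, h2⟩
      rwa [eval_letter x a L h1] at h2
    · intro h
      -- Because `p_{aL} ≤ p_a`, a character that is 1 on the first is 1 on the second.
      have h1 : χ.eval (finalWord x [a]) = 1 := by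
        have := congrArg χ.eval (finalWord_mul_append x [a] L)
        rwa [map_mul, h, mul_one] at this
      exact ⟨h1, by rwa [eval_letter x a L h1]⟩

theorem wordRange_inf (L M : List (E × Bool)) :
    wordRange x L ⊓ wordRange x M = wordRange x (L ++ FreeGroup.invRev L ++ M) := by
  have h : finalWord x L * finalWord x M = finalWord x (L ++ FreeGroup.invRev L ++ M) :=
    Subtype.ext (wordProj_mul x L M)
  have h0 : finalWord x L * finalWord x L = finalWord x L :=
    Subtype.ext (wordProj_mul_self x L)
  ext χ
  refine Iff.trans ?_ (mem_wordRange x).symm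
  rw [← h, map_mul]
  refine (and_congr (mem_wordRange x) (mem_wordRange x)).trans ⟨fun h => by rw [h.1, h.2, one_mul],
    fun h' => ?_⟩
  have h1 : χ.eval (finalWord x L) = 1 := by
    have := congrArg (χ.eval (finalWord x L) * ·) h'
    rwa [← mul_assoc, ← map_mul, h0, h', mul_one, eq_comm] at this
  exact ⟨h1, by rwa [h1, one_mul] at h'⟩

theorem eval_finalWord (L : List (E × Bool)) (χ : FinalSpectrum x) :
    χ.eval (finalWord x L) = clopenInd ℂ (wordRange x L) χ := by
  by_cases h : χ ∈ wordRange x L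
  · rw [clopenInd_of_mem h]; exact (mem_wordRange x).1 h
  · rw [clopenInd_of_notMem h]
    have h0 := congrArg χ.eval (show finalWord x L * finalWord x L = finalWord x L from
      Subtype.ext (wordProj_mul_self x L))
    rw [map_mul] at h0
    by_contra hne
    exact h ((mem_wordRange x).2 (mul_right_cancel₀ hne (h0.trans (one_mul _).symm)))

variable {x} in
theorem ext_finalWord {χ ψ : FinalSpectrum x}
    (h : ∀ L, χ.eval (finalWord x L) = ψ.eval (finalWord x L)) : χ = ψ := by
  refine ext fun ⟨b, hb⟩ => ?_
  induction hb using Algebra.adjoin_induction with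
  | mem b hb =>
    obtain ⟨u, hu, rfl⟩ := hb
    obtain ⟨L, -, rfl⟩ := exists_wordVal_of_mem hu
    exact h L
  | algebraMap c => exact (χ.eval.commutes c).trans (ψ.eval.commutes c).symm
  | add a b ha hb ha' hb' =>
    exact (map_add χ.eval ⟨a, ha⟩ ⟨b, hb⟩).trans
      ((congrArg₂ _ ha' hb').trans (map_add ψ.eval ⟨a, ha⟩ ⟨b, hb⟩).symm)
  | mul a b ha hb ha' hb' =>
    exact (map_mul χ.eval ⟨a, ha⟩ ⟨b, hb⟩).trans
      ((congrArg₂ _ ha' hb').trans (map_mul ψ.eval ⟨a, ha⟩ ⟨b, hb⟩).symm)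

variable {x} in
theorem exists_wordRange_of_ne {χ ψ : FinalSpectrum x} (h : χ ≠ ψ) :
    ∃ L, ¬(χ ∈ wordRange x L ↔ ψ ∈ wordRange x L) := by
  by_contra! hc
  refine h (ext_finalWord fun L => ?_)
  rw [eval_finalWord, eval_finalWord]
  by_cases h1 : χ ∈ wordRange x L
  · rw [clopenInd_of_mem h1, clopenInd_of_mem ((hc L).1 h1)]
  · rw [clopenInd_of_notMem h1, clopenInd_of_notMem fun h2 => h1 ((hc L).2 h2)]

section
variable (R : Type*) [CommRing R] [TopologicalSpace R] [IsTopologicalRing R]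

/-- The span of the indicator functions of the ranges of words, as a subalgebra. -/
def wordSubalgebra : Subalgebra R C(FinalSpectrum x, R) :=
  (Submodule.span R (Set.range fun L => clopenInd R (wordRange x L))).toSubalgebra
    (Submodule.subset_span ⟨[], by
      change clopenInd R (wordRange x []) = 1
      rw [wordRange, wordClopen_nil, clopenInd_top]⟩)
    (fun a b ha hb => by
      induction ha, hb using Submodule.span_induction₂ with
      | mem_mem a b ha hb =>
        obtain ⟨L, rfl⟩ := ha
        obtain ⟨M, rfl⟩ := hb
        simp only [clopenInd_mul, wordRange_inf]
        exact Submodule.subset_span ⟨_, rfl⟩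
      | zero_left b hb => rw [zero_mul]; exact Submodule.zero_mem _
      | zero_right b hb => rw [mul_zero]; exact Submodule.zero_mem _
      | add_left a b c _ _ _ h1 h2 => rw [add_mul]; exact Submodule.add_mem _ h1 h2
      | add_right a b c _ _ _ h1 h2 => rw [mul_add]; exact Submodule.add_mem _ h1 h2
      | smul_left r a b _ _ h => rw [smul_mul_assoc]; exact Submodule.smul_mem _ _ h
      | smul_right r a b _ _ h => rw [mul_smul_comm]; exact Submodule.smul_mem _ _ h)

variable {R} in
theorem mem_wordSubalgebra {a : C(FinalSpectrum x, R)} : a ∈ wordSubalgebra x R ↔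
    a ∈ Submodule.span R (Set.range fun L => clopenInd R (wordRange x L)) := Iff.rfl

/-- The span is an algebra, so the clopen sets with indicator function in it form a Boolean algebra.
It separates characters, since these are determined by their values on final projections, and so it
contains every clopen set. -/
theorem span_clopenInd_eq_top [DiscreteTopology R] :
    Submodule.span R (Set.range fun L => clopenInd R (wordRange x L)) = ⊤ := by
  refine eq_top_iff.2 fun f _ => mem_span_of_discrete _ (fun Z => ?_) f
  rw [← mem_wordSubalgebra]
  refine clopens_induction (P := fun Z => clopenInd R Z ∈ wordSubalgebra x R) ?_ ?_ ?_ ?_ Z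
  · rw [clopenInd_bot]; exact zero_mem _
  · intro Z hZ
    rw [clopenInd_compl]; exact sub_mem (one_mem _) hZ
  · intro Z W hZ hW
    rw [← clopenInd_mul]; exact mul_mem hZ hW
  · intro χ ψ h
    obtain ⟨L, hL⟩ := exists_wordRange_of_ne h
    have hmem : clopenInd R (wordRange x L) ∈ wordSubalgebra x R :=
      Submodule.subset_span ⟨L, rfl⟩
    by_cases h1 : χ ∈ wordRange x L
    · exact ⟨_, hmem, h1, fun h2 => hL ⟨fun _ => h2, fun _ => h1⟩⟩
    · refine ⟨(wordRange x L)ᶜ, ?_, h1, fun h2 => hL ⟨fun h => absurd h h1, fun h => absurd h h2⟩⟩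
      rw [clopenInd_compl]; exact sub_mem (one_mem _) hmem
end

/-- Stone–Weierstrass: the span is a `*`-subalgebra, and word ranges separate characters. -/
theorem dense_span_clopenInd :
    Dense (Submodule.span ℂ (Set.range fun L => clopenInd ℂ (wordRange x L)) :
      Set C(FinalSpectrum x, ℂ)) := by
  let S : StarSubalgebra ℂ C(FinalSpectrum x, ℂ) :=
    { wordSubalgebra x ℂ with
      star_mem' := by
        intro a ha
        change a ∈ Submodule.span ℂ _ at ha
        change star a ∈ Submodule.span ℂ _
        induction ha using Submodule.span_induction with
        | mem a ha =>
          obtain ⟨L, rfl⟩ := ha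
          simp only [star_clopenInd]
          exact Submodule.subset_span ⟨L, rfl⟩
        | zero => rw [star_zero]; exact Submodule.zero_mem _
        | add a b _ _ ha hb => rw [star_add]; exact Submodule.add_mem _ ha hb
        | smul c a _ ha => rw [star_smul]; exact Submodule.smul_mem _ _ ha }
  have h := ContinuousMap.starSubalgebra_topologicalClosure_eq_top_of_separatesPoints S (by
    intro χ ψ hne
    obtain ⟨L, hL⟩ := exists_wordRange_of_ne hne
    refine ⟨_, ⟨clopenInd ℂ (wordRange x L), Submodule.subset_span ⟨L, rfl⟩, rfl⟩, fun h => hL ?_⟩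
    rw [mem_wordRange, mem_wordRange, eval_finalWord, eval_finalWord]
    exact Eq.congr_left h)
  intro a
  have h2 : a ∈ (S.topologicalClosure : Set C(FinalSpectrum x, ℂ)) := by rw [h]; trivial
  rwa [StarSubalgebra.topologicalClosure_coe] at h2

end FinalSpectrum

end

noncomputable section

/-- Idempotents of a field are 0 or 1, and orthogonality allows at most one 1, so the sum is again 0
or 1 whatever the characteristic. This carries decompositions of projections from values in one
field to indicators with values in another ring. -/
theorem sum_ite_eq_one {ι F : Type*} (R : Type*) [Field F] [Ring R] [DecidableEq F] (s : Finset ι)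
    (z : ι → F) (hz : ∀ i ∈ s, z i * z i = z i)
    (horth : ∀ i ∈ s, ∀ j ∈ s, i ≠ j → z i * z j = 0) :
    ∑ i ∈ s, (if z i = 1 then (1 : R) else 0) = if ∑ i ∈ s, z i = 1 then 1 else 0 := by
  by_cases h : ∃ i ∈ s, z i = 1
  · obtain ⟨i, hi, h1⟩ := h
    have h0 : ∀ j ∈ s, j ≠ i → z j = 0 := fun j hj hne => by
      have := horth j hj i hi hne
      rwa [h1, mul_one] at this
    rw [Finset.sum_eq_single i (fun j hj hne => by simp [h0 j hj hne]) (fun h => absurd hi h),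
      Finset.sum_eq_single i h0 (fun h => absurd hi h)]
  · push Not at h
    have h0 : ∀ j ∈ s, z j = 0 := fun j hj => by
      by_contra hne
      exact h j hj (mul_right_cancel₀ hne ((hz j hj).trans (one_mul _).symm))
    rw [Finset.sum_eq_zero fun j hj => by simp [h0 j hj], Finset.sum_eq_zero h0]
    simp

/-! ### Relations in the Leavitt path algebra -/

namespace LeavittPathAlgebra
variable (K : Type*) [Field K] [StarRing K] {V E : Type*} [Fintype V] (G : SeparatedGraph V E)

theorem star_edge (e : E) : star (edge K G e) = ghost K G e := star_gen _

variable {K G}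

theorem vertex_mul_of_ne {v w : V} (h : v ≠ w) : vertex K G v * vertex K G w = 0 := by
  simpa [vertex, gen] using! mk_rel (SeparatedGraph.LRel.vertex_mul_of_ne (K := K) (G := G) v w h)

variable (K G) in
theorem sum_vertex : ∑ v, vertex K G v = 1 := by
  have h := mk_rel (SeparatedGraph.LRel.sum_vertex (K := K) (G := G))
  rw [map_sum, map_one] at h
  exact h

theorem range_mul_edge (e : E) : vertex K G (G.range e) * edge K G e = edge K G e := by
  simpa [vertex, edge, gen] using! mk_rel (SeparatedGraph.LRel.range_mul_edge (K := K) (G := G) e)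

theorem star_edge_mul_edge_of_ne {v : V} {X : Finset E} (hX : X ∈ G.blocks v) {e f : E}
    (he : e ∈ X) (hf : f ∈ X) (hne : e ≠ f) : star (edge K G e) * edge K G f = 0 := by
  rw [star_edge]
  simpa [ghost, edge, gen] using! mk_rel (SeparatedGraph.LRel.sck1_of_ne (K := K) (G := G) v X hX e f he hf hne)

theorem vertex_eq_sum {v : V} {X : Finset E} (hX : X ∈ G.blocks v) :
    vertex K G v = ∑ e ∈ X, wordProj (edge K G) [(e, true)] := by
  have h := mk_rel (SeparatedGraph.LRel.sck2 (K := K) (G := G) v X hX)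
  rw [map_sum] at h
  refine h.trans (Finset.sum_congr rfl fun e _ => ?_)
  rw [map_mul, wordProj, wordVal_singleton, letterVal, star_edge]
  rfl

theorem vertex_source (e : E) :
    vertex K G (G.source e) = wordProj (edge K G) [(e, false)] := by
  rw [wordProj, wordVal_singleton, letterVal, star_star, star_edge_mul_edge]

variable (K) in
/-- Every vertex is a sum of final projections. -/
theorem exists_vertex_eq_sum (hG : G.IsBipartite) (v : V) :
    ∃ (X : Finset E) (b : Bool), vertex K G v = ∑ e ∈ X, wordProj (edge K G) [(e, b)] := by
  have hv : v ∈ Set.range G.range ∪ Set.range G.source := by rw [hG.union]; trivial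
  -- The range of an edge has a block, over which the vertex is the sum of the `ee*`; the source of
  -- an edge is `e*e`.
  rcases hv with ⟨e, rfl⟩ | ⟨e, rfl⟩
  · obtain ⟨X, hX, -⟩ := (G.range_eq_iff _ e).1 rfl
    exact ⟨X, true, vertex_eq_sum hX⟩
  · exact ⟨{e}, false, by rw [Finset.sum_singleton, vertex_source]⟩

theorem wordProj_mul_of_ne {v : V} {X : Finset E} (hX : X ∈ G.blocks v) {e f : E}
    (he : e ∈ X) (hf : f ∈ X) (hne : e ≠ f) :
    wordProj (edge K G) [(e, true)] * wordProj (edge K G) [(f, true)] = 0 := by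
  simp only [wordProj, wordVal_singleton, letterVal]
  rw [mul_assoc, ← mul_assoc (star _), star_edge_mul_edge_of_ne hX he hf hne]
  simp

theorem algHom_ext {A : Type*} [Ring A] [Algebra K A] {φ ψ : LeavittPathAlgebra K G →ₐ[K] A}
    (hv : ∀ v, φ (vertex K G v) = ψ (vertex K G v)) (he : ∀ e, φ (edge K G e) = ψ (edge K G e))
    (hg : ∀ e, φ (ghost K G e) = ψ (ghost K G e)) : φ = ψ := by
  ext a
  induction a using induction with
  | halg c => rw [AlgHom.commutes, AlgHom.commutes]
  | hgen x =>
    cases x with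
    | vertex v => exact hv v
    | edge e => exact he e
    | ghost e => exact hg e
  | hadd a b ha hb => rw [map_add, map_add, ha, hb]
  | hmul a b ha hb => rw [map_mul, map_mul, ha, hb]

/-- In the bipartite case the Leavitt path algebra is generated by the edges as a `*`-algebra. -/
theorem starAlgHom_ext (hG : G.IsBipartite) {A : Type*} [Ring A] [StarRing A] [Algebra K A]
    {φ ψ : LeavittPathAlgebra K G →⋆ₐ[K] A}
    (he : ∀ e, φ (edge K G e) = ψ (edge K G e)) : φ = ψ := by
  have h : (φ : LeavittPathAlgebra K G →ₐ[K] A) = ψ := by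
    refine algHom_ext (fun v => ?_) he fun e => ?_
    · obtain ⟨X, b, h⟩ := exists_vertex_eq_sum K hG v
      rw [h, map_sum, map_sum]
      refine Finset.sum_congr rfl fun e _ => ?_
      change φ _ = ψ _
      rw [map_wordProj, map_wordProj]
      simp only [he]
    · rw [← star_edge]
      change φ _ = ψ _
      rw [map_star, map_star, he]
  ext a
  exact DFunLike.congr_fun h a

/-- Homomorphisms out of the Leavitt path algebra, by generators and relations. -/
def liftHom {A : Type*} [Ring A] [Algebra K A] (p : V → A) (s t : E → A)
    (hp : ∀ v, p v * p v = p v) (hpq : ∀ v w, v ≠ w → p v * p w = 0) (hsum : ∑ v, p v = 1)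
    (hrs : ∀ e, p (G.range e) * s e = s e) (hss : ∀ e, s e * p (G.source e) = s e)
    (htr : ∀ e, t e * p (G.range e) = t e) (hst : ∀ e, p (G.source e) * t e = t e)
    (hts : ∀ e, t e * s e = p (G.source e))
    (hne : ∀ v, ∀ X ∈ G.blocks v, ∀ e ∈ X, ∀ f ∈ X, e ≠ f → t e * s f = 0)
    (hX : ∀ v, ∀ X ∈ G.blocks v, p v = ∑ e ∈ X, s e * t e) :
    LeavittPathAlgebra K G →ₐ[K] A :=
  RingQuot.liftAlgHom K ⟨FreeAlgebra.lift K fun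
      | .vertex v => p v
      | .edge e => s e
      | .ghost e => t e, by
    intro a b h
    cases h with
    | vertex_mul_self v => simpa using hp v
    | vertex_mul_of_ne v w h => simpa using hpq v w h
    | sum_vertex => simpa using hsum
    | range_mul_edge e => simpa using hrs e
    | edge_mul_source e => simpa using hss e
    | ghost_mul_range e => simpa using htr e
    | source_mul_ghost e => simpa using hst e
    | sck1_self e => simpa using hts e
    | sck1_of_ne v X hX e f he hf h => simpa using hne v X hX e he f hf h
    | sck2 v X h => simpa using hX v X h⟩

section LiftHom
variable {A : Type*} [Ring A] [Algebra K A] {p : V → A} {s t : E → A} (hp hpq hsum hrs hss htr hst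
  hts hne hX)

theorem liftHom_vertex (v : V) :
    liftHom (K := K) (G := G) p s t hp hpq hsum hrs hss htr hst hts hne hX (vertex K G v) = p v := by
  unfold liftHom vertex gen
  erw [RingQuot.liftAlgHom_mkAlgHom_apply]
  simp

theorem liftHom_edge (e : E) :
    liftHom (K := K) (G := G) p s t hp hpq hsum hrs hss htr hst hts hne hX (edge K G e) = s e := by
  unfold liftHom edge gen
  erw [RingQuot.liftAlgHom_mkAlgHom_apply]
  simp

theorem liftHom_ghost (e : E) :
    liftHom (K := K) (G := G) p s t hp hpq hsum hrs hss htr hst hts hne hX (ghost K G e) = t e := by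
  unfold liftHom ghost gen
  erw [RingQuot.liftAlgHom_mkAlgHom_apply]
  simp
end LiftHom

end LeavittPathAlgebra

/-! ### Quotients -/

namespace StarQuotient
variable {A : Type*} [Ring A] [StarRing A] (I : TwoSidedIdeal A) (K : Type*) [CommSemiring K]
  [StarRing K] [Algebra K A] [StarModule K A]

/-- A homomorphism vanishing on the ideal factors through the quotient. -/
def liftAlgHom {B : Type*} [Ring B] [Algebra K B] (φ : A →ₐ[K] B) (h : ∀ a ∈ I, φ a = 0) :
    StarQuotient I →ₐ[K] B where
  toFun := Quotient.lift φ fun a b hab => by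
    have := h _ ((TwoSidedIdeal.rel_iff I a b).1 hab)
    rwa [map_sub, sub_eq_zero] at this
  map_one' := map_one φ
  map_zero' := map_zero φ
  map_mul' := by
    refine ind fun a => ind fun b => ?_
    exact map_mul φ a b
  map_add' := by
    refine ind fun a => ind fun b => ?_
    exact map_add φ a b
  commutes' c := φ.commutes c

variable [I.IsStarClosed]

theorem liftAlgHom_mk {B : Type*} [Ring B] [Algebra K B] (φ : A →ₐ[K] B) (h : ∀ a ∈ I, φ a = 0)
    (a : A) : liftAlgHom I K φ h (mk I K a) = φ a := rfl

/-- A `*`-homomorphism vanishing on the ideal factors through the quotient. -/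
def lift {B : Type*} [Ring B] [StarRing B] [Algebra K B] (φ : A →⋆ₐ[K] B) (h : ∀ a ∈ I, φ a = 0) :
    StarQuotient I →⋆ₐ[K] B :=
  { liftAlgHom I K φ.toAlgHom h with
    map_star' := by
      refine ind fun a => ?_
      exact map_star φ a }

end StarQuotient

theorem TwoSidedIdeal.map_eq_zero_of_mem_span {A B F : Type*} [Ring A] [Ring B] [FunLike F A B]
    [RingHomClass F A B] (φ : F) {S : Set A} (h : ∀ a ∈ S, φ a = 0) :
    ∀ a ∈ TwoSidedIdeal.span S, φ a = 0 := by
  intro a ha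
  have : TwoSidedIdeal.span S ≤ TwoSidedIdeal.ker φ :=
    TwoSidedIdeal.span_le.2 fun b hb => (TwoSidedIdeal.mem_ker φ).2 (h b hb)
  exact (TwoSidedIdeal.mem_ker φ).1 (this ha)

/-! ### The quotient by the commutators of final projections -/

namespace SeparatedGraph
open LeavittPathAlgebra
variable {V E : Type*} [Fintype V] (G : SeparatedGraph V E) (K : Type*) [Field K] [StarRing K]

/-- The image of a vertex in `L^{ab}_K(E, C)`. -/
def labVertex (v : V) : G.Lab K := StarQuotient.mk (G.abIdeal K) K (vertex K G v)

variable {G K}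

theorem mk_wordProj (L : List (E × Bool)) :
    StarQuotient.mk (G.abIdeal K) K (wordProj (edge K G) L) = wordProj (G.labEdge K) L :=
  map_wordProj _ _ L

theorem mk_wordVal (L : List (E × Bool)) :
    StarQuotient.mk (G.abIdeal K) K (wordVal (edge K G) L) = wordVal (G.labEdge K) L :=
  map_wordVal _ _ L

theorem lab_starAlgHom_ext (hG : G.IsBipartite) {A : Type*} [Ring A] [StarRing A] [Algebra K A]
    {φ ψ : G.Lab K →⋆ₐ[K] A} (he : ∀ e, φ (G.labEdge K e) = ψ (G.labEdge K e)) : φ = ψ := by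
  have : φ.comp (StarQuotient.mk (G.abIdeal K) K) = ψ.comp (StarQuotient.mk (G.abIdeal K) K) :=
    starAlgHom_ext hG he
  ext a
  obtain ⟨a, rfl⟩ := StarQuotient.mk_surjective (G.abIdeal K) K a
  exact DFunLike.congr_fun this a

theorem labVertex_mul_self (v : V) : G.labVertex K v * G.labVertex K v = G.labVertex K v := by
  rw [labVertex, ← map_mul, vertex_mul_self]

theorem star_labVertex (v : V) : star (G.labVertex K v) = G.labVertex K v := by
  rw [labVertex, ← map_star, star_vertex]

theorem labVertex_mul_of_ne {v w : V} (h : v ≠ w) : G.labVertex K v * G.labVertex K w = 0 := by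
  rw [labVertex, labVertex, ← map_mul, vertex_mul_of_ne h, map_zero]

variable (G K) in
theorem sum_labVertex : ∑ v, G.labVertex K v = 1 := by
  simp only [labVertex]
  rw [← map_sum, sum_vertex, map_one]

theorem labVertex_range_mul (e : E) : G.labVertex K (G.range e) * G.labEdge K e = G.labEdge K e := by
  rw [labVertex, labEdge, ← map_mul, range_mul_edge]

theorem labVertex_source (e : E) :
    G.labVertex K (G.source e) = wordProj (G.labEdge K) [(e, false)] := by
  rw [labVertex, vertex_source, mk_wordProj]

theorem labVertex_eq_sum {v : V} {X : Finset E} (hX : X ∈ G.blocks v) :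
    G.labVertex K v = ∑ e ∈ X, wordProj (G.labEdge K) [(e, true)] := by
  rw [labVertex, vertex_eq_sum hX, map_sum]
  simp only [mk_wordProj]

variable (K) in
theorem exists_labVertex_eq_sum (hG : G.IsBipartite) (v : V) :
    ∃ (X : Finset E) (b : Bool),
      G.labVertex K v = ∑ e ∈ X, wordProj (G.labEdge K) [(e, b)] := by
  obtain ⟨X, b, h⟩ := exists_vertex_eq_sum K hG v
  refine ⟨X, b, ?_⟩
  rw [labVertex, h, map_sum]
  simp only [mk_wordProj]

theorem lab_wordProj_mul_of_ne {v : V} {X : Finset E} (hX : X ∈ G.blocks v) {e f : E}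
    (he : e ∈ X) (hf : f ∈ X) (hne : e ≠ f) :
    wordProj (G.labEdge K) [(e, true)] * wordProj (G.labEdge K) [(f, true)] = 0 := by
  rw [← mk_wordProj, ← mk_wordProj, ← map_mul, wordProj_mul_of_ne hX he hf hne, map_zero]

theorem lab_star_mul_of_ne {v : V} {X : Finset E} (hX : X ∈ G.blocks v) {e f : E}
    (he : e ∈ X) (hf : f ∈ X) (hne : e ≠ f) : star (G.labEdge K e) * G.labEdge K f = 0 := by
  rw [labEdge, labEdge, ← map_star, ← map_mul, star_edge_mul_edge_of_ne hX he hf hne, map_zero]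

end SeparatedGraph
end

noncomputable section

/-! ### The homomorphism to the crossed product -/

namespace SeparatedGraph
open LeavittPathAlgebra FinalSpectrum TopologicalSpace
variable {V E : Type*} [Fintype V] {G : SeparatedGraph V E} (hG : G.IsBipartite)

include hG in
theorem labVertex_mem (v : V) : G.labVertex ℂ v ∈ finalAlgebra (G.labEdge ℂ) := by
  obtain ⟨X, b, h⟩ := exists_labVertex_eq_sum ℂ hG v
  rw [h]
  exact sum_mem fun e _ => wordProj_mem _ _

/-- A vertex as an element of the algebra of final projections. -/
def finalVertex (v : V) : finalAlgebra (G.labEdge ℂ) := ⟨G.labVertex ℂ v, labVertex_mem hG v⟩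

theorem finalVertex_mul_self (v : V) : finalVertex hG v * finalVertex hG v = finalVertex hG v :=
  Subtype.ext (labVertex_mul_self v)

theorem finalVertex_mul_of_ne {v w : V} (h : v ≠ w) : finalVertex hG v * finalVertex hG w = 0 :=
  Subtype.ext (labVertex_mul_of_ne h)

theorem sum_finalVertex : ∑ v, finalVertex hG v = 1 :=
  Subtype.ext (by simpa [finalVertex] using sum_labVertex G ℂ)

theorem finalVertex_range_mul (e : E) :
    finalVertex hG (G.range e) * finalWord (G.labEdge ℂ) [(e, true)] =
      finalWord (G.labEdge ℂ) [(e, true)] :=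
  Subtype.ext (by
    simp [finalVertex, finalWord, wordProj, wordVal_singleton, letterVal, ← mul_assoc,
      labVertex_range_mul])

theorem finalVertex_source (e : E) :
    finalVertex hG (G.source e) = finalWord (G.labEdge ℂ) [(e, false)] :=
  Subtype.ext (labVertex_source e)

theorem finalVertex_eq_sum {v : V} {X : Finset E} (hX : X ∈ G.blocks v) :
    finalVertex hG v = ∑ e ∈ X, finalWord (G.labEdge ℂ) [(e, true)] :=
  Subtype.ext (by simpa [finalVertex, finalWord] using labVertex_eq_sum hX)

/-- The clopen set of the characters that are `1` at a vertex. -/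
def vertexRange (v : V) : Clopens G.Omega where
  carrier := {χ | χ.eval (finalVertex hG v) = 1}
  isClopen' := by
    refine ⟨isClosed_singleton.preimage (continuous_eval _), ?_⟩
    have : {χ : G.Omega | χ.eval (finalVertex hG v) = 1} = {χ | χ.eval (finalVertex hG v) ≠ 0} := by
      ext χ
      refine ⟨fun h => ?_, fun h => ?_⟩
      · change _ = _ at h
        change _ ≠ _
        rw [h]; exact one_ne_zero
      · refine mul_right_cancel₀ (b := χ.eval (finalVertex hG v)) h ?_
        rw [← map_mul, finalVertex_mul_self, one_mul]
    rw [this]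
    exact isOpen_ne.preimage (continuous_eval _)

theorem mem_vertexRange {v : V} {χ : G.Omega} :
    χ ∈ vertexRange hG v ↔ χ.eval (finalVertex hG v) = 1 := Iff.rfl

variable [DecidableEq E] {K : Type*} [Field K] [TopologicalSpace K] [IsTopologicalRing K]

theorem clopenInd_vertexRange (v : V) (χ : G.Omega) : clopenInd K (vertexRange hG v) χ =
    if χ.eval (finalVertex hG v) = 1 then 1 else 0 := by
  by_cases h : χ ∈ vertexRange hG v
  · rw [clopenInd_of_mem h, if_pos ((mem_vertexRange hG).1 h)]
  · rw [clopenInd_of_notMem h, if_neg fun h' => h ((mem_vertexRange hG).2 h')]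

theorem clopenInd_wordRange (L : List (E × Bool)) (χ : G.Omega) :
    clopenInd K (wordRange (G.labEdge ℂ) L) χ =
      if χ.eval (finalWord (G.labEdge ℂ) L) = 1 then 1 else 0 := by
  by_cases h : χ ∈ wordRange (G.labEdge ℂ) L
  · rw [clopenInd_of_mem h, if_pos ((mem_wordRange _).1 h)]
  · rw [clopenInd_of_notMem h, if_neg fun h' => h ((mem_wordRange _).2 h')]

/-- At each character the vertices take orthogonal idempotent values with sum 1, so exactly one of
the indicators is 1. -/
theorem sum_clopenInd_vertexRange : ∑ v, clopenInd K (vertexRange hG v) = 1 := by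
  ext χ
  rw [ContinuousMap.sum_apply]
  simp only [clopenInd_vertexRange]
  rw [sum_ite_eq_one, ← map_sum, sum_finalVertex, map_one, if_pos rfl]
  · rfl
  · intro v _
    rw [← map_mul, finalVertex_mul_self]
  · intro v _ w _ h
    rw [← map_mul, finalVertex_mul_of_ne hG h, map_zero]

theorem clopenInd_vertexRange_eq_sum {v : V} {X : Finset E} (hX : X ∈ G.blocks v) :
    clopenInd K (vertexRange hG v) =
      ∑ e ∈ X, clopenInd K (wordRange (G.labEdge ℂ) [(e, true)]) := by
  ext χ
  rw [ContinuousMap.sum_apply]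
  simp only [clopenInd_vertexRange, clopenInd_wordRange]
  rw [sum_ite_eq_one, ← map_sum, finalVertex_eq_sum hG hX]
  · intro e _
    rw [← map_mul]
    exact congrArg χ.eval (Subtype.ext (wordProj_mul_self _ _))
  · intro e he f hf h
    rw [← map_mul, ← map_zero χ.eval]
    exact congrArg χ.eval (Subtype.ext (lab_wordProj_mul_of_ne hX he hf h))

theorem vertexRange_inf_of_ne {v w : V} (h : v ≠ w) :
    vertexRange hG v ⊓ vertexRange hG w = ⊥ := by
  ext χ
  refine ⟨fun h' => ?_, fun h' => absurd h' (Set.notMem_empty χ)⟩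
  obtain ⟨h1, h2⟩ : χ.eval (finalVertex hG v) = 1 ∧ χ.eval (finalVertex hG w) = 1 := h'
  have := congrArg χ.eval (finalVertex_mul_of_ne hG h)
  rw [map_mul, h1, h2, map_zero, one_mul] at this
  exact absurd this one_ne_zero

theorem vertexRange_inf_edge (e : E) :
    vertexRange hG (G.range e) ⊓ wordRange (G.labEdge ℂ) [(e, true)] =
      wordRange (G.labEdge ℂ) [(e, true)] := by
  refine inf_eq_right.2 fun χ h => ?_
  have h' := (mem_wordRange _).1 h
  have := congrArg χ.eval (finalVertex_range_mul hG e)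
  rw [map_mul, h', mul_one] at this
  exact this

theorem vertexRange_source (e : E) :
    vertexRange hG (G.source e) = wordRange (G.labEdge ℂ) [(e, false)] := by
  ext χ
  refine Iff.trans ?_ (mem_wordRange _).symm
  rw [← finalVertex_source hG]
  rfl

/-- The element `e*e` is a projection, hence its own final projection. The product in the crossed
product produces the unreduced word `e⁻¹e`, whereas the vertex is described by the single letter
`e⁻¹`. -/
theorem wordRange_ghost_edge (e : E) :
    wordRange (G.labEdge ℂ) [(e, false), (e, true)] = wordRange (G.labEdge ℂ) [(e, false)] := by
  refine le_antisymm (fun χ h => ((mem_wordClopen_append _ _ (L := [(e, false)])).1 h).1)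
    fun χ h => ?_
  refine (mem_wordRange _).2 ?_
  rw [← (mem_wordRange (G.labEdge ℂ)).1 h]
  congr 1
  refine Subtype.ext ?_
  simp only [finalWord, wordProj, wordVal_cons, wordVal_nil, letterVal, mul_one, star_mul, star_star]
  have := TameFamily.partialIsometry (x := G.labEdge ℂ) e
  rw [← mul_assoc, mul_assoc _ _ (star _), mul_assoc _ _ (G.labEdge ℂ e), this]

theorem wordRange_edge_ghost (e : E) :
    wordRange (G.labEdge ℂ) [(e, true), (e, false)] = wordRange (G.labEdge ℂ) [(e, true)] := by
  refine le_antisymm (fun χ h => ((mem_wordClopen_append _ _ (L := [(e, true)])).1 h).1)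
    fun χ h => ?_
  refine (mem_wordRange _).2 ?_
  rw [← (mem_wordRange (G.labEdge ℂ)).1 h]
  congr 1
  refine Subtype.ext ?_
  simp only [finalWord, wordProj, wordVal_cons, wordVal_nil, letterVal, mul_one, star_mul, star_star]
  have := TameFamily.partialIsometry (x := G.labEdge ℂ) e
  rw [← mul_assoc, this]

theorem wordRange_of_ne {v : V} {X : Finset E} (hX : X ∈ G.blocks v) {e f : E}
    (he : e ∈ X) (hf : f ∈ X) (hne : e ≠ f) :
    wordRange (G.labEdge ℂ) [(e, false), (f, true)] = ⊥ := by
  ext χ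
  refine ⟨fun h' => ?_, fun h' => absurd h' (Set.notMem_empty χ)⟩
  have h := (mem_wordRange _).1 h'
  have h0 : finalWord (G.labEdge ℂ) [(e, false), (f, true)] = 0 := Subtype.ext (by
    simp only [finalWord, wordProj, wordVal_cons, wordVal_nil, letterVal, mul_one]
    rw [lab_star_mul_of_ne hX he hf hne, zero_mul]
    rfl)
  rw [h0, map_zero] at h
  exact absurd h zero_ne_one

variable [StarRing K] [ContinuousStar K]

variable (G K) in
/-- The algebraic crossed product of the partial action on `Ω(E, C)`. -/
abbrev OmegaCrossed : Type _ :=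
  (PartialAction.ofFree (edgeHomeo (G.labEdge ℂ)) (isClosed_edgeHomeo_source _)
    (isClosed_edgeHomeo_target _)).CrossedProduct K

variable (G K) in
/-- The element `1_L δ_{[L]}` of the crossed product. -/
abbrev omegaDelta (L : List (E × Bool)) : G.OmegaCrossed K :=
  wordDelta (isClosed_edgeHomeo_source _) (isClosed_edgeHomeo_target _) K L

variable (G K) in
/-- The embedding of the continuous functions in the crossed product. -/
abbrev omegaIncl : C(G.Omega, K) →⋆ₐ[K] G.OmegaCrossed K := PartialAction.CrossedProduct.incl _ K

theorem incl_mul_omegaDelta {Z : Clopens G.Omega} {L : List (E × Bool)}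
    (h : Z ⊓ wordRange (G.labEdge ℂ) L = wordRange (G.labEdge ℂ) L) :
    omegaIncl G K (clopenInd K Z) * omegaDelta G K L = omegaDelta G K L := by
  rw [omegaDelta, wordDelta, PartialAction.CrossedProduct.incl_mul_single]
  refine PartialAction.CrossedProduct.single_congr rfl ?_
  change clopenInd K Z * clopenInd K (wordRange (G.labEdge ℂ) L) = _
  rw [clopenInd_mul, h]

theorem omegaIncl_vertexRange_source (e : E) :
    omegaIncl G K (clopenInd K (vertexRange hG (G.source e))) =
      omegaDelta G K [(e, false), (e, true)] := by
  rw [vertexRange_source, ← wordRange_ghost_edge]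
  exact (wordDelta_eq_incl _ _ (Quot.sound (FreeGroup.Red.Step.not (L₁ := [])))).symm

theorem star_omegaDelta_ghost (e : E) :
    star (omegaDelta G K [(e, false)]) = omegaDelta G K [(e, true)] :=
  star_wordDelta _ _ [(e, false)]

theorem star_omegaDelta_edge (e : E) :
    star (omegaDelta G K [(e, true)]) = omegaDelta G K [(e, false)] :=
  star_wordDelta _ _ [(e, true)]

theorem range_mul_omegaDelta (e : E) :
    omegaIncl G K (clopenInd K (vertexRange hG (G.range e))) * omegaDelta G K [(e, true)] =
      omegaDelta G K [(e, true)] :=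
  incl_mul_omegaDelta (vertexRange_inf_edge hG e)

theorem source_mul_omegaDelta (e : E) :
    omegaIncl G K (clopenInd K (vertexRange hG (G.source e))) * omegaDelta G K [(e, false)] =
      omegaDelta G K [(e, false)] :=
  incl_mul_omegaDelta (by rw [vertexRange_source, inf_idem])

variable (K) in
/-- The homomorphism of the Leavitt path algebra to the crossed product. -/
def crossedAlgHom : LeavittPathAlgebra K G →ₐ[K] G.OmegaCrossed K :=
  liftHom (fun v => omegaIncl G K (clopenInd K (vertexRange hG v)))
    (fun e => omegaDelta G K [(e, true)]) (fun e => omegaDelta G K [(e, false)])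
    (fun v => by rw [← map_mul, clopenInd_mul, inf_idem])
    (fun v w h => by rw [← map_mul, clopenInd_mul, vertexRange_inf_of_ne hG h, clopenInd_bot,
      map_zero])
    (by rw [← map_sum, sum_clopenInd_vertexRange, map_one])
    (range_mul_omegaDelta hG)
    -- The relations with the vertex on the right are adjoints of those with the vertex on the left.
    (fun e => by
      have := congrArg star (source_mul_omegaDelta (K := K) hG e)
      rwa [star_mul, star_omegaDelta_ghost, ← map_star, star_clopenInd] at this)
    (fun e => by
      have := congrArg star (range_mul_omegaDelta (K := K) hG e)
      rwa [star_mul, star_omegaDelta_edge, ← map_star, star_clopenInd] at this)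
    (source_mul_omegaDelta hG)
    (fun e => by rw [omegaIncl_vertexRange_source, wordDelta_mul]; rfl)
    -- The product is supported on the range of `e⁻¹f`, which is empty because `e*f = 0`.
    (fun v X hX e he f hf h => by
      rw [wordDelta_mul, wordDelta.eq_def]
      refine (PartialAction.CrossedProduct.single_congr (b := 0) rfl ?_).trans (map_zero _)
      change clopenInd K (wordRange (G.labEdge ℂ) [(e, false), (f, true)]) = 0
      rw [wordRange_of_ne hX he hf h, clopenInd_bot])
    -- Each `ee*` becomes the indicator function of `H_e`, since the range of `ee⁻¹` is that of `e`.
    (fun v X hX => by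
      rw [clopenInd_vertexRange_eq_sum hG hX, map_sum]
      refine Finset.sum_congr rfl fun e _ => ?_
      rw [wordDelta_mul, ← wordRange_edge_ghost]
      exact (wordDelta_eq_incl _ _ (Quot.sound (FreeGroup.Red.Step.not (L₁ := [])))).symm)

variable (K) in
/-- The `*`-homomorphism of the Leavitt path algebra to the crossed product. -/
def crossedHom : LeavittPathAlgebra K G →⋆ₐ[K] G.OmegaCrossed K :=
  { crossedAlgHom hG K with
    map_star' := fun a => by
      change crossedAlgHom hG K (star a) = star (crossedAlgHom hG K a)
      induction a using LeavittPathAlgebra.induction with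
      | halg c =>
        rw [LeavittPathAlgebra.star_algebraMap', AlgHom.commutes, AlgHom.commutes,
          algebraMap_star_comm]
      | hgen x =>
        rw [LeavittPathAlgebra.star_gen]
        cases x with
        | vertex v =>
          change crossedAlgHom hG K (vertex K G v) = star (crossedAlgHom hG K (vertex K G v))
          rw [crossedAlgHom, liftHom_vertex, ← map_star, star_clopenInd]
        | edge e =>
          change crossedAlgHom hG K (ghost K G e) = star (crossedAlgHom hG K (edge K G e))
          rw [crossedAlgHom, liftHom_ghost, liftHom_edge, star_omegaDelta_edge]
        | ghost e =>
          change crossedAlgHom hG K (edge K G e) = star (crossedAlgHom hG K (ghost K G e))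
          rw [crossedAlgHom, liftHom_ghost, liftHom_edge, star_omegaDelta_ghost]
      | hadd a b ha hb => rw [star_add, map_add, map_add, star_add, ha, hb]
      | hmul a b ha hb => rw [star_mul, map_mul, map_mul, star_mul, ha, hb] }

theorem crossedHom_edge (e : E) :
    crossedHom hG K (edge K G e) = omegaDelta G K [(e, true)] := by
  change crossedAlgHom hG K (edge K G e) = _
  rw [crossedAlgHom, liftHom_edge]

theorem crossedHom_wordVal (L : List (E × Bool)) :
    crossedHom hG K (wordVal (edge K G) L) = omegaDelta G K L := by
  rw [map_wordVal]
  simp only [crossedHom_edge]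
  exact wordDelta_eq_wordVal _ _ L

/-- The word `L L⁻¹` is trivial in the free group and has the same range as `L`, so its element is a
function. -/
theorem omegaDelta_wordProj (L : List (E × Bool)) :
    omegaDelta G K L * star (omegaDelta G K L) =
      omegaIncl G K (clopenInd K (wordRange (G.labEdge ℂ) L)) := by
  rw [star_wordDelta, wordDelta_mul, wordDelta_eq_incl]
  · have : wordRange (G.labEdge ℂ) (L ++ FreeGroup.invRev L) = wordRange (G.labEdge ℂ) L := by
      have := wordRange_inf (G.labEdge ℂ) L []
      rw [List.append_nil] at this
      rw [← this, wordRange.eq_def _ [], wordClopen_nil, inf_top_eq]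
    rw [← this]
  · rw [← FreeGroup.mul_mk, ← FreeGroup.inv_mk, mul_inv_cancel]

theorem crossedHom_wordProj (L : List (E × Bool)) :
    crossedHom hG K (wordProj (edge K G) L) =
      omegaIncl G K (clopenInd K (wordRange (G.labEdge ℂ) L)) := by
  rw [wordProj, map_mul, map_star, crossedHom_wordVal, omegaDelta_wordProj]

/-- Final projections are sent to functions on Ω, and functions commute. -/
theorem crossedHom_commutator {c : LeavittPathAlgebra K G}
    (hc : c ∈ finalCommutators (edge K G)) : crossedHom hG K c = 0 := by
  obtain ⟨u, hu, w, hw, rfl⟩ := hc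
  obtain ⟨L, -, rfl⟩ := exists_wordVal_of_mem hu
  obtain ⟨M, -, rfl⟩ := exists_wordVal_of_mem hw
  change crossedHom hG K (wordProj _ L * wordProj _ M - wordProj _ M * wordProj _ L) = 0
  rw [map_sub, map_mul, map_mul, crossedHom_wordProj, crossedHom_wordProj, ← map_mul, ← map_mul, mul_comm, sub_self]

variable (K) in
/-- The `*`-homomorphism of `L^{ab}_K(E, C)` to the crossed product. -/
def labCrossedHom : G.Lab K →⋆ₐ[K] G.OmegaCrossed K :=
  StarQuotient.lift (G.abIdeal K) K (crossedHom hG K)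
    (TwoSidedIdeal.map_eq_zero_of_mem_span _ fun _ h => crossedHom_commutator hG h)

theorem labCrossedHom_edge (e : E) :
    labCrossedHom hG K (G.labEdge K e) = omegaDelta G K [(e, true)] :=
  crossedHom_edge hG e

theorem labCrossedHom_wordProj (L : List (E × Bool)) :
    labCrossedHom hG K (wordProj (G.labEdge K) L) =
      omegaIncl G K (clopenInd K (wordRange (G.labEdge ℂ) L)) := by
  rw [← mk_wordProj]
  exact crossedHom_wordProj hG L

theorem labCrossedHom_wordVal (L : List (E × Bool)) :
    labCrossedHom hG K (wordVal (G.labEdge K) L) = omegaDelta G K L := by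
  rw [← mk_wordVal]
  exact crossedHom_wordVal hG L

end SeparatedGraph
end

noncomputable section

/-! ### Characters of commutative algebras generated by idempotents -/

/-- A commutative algebra over a field generated by idempotents has enough characters. -/
theorem exists_algHom_ne_zero {K B : Type*} [Field K] [CommRing B] [Algebra K B] {S : Set B}
    (hS : ∀ s ∈ S, s * s = s) (hgen : Algebra.adjoin K S = ⊤) {b : B} (hb : b ≠ 0) :
    ∃ ψ : B →ₐ[K] K, ψ b ≠ 0 := by
  -- An ideal maximal among those not containing `b` turns out to be the kernel of a `K`-valued
  -- character; no assumption on the field is needed.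
  obtain ⟨I, -, hI⟩ := zorn_le_nonempty₀ {I : Ideal B | b ∉ I} (by
    intro c hc hchain J hJ
    refine ⟨sSup c, fun h => ?_, fun z hz => le_sSup hz⟩
    obtain ⟨J', hJ', h'⟩ := (Submodule.mem_sSup_of_directed ⟨J, hJ⟩ hchain.directedOn).1 h
    exact hc hJ' h') ⊥ (by simpa using hb)
  have hbI : b ∉ I := hI.1
  have hmem (s : B) (hs : s ∉ I) : ∃ i ∈ I, ∃ c, b = i + c * s := by
    by_contra hcon
    have hle : I ⊔ Ideal.span {s} ≤ I := hI.2 (y := I ⊔ Ideal.span {s}) (by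
      intro h
      obtain ⟨i, hi, y, hy, rfl⟩ := Submodule.mem_sup.1 h
      obtain ⟨c, rfl⟩ := Ideal.mem_span_singleton'.1 hy
      exact hcon ⟨i, hi, c, rfl⟩) le_sup_left
    exact hs (hle (Ideal.mem_sup_right (Ideal.mem_span_singleton_self s)))
  -- If neither idempotent lay in `I`, maximality would give `b = i + c s = j + d (1 - s)` with `i,
  -- j ∈ I`, and then `b = b (1 - s) + b s = i (1 - s) + j s` would lie in `I`.
  have hdich (s : B) (hs : s * s = s) : s ∈ I ∨ 1 - s ∈ I := by
    by_contra! h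
    obtain ⟨i, hi, c, h1⟩ := hmem s h.1
    obtain ⟨j, hj, d, h2⟩ := hmem (1 - s) h.2
    have : b = i * (1 - s) + j * s := by
      have e1 : b * (1 - s) = i * (1 - s) := by rw [h1]; linear_combination -c * hs
      have e2 : b * s = j * s := by rw [h2]; linear_combination -d * hs
      linear_combination e1 + e2
    exact hbI (this ▸ I.add_mem (I.mul_mem_right _ hi) (I.mul_mem_right _ hj))
  -- Every generator becomes 0 or 1 modulo `I`, so the quotient consists of scalars.
  have hsurj : Function.Surjective (Algebra.ofId K (B ⧸ I)) := by
    intro q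
    obtain ⟨a, rfl⟩ := Ideal.Quotient.mk_surjective q
    have ha : a ∈ Algebra.adjoin K S := by rw [hgen]; trivial
    change Ideal.Quotient.mk I a ∈ (Algebra.ofId K (B ⧸ I)).range
    induction ha using Algebra.adjoin_induction with
    | mem s hs =>
      rcases hdich s (hS s hs) with h | h
      · rw [Ideal.Quotient.eq_zero_iff_mem.2 h]; exact zero_mem _
      · rw [← Ideal.Quotient.eq_zero_iff_mem, map_sub, map_one, sub_eq_zero] at h
        rw [← h]; exact one_mem _
    | algebraMap c => exact ⟨c, rfl⟩
    | add a b _ _ ha hb => rw [map_add]; exact add_mem ha hb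
    | mul a b _ _ ha hb => rw [map_mul]; exact mul_mem ha hb
  have : Nontrivial (B ⧸ I) := Ideal.Quotient.nontrivial_iff.2 fun h => hbI (h ▸ trivial)
  let e : K ≃ₐ[K] B ⧸ I :=
    AlgEquiv.ofBijective (Algebra.ofId K (B ⧸ I)) ⟨RingHom.injective _, hsurj⟩
  refine ⟨(e.symm : B ⧸ I →ₐ[K] K).comp (Ideal.Quotient.mkₐ K I), fun h => hbI ?_⟩
  have h' : e.symm (Ideal.Quotient.mk I b) = 0 := h
  rwa [map_eq_zero_iff _ e.symm.injective, Ideal.Quotient.eq_zero_iff_mem] at h'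

/-! ### The action of the normalizing partial isometries on functions of characters -/

section Normalizer
variable {K A : Type*} [Field K] [StarRing K] [Ring A] [StarRing A] [Algebra K A] {B : Subalgebra K A}
  (hB : ∀ a ∈ B, ∀ b ∈ B, a * b = b * a)

/-- The partial isometries normalizing a commutative subalgebra. -/
def normalizingMonoid : Submonoid A where
  carrier := {w | w * star w * w = w ∧ (∀ b ∈ B, w * b * star w ∈ B) ∧ ∀ b ∈ B, star w * b * w ∈ B}
  one_mem' := by simp
  mul_mem' := by
    rintro u w ⟨hu, hu1, hu2⟩ ⟨hw, hw1, hw2⟩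
    refine ⟨?_, fun b hb => ?_, fun b hb => ?_⟩
    · have h := hB _ (by simpa using hu2 1 (one_mem _)) _ (by simpa using hw1 1 (one_mem _))
      calc u * w * star (u * w) * (u * w) = u * ((w * star w) * (star u * u)) * w := by
            simp only [star_mul, mul_assoc]
        _ = (u * star u * u) * (w * star w * w) := by rw [← h]; simp only [mul_assoc]
        _ = u * w := by rw [hu, hw]
    · have := hu1 _ (hw1 b hb)
      simpa [mul_assoc] using this
    · have := hw2 _ (hu2 b hb)
      simpa [mul_assoc] using this

theorem proj_mem_normalizingMonoid {p : A} (hp : p ∈ B) (h1 : star p = p) (h2 : p * p = p) :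
    p ∈ normalizingMonoid hB := by
  refine ⟨by rw [h1, h2, h2], fun b hb => ?_, fun b hb => ?_⟩
  · rw [h1]; exact mul_mem (mul_mem hp hb) hp
  · rw [h1]; exact mul_mem (mul_mem hp hb) hp

variable (w u : normalizingMonoid hB)

/-- `b ↦ w b w*` on the commutative subalgebra. -/
def normConj : B →ₗ[K] B where
  toFun b := ⟨w * b * star (w : A), w.2.2.1 b b.2⟩
  map_add' a b := Subtype.ext (by simp [mul_add, add_mul])
  map_smul' c b := Subtype.ext (by simp)

theorem normConj_mul (a b : B) : normConj hB w (a * b) = normConj hB w a * normConj hB w b := by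
  refine Subtype.ext ?_
  have hw : star (w : A) * w ∈ B := by simpa using w.2.2.2 1 (one_mem _)
  calc (w : A) * (a * b) * star (w : A) = (w * star (w : A) * w) * (a * b) * star (w : A) := by
        rw [w.2.1]
    _ = w * ((star (w : A) * w) * a) * b * star (w : A) := by simp only [mul_assoc]
    _ = _ := by
      rw [hB _ hw _ a.2]
      simp only [normConj, LinearMap.coe_mk, AddHom.coe_mk, MulMemClass.coe_mul, mul_assoc]

theorem normConj_mul_apply (b : B) :
    normConj hB (w * u) b = normConj hB w (normConj hB u b) :=
  Subtype.ext (by simp [normConj, mul_assoc])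

/-- The character `b ↦ ψ(w b w*)`. -/
def normShift (ψ : B →ₐ[K] K) (h : ψ (normConj hB w 1) = 1) : B →ₐ[K] K :=
  AlgHom.ofLinearMap (ψ.toLinearMap.comp (normConj hB w)) h fun a b => by
    simp [normConj_mul]

open Classical in
/-- The action of normalizing partial isometries on the functions on the space of characters. -/
def normAct : normalizingMonoid hB →* Module.End ℂ ((B →ₐ[K] K) → ℂ) where
  toFun w :=
    -- The condition says `ψ(w w*) = 1`, that is, ψ lies in the range of `w`; elsewhere the value is
    -- 0, so `w` acts as a partial translation. Functions take values in ℂ although characters take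
    -- values in `K`: this is the passage from one field to the other.
    { toFun := fun f ψ => if h : ψ (normConj hB w 1) = 1 then f (normShift hB w ψ h) else 0
      map_add' := fun f f' => by
        ext ψ
        by_cases h : ψ (normConj hB w 1) = 1 <;> simp [h]
      map_smul' := fun c f => by
        ext ψ
        by_cases h : ψ (normConj hB w 1) = 1 <;> simp [h] }
  map_one' := by
    have h1 (b : B) : normConj hB 1 b = b := Subtype.ext (by simp [normConj])
    ext f ψ
    have h : ψ (normConj hB 1 1) = 1 := by rw [h1, map_one]
    refine (dif_pos h).trans ?_
    refine congrArg f (AlgHom.ext fun b => ?_)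
    exact congrArg ψ (h1 b)
  map_mul' w u := by
    ext f ψ
    change dite _ _ _ = dite _ _ _
    by_cases h : ψ (normConj hB w 1) = 1
    · rw [dif_pos h]
      change _ = dite _ _ _
      by_cases h' : ψ (normConj hB w (normConj hB u 1)) = 1
      · rw [dif_pos (show ψ (normConj hB (w * u) 1) = 1 by rw [normConj_mul_apply, h']),
          dif_pos (show normShift hB w ψ h (normConj hB u 1) = 1 from h')]
        refine congrArg f (AlgHom.ext fun b => ?_)
        exact congrArg ψ (normConj_mul_apply hB w u b)
      · rw [dif_neg (show ¬ψ (normConj hB (w * u) 1) = 1 by rwa [normConj_mul_apply]),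
          dif_neg (show ¬normShift hB w ψ h (normConj hB u 1) = 1 from h')]
    -- Since `w u u* w*` lies below `w w*`, a character that is 1 on the former is 1 on the latter.
    · rw [dif_neg h, dif_neg]
      rw [normConj_mul_apply]
      intro h'
      have := normConj_mul hB w 1 (normConj hB u 1)
      rw [one_mul] at this
      have h2 := congrArg ψ this
      rw [map_mul, h', mul_one] at h2
      exact h h2.symm

-- If `ψ(p) = 1` then `ψ(p b p) = ψ(b)`, so `p` moves no character in its range and acts as
-- multiplication by an indicator function.
open Classical in
theorem normAct_proj (p : normalizingMonoid hB) (hp : (p : A) ∈ B) (h1 : star (p : A) = p)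
    (h2 : (p : A) * p = p) (f : (B →ₐ[K] K) → ℂ) (ψ : B →ₐ[K] K) :
    normAct hB p f ψ = if ψ ⟨p, hp⟩ = 1 then f ψ else 0 := by
  have hc : normConj hB p 1 = ⟨p, hp⟩ := Subtype.ext (by simp [normConj, h1, h2])
  change dite _ _ _ = _
  by_cases h : ψ ⟨p, hp⟩ = 1
  · have h' : ψ (normConj hB p 1) = 1 := by rw [hc, h]
    rw [dif_pos h', if_pos h]
    refine congrArg f (AlgHom.ext fun b => ?_)
    have hb : normConj hB p b = ⟨p, hp⟩ * b * ⟨p, hp⟩ := Subtype.ext (by simp [normConj, h1])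
    change ψ (normConj hB p b) = ψ b
    rw [hb, map_mul, map_mul, h, one_mul, mul_one]
  · rw [dif_neg (by rwa [hc]), if_neg h]

end Normalizer

/-! ### The final projections in `L^{ab}_K(E, C)` -/

namespace SeparatedGraph
open LeavittPathAlgebra FinalSpectrum
variable {V E : Type*} [Fintype V] (G : SeparatedGraph V E) (K : Type*) [Field K] [StarRing K]

/-- The subalgebra of `L^{ab}_K(E, C)` generated by the final projections. -/
def labFinal : Subalgebra K (G.Lab K) := Algebra.adjoin K (Set.range (wordProj (G.labEdge K)))

variable {G K}

theorem wordProj_mem_labFinal (L : List (E × Bool)) : wordProj (G.labEdge K) L ∈ G.labFinal K :=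
  Algebra.subset_adjoin ⟨L, rfl⟩

theorem labFinal_comm : ∀ a ∈ G.labFinal K, ∀ b ∈ G.labFinal K, a * b = b * a := by
  intro a ha b hb
  refine Algebra.commute_of_mem_adjoin_of_forall_mem_commute hb ?_
  rintro _ ⟨L, rfl⟩
  refine (Algebra.commute_of_mem_adjoin_of_forall_mem_commute ha ?_).symm
  rintro _ ⟨M, rfl⟩
  exact wordProj_commute _ L M

theorem wordVal_conj_mem_labFinal (L : List (E × Bool)) {b : G.Lab K} (hb : b ∈ G.labFinal K) :
    wordVal (G.labEdge K) L * b * star (wordVal (G.labEdge K) L) ∈ G.labFinal K := by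
  have key (M) : wordVal (G.labEdge K) L * wordProj (G.labEdge K) M * star (wordVal (G.labEdge K) L) =
      wordProj (G.labEdge K) (L ++ M) := by
    rw [wordProj, wordProj, wordVal_append, star_mul]
    simp only [mul_assoc]
  induction hb using Algebra.adjoin_induction with
  | mem b hb =>
    obtain ⟨M, rfl⟩ := hb
    rw [key]; exact wordProj_mem_labFinal _
  | algebraMap c =>
    rw [← Algebra.commutes, mul_assoc]
    exact mul_mem (Subalgebra.algebraMap_mem _ c) (wordProj_mem_labFinal L)
  | add a b _ _ ha hb => rw [mul_add, add_mul]; exact add_mem ha hb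
  | mul a b ha' _ ha hb =>
    set w := wordVal (G.labEdge K) L
    have hw : star w * w ∈ G.labFinal K := by
      have := wordProj_mem_labFinal (K := K) (G := G) (FreeGroup.invRev L)
      rwa [wordProj, wordVal_invRev, star_star] at this
    have : w * (a * b) * star w = (w * a * star w) * (w * b * star w) := by
      calc w * (a * b) * star w = (w * star w * w) * (a * b) * star w := by
            rw [← wordProj, wordVal_partialIsometry]
        _ = w * ((star w * w) * a) * b * star w := by simp only [mul_assoc]
        _ = _ := by rw [labFinal_comm _ hw _ ha']; simp only [mul_assoc]
    rw [this]
    exact mul_mem ha hb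

/-- A word as a normalizing partial isometry. -/
def normWord (L : List (E × Bool)) : normalizingMonoid (labFinal_comm (G := G) (K := K)) :=
  ⟨wordVal (G.labEdge K) L, wordVal_partialIsometry _ L, fun b hb => wordVal_conj_mem_labFinal L hb,
    fun b hb => by
      have := wordVal_conj_mem_labFinal (FreeGroup.invRev L) hb
      rwa [wordVal_invRev, star_star] at this⟩

variable (hG : G.IsBipartite)

include hG in
theorem labVertex_mem_labFinal (v : V) : G.labVertex K v ∈ G.labFinal K := by
  obtain ⟨X, b, h⟩ := exists_labVertex_eq_sum K hG v
  rw [h]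
  exact sum_mem fun e _ => wordProj_mem_labFinal _

/-- A vertex as a normalizing partial isometry. -/
def normVertex (v : V) : normalizingMonoid (labFinal_comm (G := G) (K := K)) :=
  ⟨G.labVertex K v, proj_mem_normalizingMonoid _ (labVertex_mem_labFinal hG v) (star_labVertex v)
    (labVertex_mul_self v)⟩

theorem normWord_mul (L M : List (E × Bool)) :
    (normWord L * normWord M : normalizingMonoid (labFinal_comm (G := G) (K := K))) =
      normWord (L ++ M) :=
  Subtype.ext (wordVal_append _ L M).symm

theorem normAct_eq_zero {w : normalizingMonoid (labFinal_comm (G := G) (K := K))}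
    (h : (w : G.Lab K) = 0) : normAct _ w = 0 := by
  ext f ψ
  refine dif_neg ?_
  have : normConj (labFinal_comm (G := G) (K := K)) w 1 = 0 := Subtype.ext (by simp [normConj, h])
  rw [this, map_zero]
  exact zero_ne_one

theorem normAct_word_mul_invRev (L : List (E × Bool)) :
    ((normWord L * normWord (FreeGroup.invRev L) :
      normalizingMonoid (labFinal_comm (G := G) (K := K))) : G.Lab K) =
        wordProj (G.labEdge K) L := by
  change wordVal _ L * wordVal _ (FreeGroup.invRev L) = _
  rw [wordVal_invRev, wordProj]

open Classical in
theorem normAct_wordProj (L : List (E × Bool)) (f : (G.labFinal K →ₐ[K] K) → ℂ)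
    (ψ : G.labFinal K →ₐ[K] K) :
    normAct (labFinal_comm (G := G) (K := K)) (normWord L * normWord (FreeGroup.invRev L)) f ψ =
      if ψ ⟨wordProj (G.labEdge K) L, wordProj_mem_labFinal L⟩ = 1 then f ψ else 0 := by
  have h := normAct_word_mul_invRev (G := G) (K := K) L
  rw [normAct_proj _ _ (by rw [h]; exact wordProj_mem_labFinal L) (by rw [h, star_wordProj])
    (by rw [h, wordProj_mul_self])]
  simp only [h]

-- Projections act by indicator functions, and for orthogonal projections these add up at every
-- character by `sum_ite_eq_one`. An additive relation over `K` thus becomes one between operators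
-- over ℂ, although `normAct` is only multiplicative.
open Classical in
theorem sum_normAct {ι : Type*} (s : Finset ι)
    (w : ι → normalizingMonoid (labFinal_comm (G := G) (K := K)))
    (q : normalizingMonoid (labFinal_comm (G := G) (K := K)))
    (hw : ∀ i, (w i : G.Lab K) ∈ G.labFinal K) (h1 : ∀ i, star (w i : G.Lab K) = w i)
    (h2 : ∀ i, (w i : G.Lab K) * w i = w i)
    (hne : ∀ i ∈ s, ∀ j ∈ s, i ≠ j → (w i : G.Lab K) * w j = 0)
    (hq1 : star (q : G.Lab K) = q) (hq2 : (q : G.Lab K) * q = q)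
    (hq : (q : G.Lab K) = ∑ i ∈ s, (w i : G.Lab K)) :
    normAct _ q = ∑ i ∈ s, normAct _ (w i) := by
  have hqm : (q : G.Lab K) ∈ G.labFinal K := by rw [hq]; exact sum_mem fun i _ => hw i
  refine LinearMap.ext fun f => funext fun ψ => ?_
  rw [LinearMap.sum_apply, Finset.sum_apply, normAct_proj _ q hqm hq1 hq2]
  have hs := sum_ite_eq_one ℂ s (fun i => ψ ⟨w i, hw i⟩)
    (fun i _ => by rw [← map_mul]; exact congrArg ψ (Subtype.ext (h2 i)))
    (fun i hi j hj h => by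
      rw [← map_mul, ← map_zero ψ]; exact congrArg ψ (Subtype.ext (hne i hi j hj h)))
  have hsum : ∑ i ∈ s, ψ ⟨w i, hw i⟩ = ψ ⟨q, hqm⟩ := by
    rw [← map_sum]
    refine congrArg ψ (Subtype.ext ?_)
    rw [AddSubmonoidClass.coe_finsetSum, hq]
  rw [hsum] at hs
  have h3 (i) : normAct _ (w i) f ψ = (if ψ ⟨w i, hw i⟩ = 1 then (1 : ℂ) else 0) * f ψ := by
    rw [normAct_proj _ (w i) (hw i) (h1 i) (h2 i), ite_mul, one_mul, zero_mul]
  rw [Finset.sum_congr rfl fun i _ => h3 i, ← Finset.sum_mul, hs, ite_mul, one_mul, zero_mul]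

theorem normWord_ghost_mul_edge (e : E) :
    (normWord [(e, false)] * normWord [(e, true)] :
      normalizingMonoid (labFinal_comm (G := G) (K := K))) = normVertex hG (G.source e) :=
  Subtype.ext (by
    change wordVal _ _ * wordVal _ _ = G.labVertex K (G.source e)
    rw [labVertex_source, wordProj, wordVal_singleton, wordVal_singleton, letterVal, letterVal,
      star_star])

theorem normVertex_range_mul (e : E) :
    (normVertex hG (G.range e) * normWord [(e, true)] :
      normalizingMonoid (labFinal_comm (G := G) (K := K))) = normWord [(e, true)] :=
  Subtype.ext (by
    change G.labVertex K (G.range e) * wordVal _ _ = wordVal _ _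
    rw [wordVal_singleton, letterVal, labVertex_range_mul])

theorem normWord_mul_range (e : E) :
    (normWord [(e, false)] * normVertex hG (G.range e) :
      normalizingMonoid (labFinal_comm (G := G) (K := K))) = normWord [(e, false)] :=
  Subtype.ext (by
    change wordVal _ _ * G.labVertex K (G.range e) = wordVal _ _
    rw [wordVal_singleton, letterVal, ← star_labVertex, ← star_mul, labVertex_range_mul])

theorem normWord_mul_source (e : E) :
    (normWord [(e, true)] * normVertex hG (G.source e) :
      normalizingMonoid (labFinal_comm (G := G) (K := K))) = normWord [(e, true)] := by
  rw [← normWord_ghost_mul_edge]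
  refine Subtype.ext ?_
  change wordVal _ [(e, true)] * (wordVal _ (FreeGroup.invRev [(e, true)]) * wordVal _ _) = wordVal _ _
  rw [wordVal_invRev, ← mul_assoc, ← wordProj, wordVal_partialIsometry]

theorem normVertex_source_mul (e : E) :
    (normVertex hG (G.source e) * normWord [(e, false)] :
      normalizingMonoid (labFinal_comm (G := G) (K := K))) = normWord [(e, false)] := by
  rw [← normWord_ghost_mul_edge]
  refine Subtype.ext ?_
  change wordVal _ [(e, false)] * wordVal _ (FreeGroup.invRev [(e, false)]) * wordVal _ _ = wordVal _ _
  rw [wordVal_invRev, ← wordProj, wordVal_partialIsometry]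

variable (K) in
/-- The action of `L_ℂ(E, C)` on the functions on the space of characters of the final projections
in `L^{ab}_K(E, C)`. -/
def characterRep : LeavittPathAlgebra ℂ G →ₐ[ℂ] Module.End ℂ ((G.labFinal K →ₐ[K] K) → ℂ) :=
  -- The relations without sums hold, or give zero, already in the monoid of normalizing partial
  -- isometries and are carried over by multiplicativity; the two with sums come from `sum_normAct`.
  liftHom (fun v => normAct _ (normVertex hG v)) (fun e => normAct _ (normWord [(e, true)]))
    (fun e => normAct _ (normWord [(e, false)]))
    (fun v => by
      rw [← map_mul]
      exact congrArg _ (Subtype.ext (labVertex_mul_self v)))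
    (fun v w h => by
      rw [← map_mul]
      exact normAct_eq_zero (labVertex_mul_of_ne h))
    (by
      rw [← map_one (normAct (labFinal_comm (G := G) (K := K)))]
      refine (sum_normAct _ _ 1 (labVertex_mem_labFinal hG) star_labVertex labVertex_mul_self
        (fun v _ w _ h => labVertex_mul_of_ne h) (star_one (G.Lab K)) (one_mul _) ?_).symm
      exact (sum_labVertex G K).symm)
    (fun e => by rw [← map_mul, normVertex_range_mul])
    (fun e => by rw [← map_mul, normWord_mul_source])
    (fun e => by rw [← map_mul, normWord_mul_range])
    (fun e => by rw [← map_mul, normVertex_source_mul])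
    (fun e => by rw [← map_mul, normWord_ghost_mul_edge])
    (fun v X hX e he f hf h => by
      rw [← map_mul]
      refine normAct_eq_zero ?_
      change wordVal _ _ * wordVal _ _ = _
      rw [wordVal_singleton, wordVal_singleton]
      exact lab_star_mul_of_ne hX he hf h)
    (fun v X hX => by
      simp only [← map_mul]
      have h (e : E) := normAct_word_mul_invRev (G := G) (K := K) [(e, true)]
      refine sum_normAct X (fun e => normWord [(e, true)] * normWord (FreeGroup.invRev [(e, true)]))
        _ ?_ ?_ ?_ ?_ (star_labVertex v) (labVertex_mul_self v) ?_
      · intro e; rw [h]; exact wordProj_mem_labFinal _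
      · intro e; rw [h, star_wordProj]
      · intro e; rw [h, wordProj_mul_self]
      · intro e he f hf hne; rw [h, h, lab_wordProj_mul_of_ne hX he hf hne]
      · simp only [h]; exact labVertex_eq_sum hX)

theorem characterRep_letter (a : E × Bool) :
    characterRep K hG (letterVal (edge ℂ G) a) = normAct _ (normWord [a]) := by
  obtain ⟨e, _ | _⟩ := a
  · rw [letterVal, star_edge, characterRep, liftHom_ghost]
  · rw [letterVal, characterRep, liftHom_edge]

theorem characterRep_wordVal (L : List (E × Bool)) :
    characterRep K hG (wordVal (edge ℂ G) L) = normAct _ (normWord L) := by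
  induction L with
  | nil => rw [wordVal_nil, map_one]; exact (map_one _).symm
  | cons a L ih => rw [wordVal_cons, map_mul, ih, characterRep_letter, ← map_mul, normWord_mul]; rfl

theorem characterRep_wordProj (L : List (E × Bool)) :
    characterRep K hG (wordProj (edge ℂ G) L) =
      normAct _ (normWord L * normWord (FreeGroup.invRev L)) := by
  rw [wordProj, ← wordVal_invRev, map_mul, characterRep_wordVal, characterRep_wordVal, map_mul]

/-- The final projections of words act through the final projections in `L^ab_K`, and these commute.
-/
theorem characterRep_eq_zero : ∀ a ∈ G.abIdeal ℂ, characterRep K hG a = 0 :=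
  TwoSidedIdeal.map_eq_zero_of_mem_span _ fun c hc => by
    obtain ⟨u, hu, w, hw, rfl⟩ := hc
    obtain ⟨L, -, rfl⟩ := exists_wordVal_of_mem hu
    obtain ⟨M, -, rfl⟩ := exists_wordVal_of_mem hw
    change characterRep K hG (wordProj _ L * wordProj _ M - wordProj _ M * wordProj _ L) = 0
    rw [map_sub, map_mul, map_mul, characterRep_wordProj, characterRep_wordProj, ← map_mul,
      ← map_mul, sub_eq_zero]
    refine congrArg _ (Subtype.ext ?_)
    rw [Submonoid.coe_mul, Submonoid.coe_mul _ (normWord M * _), normAct_word_mul_invRev,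
      normAct_word_mul_invRev]
    exact (wordProj_commute _ L M).eq

variable (K) in
/-- The action of `L^{ab}_ℂ(E, C)` on the functions on the space of characters of the final
projections in `L^{ab}_K(E, C)`. -/
def labCharacterRep : G.Lab ℂ →ₐ[ℂ] Module.End ℂ ((G.labFinal K →ₐ[K] K) → ℂ) :=
  StarQuotient.liftAlgHom (G.abIdeal ℂ) ℂ (characterRep K hG) (characterRep_eq_zero hG)

open Classical in
theorem labCharacterRep_wordProj (L : List (E × Bool)) (f : (G.labFinal K →ₐ[K] K) → ℂ)
    (ψ : G.labFinal K →ₐ[K] K) :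
    labCharacterRep K hG (wordProj (G.labEdge ℂ) L) f ψ =
      if ψ ⟨wordProj (G.labEdge K) L, wordProj_mem_labFinal L⟩ = 1 then f ψ else 0 := by
  rw [← mk_wordProj, labCharacterRep, StarQuotient.liftAlgHom_mk, characterRep_wordProj,
    normAct_wordProj]

/-- The algebra of final projections acts by multiplication operators, each determined by its effect
on the constant function 1. Hence applying an element to 1 and evaluating at ψ is multiplicative. -/
theorem labCharacterRep_final {b : G.Lab ℂ} (hb : b ∈ finalAlgebra (G.labEdge ℂ))
    (f : (G.labFinal K →ₐ[K] K) → ℂ) (ψ : G.labFinal K →ₐ[K] K) :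
    labCharacterRep K hG b f ψ = labCharacterRep K hG b 1 ψ * f ψ := by
  induction hb using Algebra.adjoin_induction generalizing f with
  | mem b hb =>
    obtain ⟨u, hu, rfl⟩ := hb
    obtain ⟨L, -, rfl⟩ := exists_wordVal_of_mem hu
    change labCharacterRep K hG (wordProj _ L) f ψ = labCharacterRep K hG (wordProj _ L) 1 ψ * f ψ
    rw [labCharacterRep_wordProj, labCharacterRep_wordProj]
    simp
  | algebraMap c => rw [AlgHom.commutes]; simp [Module.algebraMap_end_apply]
  | add a b _ _ ha hb =>
    simp only [map_add, LinearMap.add_apply, Pi.add_apply]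
    rw [ha, hb, add_mul]
  | mul a b _ _ ha hb =>
    simp only [map_mul, Module.End.mul_apply]
    rw [ha, ha (labCharacterRep K hG b 1), hb, mul_assoc]

open Classical in
include hG in
/-- Every character of the final projections in `L^{ab}_K(E, C)` gives a point of `Ω(E, C)`. -/
theorem exists_omega (ψ : G.labFinal K →ₐ[K] K) : ∃ χ : G.Omega, ∀ L,
    χ.eval (finalWord (G.labEdge ℂ) L) =
      if ψ ⟨wordProj (G.labEdge K) L, wordProj_mem_labFinal L⟩ = 1 then 1 else 0 := by
  -- The value at ψ of the function by which `b` multiplies.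
  let ℓ : finalAlgebra (G.labEdge ℂ) →ₗ[ℂ] ℂ :=
    { toFun := fun b => labCharacterRep K hG b 1 ψ
      map_add' := fun a b => by simp
      map_smul' := fun c b => by simp }
  let χ : finalAlgebra (G.labEdge ℂ) →ₐ[ℂ] ℂ := AlgHom.ofLinearMap ℓ
    (by
      change labCharacterRep K hG (1 : G.Lab ℂ) 1 ψ = 1
      rw [map_one (labCharacterRep K hG)]; rfl)
    (fun a b => by
      change labCharacterRep K hG ((a : G.Lab ℂ) * b) 1 ψ =
        labCharacterRep K hG a 1 ψ * labCharacterRep K hG b 1 ψ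
      rw [map_mul, Module.End.mul_apply, labCharacterRep_final hG a.2])
  refine ⟨χ, fun L => ?_⟩
  change labCharacterRep K hG (wordProj (G.labEdge ℂ) L) 1 ψ = _
  rw [labCharacterRep_wordProj]
  rfl

end SeparatedGraph
end

noncomputable section

/-! ### The isomorphism for discrete fields -/

namespace SeparatedGraph
open LeavittPathAlgebra FinalSpectrum
variable {V E : Type*} [Fintype V] {G : SeparatedGraph V E} (hG : G.IsBipartite)

section Covariance
variable {K : Type*} [CommRing K] [StarRing K] [TopologicalSpace K] [IsTopologicalRing K]
  [ContinuousStar K] [DecidableEq E] {A : Type*} [Ring A] [StarRing A] [Algebra K A] {y : E → A}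
  [TameFamily y]

/-- The covariance of a representation, on the indicator functions of the ranges of words. -/
theorem covariance_clopenInd {F : Type*} [FunLike F C(G.Omega, K) A] (π : F)
    (hπ : ∀ L, π (clopenInd K (wordRange (G.labEdge ℂ) L)) = wordProj y L)
    (g : FreeGroup E) (L : List (E × Bool)) :
    wordVal y g.toWord * π (clopenInd K (wordRange (G.labEdge ℂ) L)) =
      π ((PartialAction.ofFree (edgeHomeo (G.labEdge ℂ)) (isClosed_edgeHomeo_source _)
        (isClosed_edgeHomeo_target _)).pull g (clopenInd K (wordRange (G.labEdge ℂ) L))) *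
          wordVal y g.toWord := by
  rw [pull_clopenInd, hπ, hπ, wordVal_mul_wordProj]

end Covariance

variable {K : Type*} [Field K] [StarRing K] [TopologicalSpace K]

-- If `∑ c_L p_L` were nonzero, a `K`-valued character ψ would detect it. The point χ of Ω attached
-- to ψ satisfies `1_{X_L}(χ) = ψ(p_L)`, so evaluating the relation at χ gives `ψ(∑ c_L p_L) = 0`.
-- This makes the map `1_{X_L} ↦ p_L` well defined.
include hG in
theorem linearCombination_wordProj_eq_zero [IsTopologicalRing K] (c : List (E × Bool) →₀ K)
    (hc : Finsupp.linearCombination K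
      (fun L => clopenInd K (wordRange (G.labEdge ℂ) L)) c = 0) :
    Finsupp.linearCombination K (wordProj (G.labEdge K)) c = 0 := by
  classical
  let w (L : List (E × Bool)) : G.labFinal K := ⟨wordProj (G.labEdge K) L, wordProj_mem_labFinal L⟩
  have hw : Finsupp.linearCombination K (wordProj (G.labEdge K)) c =
      (Finsupp.linearCombination K w c : G.labFinal K) := by
    change _ = (G.labFinal K).val.toLinearMap (Finsupp.linearCombination K w c)
    rw [Finsupp.apply_linearCombination]
    rfl
  rw [hw]
  by_contra hne
  have hgen : Algebra.adjoin K (Set.range w) = ⊤ := by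
    refine Eq.trans (congrArg (Algebra.adjoin K) ?_)
      (Algebra.adjoin_adjoin_coe_preimage (R := K) (s := Set.range (wordProj (G.labEdge K))))
    ext ⟨a, ha⟩
    constructor
    · rintro ⟨L, hL⟩; exact ⟨L, congrArg Subtype.val hL⟩
    · rintro ⟨L, hL⟩; exact ⟨L, Subtype.ext hL⟩
  let _ : CommRing (G.labFinal K) :=
    { (inferInstance : Ring (G.labFinal K)) with
      mul_comm := fun a b => Subtype.ext (labFinal_comm a.1 a.2 b.1 b.2) }
  obtain ⟨ψ, hψ⟩ := exists_algHom_ne_zero (K := K) (B := G.labFinal K) (S := Set.range w)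
    (by
      rintro _ ⟨L, rfl⟩
      exact Subtype.ext (wordProj_mul_self _ L))
    hgen
    (b := Finsupp.linearCombination K w c) (fun h => hne (by rw [h]; rfl))
  obtain ⟨χ, hχ⟩ := exists_omega hG (K := K) ψ
  -- The three quantities `ψ(p_L)`, `χ(p_L)` and `1_{X_L}(χ)` are 0 or 1 simultaneously, in ℂ or in
  -- `K`.
  have h1 (L) : clopenInd K (wordRange (G.labEdge ℂ) L) χ = ψ (w L) := by
    rw [clopenInd_wordRange, hχ]
    change (if (if ψ (w L) = 1 then (1 : ℂ) else 0) = 1 then (1 : K) else 0) = ψ (w L)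
    by_cases h : ψ (w L) = 1
    · simp [h]
    · have h0 : ψ (w L) * ψ (w L) = ψ (w L) := by
        rw [← map_mul]; exact congrArg ψ (Subtype.ext (wordProj_mul_self _ L))
      have h0' : ψ (w L) = 0 := by
        by_contra hne'
        exact h (mul_right_cancel₀ hne' (h0.trans (one_mul _).symm))
      simp [h0']
  refine hψ ?_
  have h2 := congrArg (fun f : C(G.Omega, K) => f χ) hc
  simp only [Finsupp.linearCombination_apply, Finsupp.sum, ContinuousMap.sum_apply,
    ContinuousMap.smul_apply, h1] at h2
  change ψ.toLinearMap (Finsupp.linearCombination K w c) = 0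
  rw [Finsupp.apply_linearCombination, Finsupp.linearCombination_apply]
  exact h2

variable [DiscreteTopology K]

variable (G K) in
theorem linearCombination_clopenInd_surjective : Function.Surjective
    (Finsupp.linearCombination K fun L => clopenInd K (wordRange (G.labEdge ℂ) L)) := by
  rw [← LinearMap.range_eq_top, Finsupp.range_linearCombination]
  exact span_clopenInd_eq_top _ K

include hG in
theorem ker_linearCombination_le :
    LinearMap.ker (Finsupp.linearCombination K
      fun L => clopenInd K (wordRange (G.labEdge ℂ) L)) ≤
    LinearMap.ker (Finsupp.linearCombination K (wordProj (G.labEdge K))) :=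
  fun c hc => linearCombination_wordProj_eq_zero hG c hc

variable (K) in
/-- The linear map from the continuous functions to `L^{ab}_K(E, C)` that sends the indicator
functions of the ranges of words to the final projections of words. -/
def funLinear : C(G.Omega, K) →ₗ[K] G.Lab K :=
  (Submodule.liftQ (LinearMap.ker
      (Finsupp.linearCombination K fun L => clopenInd K (wordRange (G.labEdge ℂ) L)))
    (Finsupp.linearCombination K (wordProj (G.labEdge K)))
      (ker_linearCombination_le hG)).comp
    (LinearMap.quotKerEquivOfSurjective _ (linearCombination_clopenInd_surjective G K)).symm.toLinearMap

theorem funLinear_clopenInd (L : List (E × Bool)) :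
    funLinear hG K (clopenInd K (wordRange (G.labEdge ℂ) L)) = wordProj (G.labEdge K) L := by
  have h : (LinearMap.quotKerEquivOfSurjective _ (linearCombination_clopenInd_surjective G K)).symm
      (clopenInd K (wordRange (G.labEdge ℂ) L)) =
        Submodule.Quotient.mk (Finsupp.single L 1) := by
    rw [LinearEquiv.symm_apply_eq]
    refine Eq.symm ((LinearMap.quotKerEquivOfSurjective_apply_mk _ _ _).trans ?_)
    rw [Finsupp.linearCombination_single, one_smul]
  rw [funLinear, LinearMap.comp_apply]
  refine (congrArg _ h).trans ?_
  rw [Submodule.liftQ_apply, Finsupp.linearCombination_single, one_smul]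

variable (K) in
/-- The `*`-homomorphism from the continuous functions to `L^{ab}_K(E, C)`. -/
def funHom : C(G.Omega, K) →⋆ₐ[K] G.Lab K :=
  { AlgHom.ofLinearMap (funLinear hG K)
      (by
        have h := funLinear_clopenInd hG (K := K) []
        rwa [wordRange, wordClopen_nil, clopenInd_top, wordProj_nil] at h)
      (fun a b => by
        have ha : a ∈ Submodule.span K (Set.range fun L => clopenInd K (wordRange (G.labEdge ℂ) L)) :=
          by rw [span_clopenInd_eq_top]; trivial
        have hb : b ∈ Submodule.span K (Set.range fun L => clopenInd K (wordRange (G.labEdge ℂ) L)) :=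
          by rw [span_clopenInd_eq_top]; trivial
        induction ha, hb using Submodule.span_induction₂ with
        | mem_mem a b ha hb =>
          obtain ⟨L, rfl⟩ := ha
          obtain ⟨M, rfl⟩ := hb
          simp only [clopenInd_mul, wordRange_inf, funLinear_clopenInd, wordProj_mul]
        | zero_left b hb => rw [zero_mul, map_zero, zero_mul]
        | zero_right b hb => rw [mul_zero, map_zero, mul_zero]
        | add_left a b c _ _ _ h1 h2 => rw [add_mul, map_add, map_add, h1, h2, add_mul]
        | add_right a b c _ _ _ h1 h2 => rw [mul_add, map_add, map_add, h1, h2, mul_add]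
        | smul_left r a b _ _ h => rw [smul_mul_assoc, map_smul, map_smul, h, smul_mul_assoc]
        | smul_right r a b _ _ h => rw [mul_smul_comm, map_smul, map_smul, h, mul_smul_comm]) with
    map_star' := fun a => by
      change funLinear hG K (star a) = star (funLinear hG K a)
      have ha : a ∈ Submodule.span K (Set.range fun L => clopenInd K (wordRange (G.labEdge ℂ) L)) :=
        by rw [span_clopenInd_eq_top]; trivial
      induction ha using Submodule.span_induction with
      | mem a ha =>
        obtain ⟨L, rfl⟩ := ha
        simp only [star_clopenInd, funLinear_clopenInd, star_wordProj]
      | zero => rw [star_zero, map_zero, star_zero]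
      | add a b _ _ ha hb => rw [star_add, map_add, map_add, star_add, ha, hb]
      | smul c a _ ha => rw [star_smul, map_smul, map_smul, star_smul, ha] }

theorem funHom_clopenInd (L : List (E × Bool)) :
    funHom hG K (clopenInd K (wordRange (G.labEdge ℂ) L)) = wordProj (G.labEdge K) L :=
  funLinear_clopenInd hG L

variable [DecidableEq E]

theorem _root_.PartialAction.pull_smul {X H R : Type*} [Group H] [TopologicalSpace X] [CommRing R] [TopologicalSpace R]
    [IsTopologicalRing R] (θ : PartialAction H X) (g : H) (c : R) (f : C(X, R)) :
    θ.pull g (c • f) = c • θ.pull g f := by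
  ext x
  by_cases hx : x ∈ θ.dom g
  · simp [θ.pull_of_mem _ hx]
  · simp [θ.pull_of_notMem _ hx]

theorem funHom_covariant (g : FreeGroup E) (h : C(G.Omega, K)) :
    wordVal (G.labEdge K) g.toWord * funHom hG K h =
      funHom hG K ((PartialAction.ofFree (edgeHomeo (G.labEdge ℂ)) (isClosed_edgeHomeo_source _)
        (isClosed_edgeHomeo_target _)).pull g h) * wordVal (G.labEdge K) g.toWord := by
  have hh : h ∈ Submodule.span K (Set.range fun L => clopenInd K (wordRange (G.labEdge ℂ) L)) := by
    rw [span_clopenInd_eq_top]; trivial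
  induction hh using Submodule.span_induction with
  | mem a ha =>
    obtain ⟨L, rfl⟩ := ha
    exact covariance_clopenInd _ (funHom_clopenInd hG) g L
  | zero =>
    have := PartialAction.pull_smul (R := K) (PartialAction.ofFree (edgeHomeo (G.labEdge ℂ))
      (isClosed_edgeHomeo_source _) (isClosed_edgeHomeo_target _)) g 0 0
    rw [zero_smul, zero_smul] at this
    rw [this, map_zero, mul_zero, zero_mul]
  | add a b _ _ ha hb =>
    rw [PartialAction.pull_add, map_add, map_add, mul_add, add_mul, ha, hb]
  | smul c a _ ha => rw [PartialAction.pull_smul, map_smul, map_smul, mul_smul_comm, smul_mul_assoc, ha]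

variable (K) in
/-- The isomorphism of `L^{ab}_K(E, C)` with the crossed product. -/
def labCrossedEquiv : G.Lab K ≃⋆ₐ[K] G.OmegaCrossed K :=
  StarAlgEquiv.ofStarAlgHom (labCrossedHom hG K)
    (covariantHom _ _ (G.labEdge K) (funHom hG K) (funHom_clopenInd hG) (funHom_covariant hG))
    (lab_starAlgHom_ext hG fun e => by
      rw [StarAlgHom.comp_apply, labCrossedHom_edge, covariantHom_wordDelta]
      rfl)
    (by
      -- On the crossed product the composite is checked on functions and on words, whose products
      -- span.
      have hfun (h : C(G.Omega, K)) : labCrossedHom hG K (funHom hG K h) = omegaIncl G K h := by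
        have hh : h ∈ Submodule.span K
            (Set.range fun L => clopenInd K (wordRange (G.labEdge ℂ) L)) := by
          rw [span_clopenInd_eq_top]; trivial
        induction hh using Submodule.span_induction with
        | mem a ha =>
          obtain ⟨L, rfl⟩ := ha
          rw [funHom_clopenInd, labCrossedHom_wordProj]
        | zero => rw [map_zero, map_zero, map_zero]
        | add a b _ _ ha hb => rw [map_add, map_add, map_add, ha, hb]
        | smul c a _ ha => rw [map_smul, map_smul, map_smul, ha]
      ext a
      change labCrossedHom hG K (covariantHom _ _ _ _ (funHom_clopenInd hG)
        (funHom_covariant hG) a) = a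
      induction a using PartialAction.CrossedProduct.induction with
      | h0 => rw [map_zero, map_zero]
      | hadd a b ha hb => rw [map_add, map_add, ha, hb]
      | hs g a =>
        rw [covariantHom_single, map_mul, hfun, labCrossedHom_wordVal, single_eq_incl_mul])

theorem labCrossedEquiv_edge (e : E) :
    labCrossedEquiv hG K (G.labEdge K e) = omegaDelta G K [(e, true)] :=
  labCrossedHom_edge hG e

end SeparatedGraph

end

noncomputable section

/-! ### Quotients of C*-algebras -/

section ApproximateUnit
variable {A : Type*} [CStarAlgebra A]

/-- In the left ideal generated by `j` there are elements `1 - v` that are approximate right units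
for `j`. -/
theorem exists_approximate_unit (j : A) {ε : ℝ} (hε : 0 < ε) :
    ∃ x v : A, 1 - v = x * j ∧ star v = v ∧ ‖v‖ ≤ 1 ∧ ‖j * v‖ ≤ ε := by
  set h := star j * j with hh
  have hsa : IsSelfAdjoint h := .star_mul_self j
  -- With `h = j*j` and `v = δ (h + δ)⁻¹`, one has `1 - v = (h + δ)⁻¹ j* j`. The absolute value
  -- keeps the function continuous on the whole line; on the spectrum of `h` it does nothing.
  set δ := ε ^ 2 with hδ
  have hδ0 : 0 < δ := by positivity
  have hden (t : ℝ) : 0 < |t| + δ := by positivity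
  have hg : Continuous fun t : ℝ => (|t| + δ)⁻¹ :=
    (continuous_abs.add continuous_const).inv₀ fun t => (hden t).ne'
  have hf : Continuous fun t : ℝ => δ * (|t| + δ)⁻¹ := continuous_const.mul hg
  set v := cfc (fun t : ℝ => δ * (|t| + δ)⁻¹) h with hv
  have hvsa : star v = v := (cfc_predicate (R := ℝ) _ h : IsSelfAdjoint v)
  refine ⟨cfc (fun t : ℝ => (|t| + δ)⁻¹) h * star j, v, ?_, hvsa, ?_, ?_⟩
  · have hmul : cfc (fun t : ℝ => (|t| + δ)⁻¹) h * h = cfc (fun t : ℝ => (|t| + δ)⁻¹ * t) h := by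
      rw [cfc_mul _ _ h hg.continuousOn (continuousOn_id' _), cfc_id' ℝ h hsa]
    rw [mul_assoc, ← hh, hmul, ← cfc_const_one ℝ h hsa, hv,
      ← cfc_sub _ _ h continuousOn_const hf.continuousOn]
    refine cfc_congr fun t ht => ?_
    have ht0 : 0 ≤ t := spectrum_star_mul_self_nonneg t ht
    have := hden t
    rw [abs_of_nonneg ht0] at *
    field_simp
    ring
  · refine norm_cfc_le zero_le_one fun t _ => ?_
    rw [Real.norm_of_nonneg (mul_nonneg hδ0.le (inv_nonneg.2 (hden t).le)), ← div_eq_mul_inv,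
      div_le_one (hden t)]
    linarith [abs_nonneg t]
  -- `‖j v‖² = ‖v h v‖` is at most the supremum of `δ² |t| / (|t| + δ)²`, which is at most `δ = ε²`.
  · have h1 : ‖j * v‖ * ‖j * v‖ ≤ ε ^ 2 := by
      rw [← CStarRing.norm_star_mul_self, star_mul, hvsa, mul_assoc, ← mul_assoc (star j), ← hh]
      have hidf : Continuous fun t : ℝ => t * (δ * (|t| + δ)⁻¹) := continuous_id.mul hf
      have : v * (h * v) = cfc (fun t : ℝ => δ * (|t| + δ)⁻¹ * (t * (δ * (|t| + δ)⁻¹))) h := by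
        rw [cfc_mul _ _ h hf.continuousOn hidf.continuousOn,
          cfc_mul _ _ h (continuousOn_id' _) hf.continuousOn, cfc_id' ℝ h hsa]
      rw [this]
      refine norm_cfc_le hδ0.le fun t _ => ?_
      have hb : ‖δ * (|t| + δ)⁻¹ * (t * (δ * (|t| + δ)⁻¹))‖ =
          δ * ((δ * |t|) / (|t| + δ) ^ 2) := by
        rw [norm_mul, norm_mul, norm_mul, norm_mul, norm_inv, Real.norm_eq_abs t,
          Real.norm_of_nonneg hδ0.le, Real.norm_of_nonneg (hden t).le]
        have := hden t
        field_simp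
      rw [hb]
      refine mul_le_of_le_one_right hδ0.le ((div_le_one (pow_pos (hden t) 2)).2 ?_)
      nlinarith [abs_nonneg t, mul_nonneg hδ0.le (abs_nonneg t), sq_nonneg (|t|), sq_nonneg δ]
    nlinarith [norm_nonneg (j * v)]

end ApproximateUnit

namespace StarQuotient
variable {A : Type*} [CStarAlgebra A] (I : TwoSidedIdeal A)

/-- The identification with the quotient by the underlying additive subgroup. -/
def toQuotient : StarQuotient I →+ A ⧸ I.asIdeal.toAddSubgroup where
  toFun := Quotient.lift (fun a => (a : A ⧸ I.asIdeal.toAddSubgroup)) fun a b hab => by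
    refine QuotientAddGroup.eq.2 ?_
    have := (TwoSidedIdeal.rel_iff I a b).1 hab
    change -a + b ∈ I.asIdeal
    rw [TwoSidedIdeal.mem_asIdeal]
    have h := I.neg_mem this
    rwa [neg_sub, sub_eq_neg_add] at h
  map_zero' := rfl
  map_add' := by
    refine ind fun a => ind fun b => ?_
    rfl

theorem toQuotient_injective : Function.Injective (toQuotient I) := by
  refine ind fun a => ind fun b => fun h => ?_
  have h' : -a + b ∈ I.asIdeal := QuotientAddGroup.eq.1 h
  rw [TwoSidedIdeal.mem_asIdeal] at h'
  have h'' := I.neg_mem h'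
  rw [neg_add, neg_neg, ← sub_eq_add_neg] at h''
  exact (RingCon.eq I.ringCon).2 ((TwoSidedIdeal.rel_iff I a b).2 h'')

theorem toQuotient_surjective : Function.Surjective (toQuotient I) := by
  intro q
  obtain ⟨a, rfl⟩ := QuotientAddGroup.mk_surjective q
  exact ⟨I.ringCon.mk' a, rfl⟩

variable [hI : IsClosed (I : Set A)]

theorem isClosed_toAddSubgroup : IsClosed (I.asIdeal.toAddSubgroup : Set A) := hI

instance : NormedAddCommGroup (StarQuotient I) :=
  have := isClosed_toAddSubgroup I
  NormedAddCommGroup.induced (StarQuotient I) (A ⧸ I.asIdeal.toAddSubgroup) (toQuotient I)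
    (toQuotient_injective I)

theorem norm_toQuotient (q : StarQuotient I) : ‖q‖ = ‖toQuotient I q‖ := rfl

theorem norm_mk'_le (a : A) : ‖(show StarQuotient I from I.ringCon.mk' a)‖ ≤ ‖a‖ :=
  QuotientAddGroup.norm_mk_le_norm

theorem exists_mk'_eq (q : StarQuotient I) {ε : ℝ} (hε : 0 < ε) :
    ∃ a : A, (show StarQuotient I from I.ringCon.mk' a) = q ∧ ‖a‖ < ‖q‖ + ε := by
  obtain ⟨a, h1, h2⟩ := QuotientAddGroup.exists_norm_mk_lt (toQuotient I q) hε
  exact ⟨a, toQuotient_injective I h1, h2⟩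

theorem norm_mul_le_mul (p q : StarQuotient I) : ‖p * q‖ ≤ ‖p‖ * ‖q‖ := by
  have ht : Filter.Tendsto (fun ε : ℝ => (‖p‖ + ε) * (‖q‖ + ε)) (nhdsWithin 0 (Set.Ioi 0))
      (nhds (‖p‖ * ‖q‖)) := by
    have : Continuous fun ε : ℝ => (‖p‖ + ε) * (‖q‖ + ε) := by fun_prop
    simpa using (this.tendsto 0).mono_left nhdsWithin_le_nhds
  refine ge_of_tendsto ht ?_
  filter_upwards [self_mem_nhdsWithin] with ε hε
  obtain ⟨a, rfl, ha⟩ := exists_mk'_eq I p hε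
  obtain ⟨b, rfl, hb⟩ := exists_mk'_eq I q hε
  exact (norm_mk'_le I (a * b)).trans ((norm_mul_le a b).trans
    (mul_le_mul ha.le hb.le (norm_nonneg b) ((norm_nonneg a).trans ha.le)))

theorem norm_smul_le_mul (c : ℂ) (q : StarQuotient I) : ‖c • q‖ ≤ ‖c‖ * ‖q‖ := by
  have ht : Filter.Tendsto (fun ε : ℝ => ‖c‖ * (‖q‖ + ε)) (nhdsWithin 0 (Set.Ioi 0))
      (nhds (‖c‖ * ‖q‖)) := by
    have : Continuous fun ε : ℝ => ‖c‖ * (‖q‖ + ε) := by fun_prop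
    simpa using (this.tendsto 0).mono_left nhdsWithin_le_nhds
  refine ge_of_tendsto ht ?_
  filter_upwards [self_mem_nhdsWithin] with ε hε
  obtain ⟨b, rfl, hb⟩ := exists_mk'_eq I q hε
  exact (norm_mk'_le I (c • b)).trans ((norm_smul_le c b).trans
    (mul_le_mul_of_nonneg_left hb.le (norm_nonneg c)))

instance : CompleteSpace (StarQuotient I) := by
  have := isClosed_toAddSubgroup I
  have hiso : Isometry (toQuotient I) :=
    AddMonoidHomClass.isometry_of_norm _ fun q => (norm_toQuotient I q).symm
  have hc : CompleteSpace (A ⧸ I.asIdeal.toAddSubgroup) := by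
    exact QuotientAddGroup.completeSpace_left A I.asIdeal.toAddSubgroup
  rw [completeSpace_iff_isComplete_range hiso.isUniformInducing,
    (toQuotient_surjective I).range_eq]
  exact isComplete_univ

instance : NormedRing (StarQuotient I) :=
  { (inferInstance : NormedAddCommGroup (StarQuotient I)),
    (inferInstance : Ring (StarQuotient I)) with
    dist_eq := fun p q => NormedAddCommGroup.dist_eq p q
    norm_mul_le := norm_mul_le_mul I }

instance : NormedAlgebra ℂ (StarQuotient I) where
  norm_smul_le := norm_smul_le_mul I

variable [I.IsStarClosed]

/-- Take a representative `b` of `q* q` of nearly minimal norm. The difference `j = b - a* a` lies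
in the ideal, and `exists_approximate_unit` gives `v` with `1 - v` in the ideal, so `a v` still
represents `q`. Then `‖q‖² ≤ ‖v a* a v‖ ≤ ‖b v - j v‖`, which is nearly at most `‖q* q‖`. -/
instance : CStarRing (StarQuotient I) where
  norm_mul_self_le := by
    refine ind fun a => ?_
    set q : StarQuotient I := I.ringCon.mk' a
    refine le_of_forall_pos_le_add fun ε hε => ?_
    obtain ⟨b, hb, hlt⟩ := exists_mk'_eq I (star q * q) (half_pos hε)
    have hj : b - star a * a ∈ I :=
      (TwoSidedIdeal.rel_iff I _ _).1 ((RingCon.eq I.ringCon).1 hb)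
    obtain ⟨x, v, h1, h2, h3, h4⟩ := exists_approximate_unit (b - star a * a) (half_pos hε)
    have hv : (1 : A) - v ∈ I := by rw [h1]; exact I.mul_mem_left _ _ hj
    have hq : q = I.ringCon.mk' (a * v) := by
      refine (RingCon.eq I.ringCon).2 ((TwoSidedIdeal.rel_iff I _ _).2 ?_)
      have := I.mul_mem_left a _ hv
      rwa [mul_sub, mul_one] at this
    have h5 : ‖q‖ ≤ ‖a * v‖ := by rw [hq]; exact norm_mk'_le I _
    calc ‖q‖ * ‖q‖ ≤ ‖a * v‖ * ‖a * v‖ := mul_self_le_mul_self (norm_nonneg _) h5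
      _ = ‖v * (star a * a * v)‖ := by
        rw [← CStarRing.norm_star_mul_self, star_mul, h2]; simp only [mul_assoc]
      _ ≤ ‖v‖ * ‖star a * a * v‖ := norm_mul_le _ _
      _ ≤ 1 * ‖star a * a * v‖ := mul_le_mul_of_nonneg_right h3 (norm_nonneg _)
      _ = ‖b * v - (b - star a * a) * v‖ := by rw [one_mul, sub_mul, sub_sub_cancel]
      _ ≤ ‖b * v‖ + ‖(b - star a * a) * v‖ := norm_sub_le _ _
      _ ≤ ‖b‖ + ε / 2 := by
        refine add_le_add ((norm_mul_le _ _).trans ?_) h4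
        exact mul_le_of_le_one_right (norm_nonneg _) h3
      _ ≤ ‖star q * q‖ + ε := by linarith

instance : CStarAlgebra (StarQuotient I) where

end StarQuotient

instance {A : Type*} [Ring A] [TopologicalSpace A] [IsTopologicalRing A] (I : TwoSidedIdeal A) :
    IsClosed (I.topClosure : Set A) := by
  have : (I.topClosure : Set A) = closure (I : Set A) := by
    ext a
    rw [SetLike.mem_coe, TwoSidedIdeal.topClosure, TwoSidedIdeal.mem_mk']
  rw [this]
  exact isClosed_closure

/-! ### The universal property of the enveloping C*-algebra -/

theorem StarAlgHom.continuous_of_cstarAlgebra {A B : Type*} [CStarAlgebra A] [CStarAlgebra B]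
    (φ : A →⋆ₐ[ℂ] B) : Continuous φ :=
  AddMonoidHomClass.continuous_of_bound φ 1 fun a => by
    rw [one_mul]; exact NonUnitalStarAlgHom.norm_apply_le φ a

/-- The norm of a C*-algebra as a C*-seminorm. -/
def CStarSeminorm.ofNorm (B : Type*) [CStarAlgebra B] : CStarSeminorm B where
  toSeminorm := normSeminorm ℂ B
  mul_le' := norm_mul_le
  star_mul_self' a := by
    change ‖star a * a‖ = ‖a‖ ^ 2
    rw [CStarRing.norm_star_mul_self, sq]

namespace CStarEnvelope
variable {A : Type*} [Ring A] [StarRing A] [Algebra ℂ A] [CStarBounded A] {B : Type*}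
  [CStarAlgebra B] (φ : A →⋆ₐ[ℂ] B)

theorem norm_apply_le_cstarSup (a : A) : ‖φ a‖ ≤ cstarSup a :=
  le_cstarSup ((CStarSeminorm.ofNorm B).comap φ) a

theorem uniformContinuous_hom : UniformContinuous fun a : PreEnvelope A => φ a := by
  let ψ : PreEnvelope A →+ B :=
    { toFun := fun a => φ a, map_zero' := map_zero φ, map_add' := map_add φ }
  exact AddMonoidHomClass.uniformContinuous_of_bound ψ 1 fun a => by
    rw [one_mul]; exact norm_apply_le_cstarSup φ a

/-- The extension of a `*`-homomorphism to the enveloping C*-algebra, as a map. -/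
def liftFun : CStarEnvelope A → B :=
  UniformSpace.Completion.extension fun a : PreEnvelope A => φ a

theorem continuous_liftFun : Continuous (liftFun φ) := UniformSpace.Completion.continuous_extension

theorem liftFun_toEnvelope (a : A) : liftFun φ (toEnvelope A a) = φ a :=
  UniformSpace.Completion.extension_coe (uniformContinuous_hom φ) a

/-- The extension of a `*`-homomorphism to the enveloping C*-algebra. -/
def lift : CStarEnvelope A →⋆ₐ[ℂ] B where
  toFun := liftFun φ
  map_one' := by rw [← map_one (toEnvelope A), liftFun_toEnvelope, map_one]
  map_zero' := by rw [← map_zero (toEnvelope A), liftFun_toEnvelope, map_zero]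
  map_add' a b := by
    refine denseRange.induction_on₂ (isClosed_eq ((continuous_liftFun φ).comp continuous_add)
      (((continuous_liftFun φ).comp continuous_fst).add
        ((continuous_liftFun φ).comp continuous_snd))) (fun a b => ?_) a b
    rw [← map_add (toEnvelope A), liftFun_toEnvelope, liftFun_toEnvelope, liftFun_toEnvelope,
      map_add]
  map_mul' a b := by
    refine denseRange.induction_on₂ (isClosed_eq ((continuous_liftFun φ).comp continuous_mul)
      (((continuous_liftFun φ).comp continuous_fst).mul
        ((continuous_liftFun φ).comp continuous_snd))) (fun a b => ?_) a b
    rw [← map_mul (toEnvelope A), liftFun_toEnvelope, liftFun_toEnvelope, liftFun_toEnvelope,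
      map_mul]
  commutes' c := by
    rw [← AlgHom.commutes (toEnvelope A), liftFun_toEnvelope, AlgHomClass.commutes]
  map_star' a := by
    refine denseRange.induction_on a (isClosed_eq ((continuous_liftFun φ).comp continuous_star')
      ((continuous_liftFun φ).star)) fun a => ?_
    rw [star_toEnvelope, liftFun_toEnvelope, liftFun_toEnvelope, map_star]

theorem lift_of (a : A) : lift φ (of A a) = φ a := liftFun_toEnvelope φ a

theorem hom_ext [StarModule ℂ A] {φ ψ : CStarEnvelope A →⋆ₐ[ℂ] B}
    (h : ∀ a, φ (of A a) = ψ (of A a)) : φ = ψ := by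
  ext a
  exact denseRange.induction_on a (isClosed_eq φ.continuous_of_cstarAlgebra
    ψ.continuous_of_cstarAlgebra) h

end CStarEnvelope

end

noncomputable section

/-! ### Representations of the continuous functions on the spectrum of a tame family -/

namespace FinalSpectrum
variable {A E D : Type*} [Ring A] [StarRing A] [Algebra ℂ A] (x : E → A) [TameFamily x]
  [CStarAlgebra D]

/-- A `*`-homomorphism to a C*-algebra induces a representation of the continuous functions on the
spectrum of a tame family. -/
theorem exists_starAlgHom (φ : A →⋆ₐ[ℂ] D) :
    ∃ π : C(FinalSpectrum x, ℂ) →⋆ₐ[ℂ] D,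
      ∀ L, π (clopenInd ℂ (wordRange x L)) = φ (wordProj x L) := by
  have hcomm : ∀ a ∈ Set.range fun L => φ (wordProj x L),
      ∀ b ∈ Set.range fun L => φ (wordProj x L), a * b = b * a := by
    rintro _ ⟨L, rfl⟩ _ ⟨M, rfl⟩
    simp only [← map_mul, (wordProj_commute x L M).eq]
  have hadj : IsMulCommutative (StarAlgebra.adjoin ℂ (Set.range fun L => φ (wordProj x L))) :=
    StarAlgebra.isMulCommutative_adjoin ℂ hcomm (by
      rintro a ha _ ⟨M, rfl⟩
      rw [← map_star, star_wordProj]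
      exact hcomm a ha _ ⟨M, rfl⟩)
  -- The commutative C*-algebra generated by the images of the final projections, to which Gelfand
  -- duality applies.
  let S : StarSubalgebra ℂ D :=
    (StarAlgebra.adjoin ℂ (Set.range fun L => φ (wordProj x L))).topologicalClosure
  have hS : IsClosed (S : Set D) := StarSubalgebra.isClosed_topologicalClosure _
  have hmul : ∀ a b : S, a * b = b * a :=
    (StarSubalgebra.commRingTopologicalClosure
      (StarAlgebra.adjoin ℂ (Set.range fun L => φ (wordProj x L))) hadj.is_comm.comm).mul_comm
  let _ : CommCStarAlgebra S :=
    { (inferInstance : CStarAlgebra S) with mul_comm := hmul }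
  have hmem (L : List (E × Bool)) : φ (wordProj x L) ∈ S :=
    StarSubalgebra.le_topologicalClosure _ (StarAlgebra.subset_adjoin ℂ _ ⟨L, rfl⟩)
  have hfin (b : finalAlgebra x) : φ b ∈ S := by
    obtain ⟨b, hb⟩ := b
    induction hb using Algebra.adjoin_induction with
    | mem b hb =>
      obtain ⟨u, hu, rfl⟩ := hb
      obtain ⟨L, -, rfl⟩ := exists_wordVal_of_mem hu
      exact hmem L
    | algebraMap c =>
      change φ (algebraMap ℂ A c) ∈ S
      rw [AlgHomClass.commutes]
      exact algebraMap_mem S c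
    | add a b _ _ ha hb => exact (map_add φ a b).symm ▸ add_mem ha hb
    | mul a b _ _ ha hb => exact (map_mul φ a b).symm ▸ mul_mem ha hb
  let ψ : finalAlgebra x →ₐ[ℂ] S :=
    (φ.toAlgHom.comp (finalAlgebra x).val).codRestrict S.toSubalgebra hfin
  -- Characters of `S` restrict along φ to characters of the algebra of final projections; this is
  -- the map dual to the representation sought.
  let F : C(WeakDual.characterSpace ℂ S, FinalSpectrum x) :=
    { toFun := fun c => (WeakDual.CharacterSpace.toAlgHom c).comp ψ
      continuous_toFun := continuous_induced_rng.2 (continuous_pi fun b =>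
        (WeakDual.eval_continuous (ψ b)).comp continuous_subtype_val) }
  refine ⟨S.subtype.comp ((gelfandStarTransform S).symm.toStarAlgHom.comp
    (ContinuousMap.compStarAlgHom' ℂ ℂ F)), fun L => ?_⟩
  -- At a character `c` both sides equal `c(φ(p_L))`, by `eval_finalWord`.
  have h : ContinuousMap.compStarAlgHom' ℂ ℂ F (clopenInd ℂ (wordRange x L)) =
      gelfandStarTransform S ⟨φ (wordProj x L), hmem L⟩ := by
    ext c
    exact (eval_finalWord x L (F c)).symm
  change ((gelfandStarTransform S).symm (ContinuousMap.compStarAlgHom' ℂ ℂ F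
    (clopenInd ℂ (wordRange x L))) : D) = _
  rw [h, StarAlgEquiv.symm_apply_apply]

end FinalSpectrum

/-! ### The isomorphism of C*-algebras -/

/-- Translation extended by zero is contractive, so covariance is a closed condition on functions.
-/
theorem PartialAction.continuous_pull {X H : Type*} [Group H] [TopologicalSpace X] [CompactSpace X]
    (θ : PartialAction H X) (g : H) :
    Continuous (θ.pull g : C(X, ℂ) → C(X, ℂ)) := by
  let ℓ : C(X, ℂ) →+ C(X, ℂ) := AddMonoidHom.mk' (θ.pull g) (θ.pull_add g)
  refine AddMonoidHomClass.continuous_of_bound ℓ 1 fun f => ?_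
  rw [one_mul]
  refine (ContinuousMap.norm_le _ (norm_nonneg f)).2 fun x => ?_
  change ‖θ.pull g f x‖ ≤ ‖f‖
  by_cases hx : x ∈ θ.dom g
  · rw [θ.pull_of_mem f hx]; exact f.norm_coe_le_norm _
  · rw [θ.pull_of_notMem f hx, norm_zero]; exact norm_nonneg f

namespace SeparatedGraph
open LeavittPathAlgebra FinalSpectrum
variable {V E : Type*} [Fintype V] {G : SeparatedGraph V E} (hG : G.IsBipartite)

theorem map_mem_wordSemigroup {A B F : Type*} [Ring A] [StarRing A] [Ring B] [StarRing B]
    [FunLike F A B] [RingHomClass F A B] [StarHomClass F A B] (φ : F) {x : E → A} {u : A}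
    (hu : u ∈ wordSemigroup x) : φ u ∈ wordSemigroup fun e => φ (x e) := by
  obtain ⟨L, hL, rfl⟩ := exists_wordVal_of_mem hu
  rw [map_wordVal]
  exact wordVal_mem _ hL

variable (G) in
/-- The canonical `*`-homomorphism `L^{ab}_ℂ(E, C) → 𝒪(E, C)`. -/
def labToTame : G.Lab ℂ →⋆ₐ[ℂ] G.TameCStar :=
  StarQuotient.lift (G.abIdeal ℂ) ℂ
    ((StarQuotient.mk G.commIdeal.topClosure ℂ).comp (CStarEnvelope.of (LeavittPathAlgebra ℂ G)))
    (TwoSidedIdeal.map_eq_zero_of_mem_span _ fun c hc => by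
      obtain ⟨u, hu, w, hw, rfl⟩ := hc
      rw [StarAlgHom.comp_apply, ← (StarQuotient.mk G.commIdeal.topClosure ℂ).map_zero]
      refine (StarQuotient.mk_eq_iff _ _).2 ?_
      rw [sub_zero, TwoSidedIdeal.topClosure, TwoSidedIdeal.mem_mk']
      refine subset_closure (TwoSidedIdeal.subset_span ?_)
      exact ⟨_, map_mem_wordSemigroup _ hu, _, map_mem_wordSemigroup _ hw, by
        simp only [map_sub, map_mul, map_star]⟩)

instance : TameFamily G.tameEdge := TameFamily.map (G.labEdge ℂ) (labToTame G)

theorem labToTame_wordProj (L : List (E × Bool)) :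
    labToTame G (wordProj (G.labEdge ℂ) L) = wordProj G.tameEdge L :=
  map_wordProj _ _ L

variable (G) in
/-- The representation of the continuous functions on `Ω(E, C)` in `𝒪(E, C)`. -/
def tameFun : C(G.Omega, ℂ) →⋆ₐ[ℂ] G.TameCStar :=
  (exists_starAlgHom (G.labEdge ℂ) (labToTame G)).choose

theorem tameFun_clopenInd (L : List (E × Bool)) :
    tameFun G (clopenInd ℂ (wordRange (G.labEdge ℂ) L)) = wordProj G.tameEdge L :=
  ((exists_starAlgHom (G.labEdge ℂ) (labToTame G)).choose_spec L).trans (labToTame_wordProj L)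

/-- A closed condition on continuous functions that is linear and holds for the indicator functions
of the ranges of words holds for all continuous functions. -/
theorem omega_fun_induction {p : C(G.Omega, ℂ) → Prop} (hp : IsClosed {f | p f})
    (hw : ∀ L, p (clopenInd ℂ (wordRange (G.labEdge ℂ) L))) (hadd : ∀ f g, p f → p g → p (f + g))
    (hsmul : ∀ (c : ℂ) f, p f → p (c • f)) (f : C(G.Omega, ℂ)) : p f := by
  refine (dense_span_clopenInd (G.labEdge ℂ)).induction (fun f hf => ?_) hp f
  induction hf using Submodule.span_induction with
  | mem f hf =>
    obtain ⟨L, rfl⟩ := hf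
    exact hw L
  | zero => simpa using hsmul 0 _ (hw [])
  | add f g _ _ hf hg => exact hadd f g hf hg
  | smul c f _ hf => exact hsmul c f hf

variable [DecidableEq E]

/-- Covariance is linear and closed in the function, so it need only be checked on the dense span of
the `1_{X_L}`. -/
theorem tameFun_covariant (g : FreeGroup E) (h : C(G.Omega, ℂ)) :
    wordVal G.tameEdge g.toWord * tameFun G h =
      tameFun G ((PartialAction.ofFree (edgeHomeo (G.labEdge ℂ)) (isClosed_edgeHomeo_source _)
        (isClosed_edgeHomeo_target _)).pull g h) * wordVal G.tameEdge g.toWord := by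
  have hc := (tameFun G).continuous_of_cstarAlgebra
  induction h using omega_fun_induction with
  | hp =>
    exact isClosed_eq (continuous_const.mul hc)
      ((hc.comp (PartialAction.continuous_pull _ g)).mul continuous_const)
  | hw L => exact covariance_clopenInd _ tameFun_clopenInd g L
  | hadd a b ha hb => rw [PartialAction.pull_add, map_add, map_add, mul_add, add_mul, ha, hb]
  | hsmul c a ha => rw [PartialAction.pull_smul, map_smul, map_smul, mul_smul_comm, smul_mul_assoc, ha]

variable (G) in
/-- The `*`-homomorphism from the full crossed product to `𝒪(E, C)`. -/
def crossedToTame : CStarEnvelope (G.OmegaCrossed ℂ) →⋆ₐ[ℂ] G.TameCStar :=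
  CStarEnvelope.lift
    (covariantHom _ _ G.tameEdge (tameFun G) tameFun_clopenInd tameFun_covariant)

theorem crossedToTame_of_delta (e : E) :
    crossedToTame G (CStarEnvelope.of _ (omegaDelta G ℂ [(e, true)])) = G.tameEdge e :=
  (CStarEnvelope.lift_of _ _).trans (covariantHom_wordDelta _ _ _ _ _ _ e)

/-- The `*`-homomorphism from `C*(E, C)` to the full crossed product. -/
def cstarToCrossed : G.GraphCStar →⋆ₐ[ℂ] CStarEnvelope (G.OmegaCrossed ℂ) :=
  CStarEnvelope.lift ((CStarEnvelope.of (G.OmegaCrossed ℂ)).comp (crossedHom hG ℂ))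

theorem cstarToCrossed_of (a : LeavittPathAlgebra ℂ G) :
    cstarToCrossed hG (CStarEnvelope.of _ a) = CStarEnvelope.of _ (crossedHom hG ℂ a) :=
  CStarEnvelope.lift_of _ a

theorem cstarToCrossed_commutator {c : G.GraphCStar} (hc : c ∈ finalCommutators G.cstarEdge) :
    cstarToCrossed hG c = 0 := by
  obtain ⟨u, hu, w, hw, rfl⟩ := hc
  obtain ⟨u, hu', rfl⟩ := exists_of_mem_wordSemigroup_map (CStarEnvelope.of _) hu
  obtain ⟨w, hw', rfl⟩ := exists_of_mem_wordSemigroup_map (CStarEnvelope.of _) hw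
  simp only [← map_star, ← map_mul, ← map_sub]
  rw [cstarToCrossed_of, crossedHom_commutator hG ⟨u, hu', w, hw', rfl⟩, map_zero]

theorem cstarToCrossed_eq_zero (a : G.GraphCStar) (ha : a ∈ G.commIdeal.topClosure) :
    cstarToCrossed hG a = 0 := by
  have h : Set.MapsTo (cstarToCrossed hG) G.commIdeal {0} :=
    TwoSidedIdeal.map_eq_zero_of_mem_span _ fun _ hc => cstarToCrossed_commutator hG hc
  rw [TwoSidedIdeal.topClosure, TwoSidedIdeal.mem_mk'] at ha
  have := h.closure (cstarToCrossed hG).continuous_of_cstarAlgebra ha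
  rwa [closure_singleton] at this

/-- The `*`-homomorphism from `𝒪(E, C)` to the full crossed product. -/
def tameToCrossed : G.TameCStar →⋆ₐ[ℂ] CStarEnvelope (G.OmegaCrossed ℂ) :=
  StarQuotient.lift G.commIdeal.topClosure ℂ (cstarToCrossed hG) (cstarToCrossed_eq_zero hG)

theorem tameToCrossed_edge (e : E) :
    tameToCrossed hG (G.tameEdge e) = CStarEnvelope.of _ (omegaDelta G ℂ [(e, true)]) :=
  (cstarToCrossed_of hG _).trans (congrArg _ (crossedHom_edge hG e))

theorem tameToCrossed_labToTame (a : G.Lab ℂ) :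
    tameToCrossed hG (labToTame G a) = CStarEnvelope.of _ (labCrossedHom hG ℂ a) := by
  obtain ⟨a, rfl⟩ := StarQuotient.mk_surjective (G.abIdeal ℂ) ℂ a
  exact cstarToCrossed_of hG a

theorem tameToCrossed_tameFun (f : C(G.Omega, ℂ)) :
    tameToCrossed hG (tameFun G f) = CStarEnvelope.of _ (omegaIncl G ℂ f) := by
  have h1 := (tameToCrossed hG).continuous_of_cstarAlgebra.comp
    (tameFun G).continuous_of_cstarAlgebra
  have h2 := ((CStarEnvelope.of (G.OmegaCrossed ℂ)).comp (omegaIncl G ℂ)).continuous_of_cstarAlgebra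
  induction f using omega_fun_induction with
  | hp => exact isClosed_eq h1 h2
  | hw L => rw [tameFun_clopenInd, ← labToTame_wordProj, tameToCrossed_labToTame,
      labCrossedHom_wordProj]
  | hadd a b ha hb => simp only [map_add, ha, hb]
  | hsmul c a ha => simp only [map_smul, ha]

theorem tameToCrossed_wordVal (L : List (E × Bool)) :
    tameToCrossed hG (wordVal G.tameEdge L) = CStarEnvelope.of _ (omegaDelta G ℂ L) := by
  rw [← labCrossedHom_wordVal hG, ← tameToCrossed_labToTame]
  exact congrArg _ (map_wordVal (G.labEdge ℂ) (labToTame G) L).symm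

/-- The isomorphism of `𝒪(E, C)` with the full crossed product. -/
def tameCrossedEquiv : G.TameCStar ≃⋆ₐ[ℂ] CStarEnvelope (G.OmegaCrossed ℂ) :=
  StarAlgEquiv.ofStarAlgHom (tameToCrossed hG) (crossedToTame G)
    (by
      -- The composite fixes the edges, which generate the Leavitt path algebra as a `*`-algebra;
      -- that algebra is dense in `C*(E, C)`, which maps onto `𝒪(E, C)`.
      have : ((crossedToTame G).comp (tameToCrossed hG)).comp
          (StarQuotient.mk G.commIdeal.topClosure ℂ) =
            StarQuotient.mk G.commIdeal.topClosure ℂ := by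
        refine CStarEnvelope.hom_ext fun a => ?_
        refine DFunLike.congr_fun (f := (((crossedToTame G).comp (tameToCrossed hG)).comp
          (StarQuotient.mk G.commIdeal.topClosure ℂ)).comp (CStarEnvelope.of _))
          (g := (StarQuotient.mk G.commIdeal.topClosure ℂ).comp (CStarEnvelope.of _))
          (starAlgHom_ext hG fun e => ?_) a
        change crossedToTame G (tameToCrossed hG (G.tameEdge e)) = G.tameEdge e
        rw [tameToCrossed_edge, crossedToTame_of_delta]
      ext a
      obtain ⟨a, rfl⟩ := StarQuotient.mk_surjective G.commIdeal.topClosure ℂ a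
      exact DFunLike.congr_fun this a)
    -- By density it is enough to treat the algebraic crossed product, and there functions times
    -- words.
    (CStarEnvelope.hom_ext fun a => by
      change tameToCrossed hG (CStarEnvelope.lift _ (CStarEnvelope.of _ a)) = CStarEnvelope.of _ a
      rw [CStarEnvelope.lift_of]
      induction a using PartialAction.CrossedProduct.induction with
      | h0 => simp only [map_zero]
      | hadd a b ha hb => simp only [map_add, ha, hb]
      | hs g a =>
        rw [covariantHom_single, map_mul, tameToCrossed_tameFun, tameToCrossed_wordVal,
          single_eq_incl_mul, map_mul])

theorem tameCrossedEquiv_edge (e : E) :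
    tameCrossedEquiv hG (G.tameEdge e) = CStarEnvelope.of _ (omegaDelta G ℂ [(e, true)]) :=
  tameToCrossed_edge hG e

end SeparatedGraph

end

/-! ### The two isomorphisms -/

theorem corollary6p9 {V E : Type*} [Fintype V] [Finite E] [DecidableEq E]
    (G : SeparatedGraph V E) (hG : G.IsBipartite) :
    (∀ (K : Type*) [Field K] [StarRing K] [TopologicalSpace K] [DiscreteTopology K],
      ∃ Φ : G.Lab K ≃⋆ₐ[K] G.freeAction.CrossedProduct K,
        ∀ e, Φ (G.labEdge K e) = PartialAction.CrossedProduct.delta (FreeGroup.of e)) ∧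
    ∃ Ψ : G.TameCStar ≃⋆ₐ[ℂ] G.freeAction.FullCrossedProduct,
      ∀ e, Ψ (G.tameEdge e) =
        CStarEnvelope.of _ (PartialAction.CrossedProduct.delta (FreeGroup.of e)) := by
  -- `freeAction` unfolds to the partial action used in `OmegaCrossed`, so only `1_{H_e} δ_e`
  -- remains to be identified with the one-letter word.
  refine ⟨fun K _ _ _ _ => ⟨SeparatedGraph.labCrossedEquiv hG K, fun e => ?_⟩,
    SeparatedGraph.tameCrossedEquiv hG, fun e => ?_⟩
  · exact (SeparatedGraph.labCrossedEquiv_edge hG e).trans (delta_of_eq _ _ e).symm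
  · exact (SeparatedGraph.tameCrossedEquiv_edge hG e).trans
      (congrArg _ (delta_of_eq _ _ e).symm)
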